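/- **Setting.** Let $\Omega\subset\mathbb R^2$ be a polygonal domain with Lipschitz boundary $\Gamma$, and let $\mathfrak M$ be a conforming triangulation of $\Omega$ with shape-regularity constant $\rho$ (each triangle $T$ contains a disc of radius $r$ with $\operatorname{diam}T\le\rho r$). Let $\mathcal H_h$ be the space of continuous, piecewise affine functions on $\mathfrak M$, with nodes $\mathfrak N$, boundary nodes $\mathfrak N^\Gamma$, nodal basis $\phi_p$ and nodal interpolation $I_h$. Let $G_c,\varepsilon,\mu,\lambda>0$ and $0<\kappa<1$. Let $u_h$ be a continuous, piecewise affine vector field with strain $E(u_h)=\frac12(\nabla u_h+\nabla u_h^T)$, let $E^+$ be its positive part (positive parts of the eigenvalues), and let $\sigma^+(u_h)=2\mu E^+(u_h)+\lambda\max\{0,\operatorname{tr}E(u_h)\}\mathbf I$. Put $q=\frac{G_c}{\varepsilon}+(1-\kappa)\,\sigma^+(u_h):E(u_h)$ and $$a(\zeta,\psi)=\int_\Omega q\,\zeta\psi+G_c\varepsilon\int_\Omega\nabla\zeta\cdot\nabla\psi,\qquad \|\psi\|_\varepsilon=a(\psi,\psi)^{1/2},\qquad \|F\|_{*,\varepsilon}=\sup_{\psi\in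 H^1(\Omega)}\frac{\langle F,\psi\rangle}{\|\psi\|_\varepsilon}.$$ Let $\chi=I_h\varphi_h^{n-1}$ be the obstacle given by the previous time step. Let $\varphi_h\in\mathcal K_h=\{\psi_h\in\mathcal H_h:\psi_h(p)\le\chi(p)\ \forall p\in\mathfrak N\}$ satisfy $a(\varphi_h,\psi_h-\varphi_h)\ge\langle\frac{G_c}\varepsilon,\psi_h-\varphi_h\rangle$ for all $\psi_h\in\mathcal K_h$, and let $\hat\varphi\in\mathcal K=\{\psi\in H^1(\Omega):\psi\le\chi\}$ satisfy $a(\hat\varphi,\psi-\hat\varphi)\ge\langle\frac{G_c}\varepsilon,\psi-\hat\varphi\rangle$ for all $\psi\in\mathcal K$. Put $\langle\hat\Lambda,\psi\rangle=\langle\frac{G_c}\varepsilon,\psi\rangle-a(\hat\varphi,\psi)$ and $\langle\mathcal R,\psi\rangle=\langle\frac{G_c}\varepsilon,\psi\rangle-a(\varphi_h,\psi)$. **Local quantities.** For $p\in\mathfrak N$ let $\omega_p$ be the interior of the union of the triangles with vertex $p$, $h_p=\operatorname{diam}\omega_p$, $\alpha_p=\min_{\omega_p}q$, $\gamma_p^I$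 the union of the sides in the interior of $\omega_p$, $\gamma_p^\Gamma=\Gamma\cap\partial\omega_p$, and $\tilde\omega_p$ the patch of $p$ after two uniform red refinements. On an interior side between $T$ and $T'$ let $[\nabla\varphi_h]=\nabla\varphi_h|_T\cdot n_T-\nabla\varphi_h|_{T'}\cdot n_T$. Let $n$ be the outer normal on $\Gamma$, and let $r=\frac{G_c}\varepsilon+G_c\varepsilon\Delta\varphi_h-q\varphi_h$ elementwise, $s_p=\langle\mathcal R,\phi_p\rangle/\int_{\omega_p}\phi_p$ and $c_p(\psi)=\int_{\tilde\omega_p}\psi\phi_p/\int_{\tilde\omega_p}\phi_p$. A node $p$ is a *full-contact node* ($p\in\mathfrak N^{fC}$) if $\varphi_h=\chi$ on $\omega_p$ and $\langle\mathcal R,v\rangle\ge0$ for all $0\le v\in H^1_0(\omega_p)$; if $p\in\Gamma$, then $v$ has to vanish on $\partial\omega_p\setminus\Gamma$ only. It is a *semi-contact node* ($p\in\mathfrak N^{sC}$) if $\varphi_h(p)=\chi(p)$ and $p\notin\mathfrak N^{fC}$. The quasi-discrete constraining force is $$\langle\tilde\Lambda_h,\psi\rangle=\sum_{p\in\mathfrak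 N^{fC}}\ell_p(\psi)+\sum_{p\in\mathfrak N^{sC}}\ell_p(c_p(\psi)),\qquad \ell_p(v)=\int_{\omega_p}r\,v\,\phi_p-\int_{\gamma_p^I}G_c\varepsilon[\nabla\varphi_h]\,v\,\phi_p-\int_{\gamma_p^\Gamma}G_c\varepsilon(\nabla\varphi_h\cdot n)\,v\,\phi_p .$$ **Estimator.** With $m_p=\min\{h_p/\sqrt{G_c\varepsilon},\alpha_p^{-1/2}\}$ let $\eta=\eta_1+\eta_2+\eta_3+\eta_4$, where $$\eta_1^2=\sum_{p\in\mathfrak N\setminus\mathfrak N^{fC}}m_p^2\|r\|_{\omega_p}^2,\qquad \eta_2^2=\sum_{p\in\mathfrak N\setminus\mathfrak N^{fC}}m_p(G_c\varepsilon)^{-1/2}\|G_c\varepsilon[\nabla\varphi_h]\|^2_{\gamma_p^I},$$ $$\eta_3^2=\sum_{p\in\mathfrak N^\Gamma\setminus\mathfrak N^{fC}}m_p(G_c\varepsilon)^{-1/2}\|G_c\varepsilon\nabla\varphi_h\cdot n\|^2_{\gamma_p^\Gamma},\qquad \eta_4^2=\sum_{p\in\mathfrak N^{sC}}s_p\int_{\tilde\omega_p}(\chi-\varphi_h)\phi_p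 .$$ **Theorem (reliability of the error estimator).** There is a constant $C$ that depends only on the shape-regularity constant $\rho$ (in particular not on $\varepsilon$, the mesh size or the other data) such that $$\|\hat\varphi-\varphi_h\|_\varepsilon+\|\hat\Lambda-\tilde\Lambda_h\|_{*,\varepsilon}\le C\,\eta .$$ -/

import Mathlib

open MeasureTheory Filter Topology
open scoped ENNReal ContDiff

noncomputable section

namespace PhaseField

/-- The Euclidean plane. -/
abbrev E := EuclideanSpace ℝ (Fin 2)

/-! ### The Sobolev space `H¹(U)` -/

/-- `G` is a weak gradient of `u` on the open set `U`. -/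
def HasWeakGrad (U : Set E) (u : E → ℝ) (G : E → E) : Prop :=
  ∀ η : E → ℝ, ContDiff ℝ ∞ η → HasCompactSupport η → tsupport η ⊆ U →
    ∫ x in U, u x • gradient η x = - ∫ x in U, η x • G x

/-- `G` is a square integrable weak gradient of `u` on `U`. -/
def HasL2WeakGrad (U : Set E) (u : E → ℝ) (G : E → E) : Prop :=
  MemLp G 2 (volume.restrict U) ∧ HasWeakGrad U u G

/-- `u ∈ H¹(U)`; values of `u` outside `U` are irrelevant. -/
def MemH1 (U : Set E) (u : E → ℝ) : Prop :=
  MemLp u 2 (volume.restrict U) ∧ ∃ G : E → E, HasL2WeakGrad U u G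

open Classical in
/-- The weak gradient of `u` on `U` (a.e. unique for `u ∈ H¹(U)`). -/
def weakGrad (U : Set E) (u : E → ℝ) : E → E :=
  if h : ∃ G : E → E, HasL2WeakGrad U u G then h.choose else 0

/-- Length measure on the segment spanned by the end points in `s`. -/
def sideMeasure (s : Finset E) : Measure E :=
  (μH[1] : Measure E).restrict (convexHull ℝ (s : Set E))

/-- `g ∈ L²(s)` is the trace on the side `s ⊆ closure U` of `ψ ∈ H¹(U)`: the limit in `L²(s)` of the
restrictions of smooth functions that converge to `ψ` in `H¹(U)`. -/
def IsTrace (U : Set E) (s : Finset E) (ψ g : E → ℝ) : Prop :=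
  MemLp g 2 (sideMeasure s) ∧ ∃ f : ℕ → E → ℝ, (∀ k, ContDiff ℝ ∞ (f k)) ∧
    Tendsto (fun k => eLpNorm (fun x => f k x - ψ x) 2 (volume.restrict U)) atTop (𝓝 0) ∧
    Tendsto (fun k => eLpNorm (fun x => gradient (f k) x - weakGrad U ψ x) 2
      (volume.restrict U)) atTop (𝓝 0) ∧
    Tendsto (fun k => eLpNorm (fun x => f k x - g x) 2 (sideMeasure s)) atTop (𝓝 0)

open Classical in
/-- The trace of `ψ ∈ H¹(U)` on the side `s`. -/
def trace (U : Set E) (s : Finset E) (ψ : E → ℝ) : E → ℝ :=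
  if h : ∃ g : E → ℝ, IsTrace U s ψ g then h.choose else 0

/-! ### Domains and meshes -/

/-- A (bounded) polygonal domain: open, connected, its closure a finite union of triangles, lying on
one side of its boundary (no slits, no isolated points removed), with no boundary point at which the
domain touches itself.  For polygons this says that the boundary is Lipschitz. -/
structure IsPolygonalDomain (Ω : Set E) : Prop where
  isOpen : IsOpen Ω
  isConnected : IsConnected Ω
  polygonal : ∃ P : Finset (Finset E),
    (∀ T ∈ P, T.card = 3 ∧ AffineIndependent ℝ ((↑) : T → E)) ∧
    ⋃ T ∈ P, convexHull ℝ (T : Set E) = closure Ω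
  interior_closure : interior (closure Ω) = Ω
  locally_connected : ∀ x ∈ frontier Ω, ∀ᶠ r in 𝓝[>] (0 : ℝ), IsConnected (Ω ∩ Metric.ball x r)

/-- A conforming triangulation of `Ω`; each triangle is given by its set of vertices. -/
structure Triangulation (Ω : Set E) where
  elems : Finset (Finset E)
  card_eq : ∀ T ∈ elems, T.card = 3
  indep : ∀ T ∈ elems, AffineIndependent ℝ ((↑) : T → E)
  conforming : ∀ T ∈ elems, ∀ T' ∈ elems,
    convexHull ℝ (T : Set E) ∩ convexHull ℝ (T' : Set E) = convexHull ℝ ((T : Set E) ∩ T')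
  cover : ⋃ T ∈ elems, convexHull ℝ (T : Set E) = closure Ω

namespace Triangulation

variable {Ω : Set E} (M : Triangulation Ω)

/-- Shape regularity with constant `ρ`: each triangle `T` contains a disc of radius `r > 0` with
`diam T ≤ ρ r`. -/
def ShapeRegular (ρ : ℝ) : Prop :=
  ∀ T ∈ M.elems, ∃ c : E, ∃ r : ℝ, 0 < r ∧
    Metric.closedBall c r ⊆ convexHull ℝ (T : Set E) ∧
    Metric.diam (convexHull ℝ (T : Set E)) ≤ ρ * r

open Classical in
/-- The nodes `𝔑`. -/
def nodes : Finset E := M.elems.biUnion id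

open Classical in
/-- The sides; a side is given by the set of its two end points. -/
def sides : Finset (Finset E) := M.elems.biUnion (Finset.powersetCard 2)

open Classical in
/-- The nodes `𝔑^Γ` on the boundary. -/
def boundaryNodes : Finset E := M.nodes.filter (· ∈ frontier Ω)

open Classical in
/-- The elements that contain the vertex set `s`. -/
def elemsAt (s : Finset E) : Finset (Finset E) := M.elems.filter (s ⊆ ·)

/-- The patch of a vertex set `s`: the interior of the union of all elements containing `s`.
`patch {p}` is `ω_p`, and for a side `s`, `patch s` is `ω_s`. -/
def patch (s : Finset E) : Set E :=
  interior (⋃ T ∈ M.elemsAt s, convexHull ℝ (T : Set E))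

/-- The patch `ω̃_p` around `p` after two uniform red refinements.  One red refinement cuts each
triangle at the midpoints of its sides, so that the subtriangle at the vertex `p` is the image of
the triangle under the homothety with centre `p` and ratio `1/2`. -/
def smallPatch (p : E) : Set E := AffineMap.homothety p ((1 / 4 : ℝ)) '' M.patch {p}

/-- `h_p`. -/
def diamPatch (p : E) : ℝ := Metric.diam (M.patch {p})

open Classical in
/-- The sides making up `γ_p^I`: the interior sides (shared by two elements) that contain `p`. -/
def skeleton (p : E) : Finset (Finset E) :=
  M.sides.filter fun s => p ∈ s ∧ (M.elemsAt s).card = 2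

open Classical in
/-- The sides making up `γ_p^Γ = Γ ∩ ∂ω_p`: the boundary sides (those belonging to only one element)
of the elements of the patch. -/
def boundarySkeleton (p : E) : Finset (Finset E) :=
  M.sides.filter fun s => (M.elemsAt s).card = 1 ∧ ∃ T ∈ M.elemsAt {p}, s ⊆ T

/-- Continuous, piecewise affine finite element functions. -/
def IsP1 {V : Type*} [NormedAddCommGroup V] [NormedSpace ℝ V] (v : E → V) : Prop :=
  ContinuousOn v (closure Ω) ∧
    ∀ T ∈ M.elems, ∃ A : E →ᵃ[ℝ] V, Set.EqOn v A (convexHull ℝ (T : Set E))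

/-- The nodal basis function `φ_p`: at a point `x` of an element with vertex `p` it is the barycentric
coordinate of `x` with respect to `p`, elsewhere it is `0`. (The set below is a singleton
or empty.) -/
def hat (p : E) (x : E) : ℝ :=
  sSup {t : ℝ | ∃ T ∈ M.elemsAt {p}, ∃ w : E → ℝ, (∀ q ∈ T, 0 ≤ w q) ∧
    ∑ q ∈ T, w q = 1 ∧ ∑ q ∈ T, w q • q = x ∧ t = w p}

/-- The nodal interpolant. -/
def interp (v : E → ℝ) (x : E) : ℝ := ∑ p ∈ M.nodes, v p * M.hat p x

end Triangulation

/-- The barycentre of an element. -/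
def barycentre (T : Finset E) : E := (1 / 3 : ℝ) • ∑ q ∈ T, q

/-- The (constant) gradient of a piecewise affine function on the element `T`. -/
def elemGrad (T : Finset E) (v : E → ℝ) : E := gradient v (barycentre T)

/-- The unit normal of the side `s` of the triangle `T` pointing out of `T`. -/
def outwardNormal (T s : Finset E) : E :=
  Classical.epsilon fun n : E => ‖n‖ = 1 ∧ ∀ x ∈ s, ∀ y ∈ T, inner ℝ n (y - x) ≤ 0

/-- The sum of `∇v|_T · n_T` over the elements `T` that have `s` as a side.  On an interior side
this is the jump `[∇v] = ∇v|_T · n_T - ∇v|_T' · n_T`, on a boundary side it is `∇v · n`. -/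
def normalJump {Ω : Set E} (M : Triangulation Ω) (v : E → ℝ) (s : Finset E) : ℝ :=
  ∑ T ∈ M.elemsAt s, inner ℝ (elemGrad T v) (outwardNormal T s)

/-! ### Elasticity -/

/-- The linearized strain tensor `E_lin(u)`. -/
def strain (u : E → E) (x : E) : Matrix (Fin 2) (Fin 2) ℝ :=
  Matrix.of fun i j =>
    (1 / 2 : ℝ) * (fderiv ℝ u x (EuclideanSpace.single j 1) i
      + fderiv ℝ u x (EuclideanSpace.single i 1) j)

theorem strain_isHermitian (u : E → E) (x : E) : (strain u x).IsHermitian := by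
  ext i j
  simp [strain, add_comm]

/-- The tensile part `Q D⁺ Qᵀ` of the strain tensor. -/
def strainPos (u : E → E) (x : E) : Matrix (Fin 2) (Fin 2) ℝ :=
  let Q : Matrix (Fin 2) (Fin 2) ℝ := (strain_isHermitian u x).eigenvectorUnitary
  Q * Matrix.diagonal (fun i => max ((strain_isHermitian u x).eigenvalues i) 0) * Q.transpose

/-- The tensile stress `σ⁺(u)` with Lamé parameters `mu`, `lam`. -/
def stressPos (mu lam : ℝ) (u : E → E) (x : E) : Matrix (Fin 2) (Fin 2) ℝ :=
  (2 * mu) • strainPos u x + (lam * max 0 (strain u x).trace) • (1 : Matrix (Fin 2) (Fin 2) ℝ)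

/-- The Frobenius product `A : B`. -/
def frob (A B : Matrix (Fin 2) (Fin 2) ℝ) : ℝ := ∑ i, ∑ j, A i j * B i j

/-! ### One time step -/

/-- The data of one time step: mesh, material parameters, discrete displacement `u_h`, discrete
phase field `φ_h^{n-1}` of the previous step, discrete phase field `φ_h` of the present step. -/
structure Step (Ω : Set E) where
  mesh : Triangulation Ω
  Gc : ℝ
  eps : ℝ
  kappa : ℝ
  mu : ℝ
  lam : ℝ
  uh : E → E
  phiPrev : E → ℝ
  phih : E → ℝ

namespace Step

variable {Ω : Set E} (D : Step Ω)

/-- The tensile energy density `σ⁺(u_h) : E_lin(u_h)`. -/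
def tensile (x : E) : ℝ := frob (stressPos D.mu D.lam D.uh x) (strain D.uh x)

/-- The reaction coefficient `G_c/ε + (1-κ) σ⁺(u_h) : E_lin(u_h)`. -/
def coeff (x : E) : ℝ := D.Gc / D.eps + (1 - D.kappa) * D.tensile x

/-- The bilinear form `a_{h,ε}`. -/
def bilin (ζ ψ : E → ℝ) : ℝ :=
  (∫ x in Ω, D.coeff x * ζ x * ψ x)
    + D.Gc * D.eps * ∫ x in Ω, (inner ℝ (weakGrad Ω ζ x) (weakGrad Ω ψ x) : ℝ)

/-- The load `⟨G_c/ε, ψ⟩`. -/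
def load (ψ : E → ℝ) : ℝ := ∫ x in Ω, D.Gc / D.eps * ψ x

/-- The energy norm `‖·‖_ε`. -/
def energyNorm (ψ : E → ℝ) : ℝ :=
  √(D.Gc * D.eps * (∫ x in Ω, ‖weakGrad Ω ψ x‖ ^ 2) + ∫ x in Ω, (√(D.coeff x) * ψ x) ^ 2)

/-- The dual norm `‖F‖_{*,ε} = sup_{ψ ∈ H¹(Ω)} ⟨F, ψ⟩ / ‖ψ‖_ε`, with values in `[0, ∞]`
(here `0 / 0 = 0` and `a / 0 = ∞` for `a > 0`). -/
def dualNorm (F : (E → ℝ) → ℝ) : ℝ≥0∞ :=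
  ⨆ (ψ : E → ℝ) (_ : MemH1 Ω ψ), ENNReal.ofReal |F ψ| / ENNReal.ofReal (D.energyNorm ψ)

/-- The obstacle `I_h φ_h^{n-1}`. -/
def obstacle : E → ℝ := D.mesh.interp D.phiPrev

/-- The discrete feasible set `𝒦_h`. -/
def FeasibleDiscrete (ψ : E → ℝ) : Prop :=
  D.mesh.IsP1 ψ ∧ ∀ p ∈ D.mesh.nodes, ψ p ≤ D.obstacle p

/-- `φ_h` solves the discrete variational inequality. -/
def IsDiscreteSolution : Prop :=
  D.FeasibleDiscrete D.phih ∧ ∀ ψ : E → ℝ, D.FeasibleDiscrete ψ →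
    D.load (fun x => ψ x - D.phih x) ≤ D.bilin D.phih (fun x => ψ x - D.phih x)

/-- The feasible set `𝒦(I_h φ_h^{n-1})`. -/
def Feasible (ψ : E → ℝ) : Prop :=
  MemH1 Ω ψ ∧ ∀ᵐ x ∂(volume.restrict Ω), ψ x ≤ D.obstacle x

/-- `φ̂` solves the auxiliary obstacle problem. -/
def IsAuxSolution (φ : E → ℝ) : Prop :=
  D.Feasible φ ∧ ∀ ψ : E → ℝ, D.Feasible ψ →
    D.load (fun x => ψ x - φ x) ≤ D.bilin φ (fun x => ψ x - φ x)

/-- `ψ ↦ ⟨G_c/ε, ψ⟩ - a_{h,ε}(ζ, ψ)`.  For `ζ = φ̂` this is the constraining force `Λ̂`; for `ζ = φ_h` it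
is the linear residual, whose restriction to finite element functions is `Λ_h`. -/
def force (ζ ψ : E → ℝ) : ℝ := D.load ψ - D.bilin ζ ψ

/-- The element residual `r(φ_h)`. -/
def residual (x : E) : ℝ :=
  D.Gc / D.eps + D.Gc * D.eps * Laplacian.laplacian D.phih x - D.Gc / D.eps * D.phih x
    - (1 - D.kappa) * D.tensile x * D.phih x

/-- The node value `s_p` of the lumped discrete constraining force. -/
def nodeForce (p : E) : ℝ :=
  D.force D.phih (D.mesh.hat p) / ∫ x in D.mesh.patch {p}, D.mesh.hat p x

/-- The weighted mean `c_p(ψ)`. -/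
def mean (p : E) (ψ : E → ℝ) : ℝ :=
  (∫ x in D.mesh.smallPatch p, ψ x * D.mesh.hat p x) / ∫ x in D.mesh.smallPatch p, D.mesh.hat p x

open Classical in
/-- The set with respect to which the local test functions of a node `p` are extended by zero: the
plane for an interior node, `Ω` for a boundary node. -/
def ambient (Ω : Set E) (p : E) : Set E := if p ∈ Ω then Set.univ else Ω

/-- The local test functions at `p`: functions on `ω_p`, extended by zero, such that the extension is
in `H¹(ℝ²)` if `p` is an interior node (that is, they form `H¹₀(ω_p)`) and in `H¹(Ω)` if `p` is a
boundary node (that is, they vanish on `∂ω_p \ Γ`, whereas on the Neumann boundary no condition is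
imposed). -/
def IsLocalTest (p : E) (v : E → ℝ) : Prop :=
  MemH1 (ambient Ω p) v ∧ ∀ᵐ x ∂(volume.restrict (ambient Ω p \ D.mesh.patch {p})), v x = 0

/-- `p ∈ 𝔑^{fC}`: full-contact nodes. -/
def IsFullContact (p : E) : Prop :=
  p ∈ D.mesh.nodes ∧ (∀ x ∈ D.mesh.patch {p}, D.phih x = D.obstacle x) ∧
    ∀ v : E → ℝ, D.IsLocalTest p v → (∀ x, 0 ≤ v x) → 0 ≤ D.force D.phih v

/-- `p ∈ 𝔑^{sC}`: semi-contact nodes. -/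
def IsSemiContact (p : E) : Prop :=
  p ∈ D.mesh.nodes ∧ D.phih p = D.obstacle p ∧ ¬ D.IsFullContact p

/-- The local contribution `⟨Λ̃_h^p, ψ φ_p⟩` of a full-contact node. -/
def fullForce (p : E) (ψ : E → ℝ) : ℝ :=
  (∫ x in D.mesh.patch {p}, D.residual x * ψ x * D.mesh.hat p x)
    - (∑ s ∈ D.mesh.skeleton p, ∫ x, D.Gc * D.eps * normalJump D.mesh D.phih s
        * trace (D.mesh.patch s) s ψ x * D.mesh.hat p x ∂(sideMeasure s))
    - ∑ s ∈ D.mesh.boundarySkeleton p, ∫ x, D.Gc * D.eps * normalJump D.mesh D.phih s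
        * trace (D.mesh.patch s) s ψ x * D.mesh.hat p x ∂(sideMeasure s)

/-- The local contribution `⟨Λ̃_h^p, ψ φ_p⟩` of a semi-contact node. -/
def semiForce (p : E) (ψ : E → ℝ) : ℝ :=
  (∫ x in D.mesh.patch {p}, D.residual x * D.mean p ψ * D.mesh.hat p x)
    - (∑ s ∈ D.mesh.skeleton p, ∫ x, D.Gc * D.eps * normalJump D.mesh D.phih s
        * D.mean p ψ * D.mesh.hat p x ∂(sideMeasure s))
    - ∑ s ∈ D.mesh.boundarySkeleton p, ∫ x, D.Gc * D.eps * normalJump D.mesh D.phih s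
        * D.mean p ψ * D.mesh.hat p x ∂(sideMeasure s)

open Classical in
/-- The quasi-discrete constraining force `Λ̃_h`. -/
def quasiForce (ψ : E → ℝ) : ℝ :=
  (∑ p ∈ D.mesh.nodes.filter (D.IsSemiContact ·), D.semiForce p ψ)
    + ∑ p ∈ D.mesh.nodes.filter (D.IsFullContact ·), D.fullForce p ψ

/-! ### The estimator -/

/-- `α_p`, the minimum of the reaction coefficient over `ω_p`.  As `u_h` is affine on each element, the
coefficient is constant there and is evaluated at the barycentres. -/
def alpha (p : E) : ℝ :=
  sInf ((fun T => D.coeff (barycentre T)) '' {T | T ∈ D.mesh.elemsAt {p}})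

/-- `min {h_p / √(G_c ε), α_p^{-1/2}}`. -/
def weight (p : E) : ℝ :=
  min (D.mesh.diamPatch p / √(D.Gc * D.eps)) (D.alpha p ^ (-(1 / 2) : ℝ))

def eta1Loc (p : E) : ℝ :=
  D.weight p * √(∫ x in D.mesh.patch {p}, D.residual x ^ 2)

def eta2Loc (p : E) : ℝ :=
  D.weight p ^ (1 / 2 : ℝ) * (D.Gc * D.eps) ^ (-(1 / 4) : ℝ) *
    √(∑ s ∈ D.mesh.skeleton p,
      ∫ _, (D.Gc * D.eps * normalJump D.mesh D.phih s) ^ 2 ∂(sideMeasure s))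

def eta3Loc (p : E) : ℝ :=
  D.weight p ^ (1 / 2 : ℝ) * (D.Gc * D.eps) ^ (-(1 / 4) : ℝ) *
    √(∑ s ∈ D.mesh.boundarySkeleton p,
      ∫ _, (D.Gc * D.eps * normalJump D.mesh D.phih s) ^ 2 ∂(sideMeasure s))

def eta4Loc (p : E) : ℝ :=
  √(D.nodeForce p * ∫ x in D.mesh.smallPatch p, (D.obstacle x - D.phih x) * D.mesh.hat p x)

open Classical in
def eta1 : ℝ := √(∑ p ∈ D.mesh.nodes.filter (¬ D.IsFullContact ·), D.eta1Loc p ^ 2)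

open Classical in
def eta2 : ℝ := √(∑ p ∈ D.mesh.nodes.filter (¬ D.IsFullContact ·), D.eta2Loc p ^ 2)

open Classical in
def eta3 : ℝ := √(∑ p ∈ D.mesh.boundaryNodes.filter (¬ D.IsFullContact ·), D.eta3Loc p ^ 2)

open Classical in
def eta4 : ℝ := √(∑ p ∈ D.mesh.nodes.filter (D.IsSemiContact ·), D.eta4Loc p ^ 2)

/-- The error estimator. -/
def eta : ℝ := D.eta1 + D.eta2 + D.eta3 + D.eta4

end Step

end PhaseField

end

noncomputable section

namespace PhaseField

set_option linter.unusedSectionVars false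

/-! ### Square integrable functions -/

section L2

variable {α : Type*} [MeasurableSpace α] {μ : Measure α}
variable {F : Type*} [NormedAddCommGroup F] [InnerProductSpace ℝ F]

/-! Let `R` be the residual of `φ_h`, `e = φ̂ - φ_h`, and `Λ̃` the quasi-discrete force. The proof
splits `R = (R - Λ̃) + Λ̃`, bounds the first part in the dual norm, and controls only the sign of
the second part on `e`.

Galerkin part. The nodal basis is a partition of unity, so `⟨R, ψ⟩ = ∑ ⟨R, ψ φ_p⟩`. Integration by
parts on the elements shows that `Λ̃` contains exactly the summands of the full-contact nodes and,
at semi-contact nodes, `c_p(ψ) ⟨R, φ_p⟩`. At nodes without contact the discrete inequality gives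
`⟨R, φ_p⟩ = 0`, so a mean value can be subtracted there for free. Hence `R - Λ̃` is the sum of `⟨R,
(ψ - c_p(ψ)) φ_p⟩` over the nodes that are not in full contact (`force_sub_quasiForce`). Each
summand is bounded by local indicators times the energy norm on the patch (`abs_force_sub_mean_le`),
and every element lies in three patches. The weight `m_p`, and with it the robustness, comes from
bounding `ψ - c_p(ψ)` either by the Poincaré inequality or by the `L²` norm, which `α_p` controls
(`l2n_sub_mean_le`).

Contact part. On a full-contact patch `φ_h - φ̂ = χ - φ̂ ≥ 0`, so the sign condition in the
definition makes the contribution to `⟨Λ̃, e⟩` nonpositive. At a semi-contact node `⟨R, φ_p⟩ ≥ 0`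
and `c_p(e) ≤ c_p(χ - φ_h)`, which produces the fourth indicator (`quasiForce_le`).

Conclusion. `‖e‖² = ⟨R, e⟩ - ⟨Λ̂, e⟩`, and `⟨Λ̂, e⟩ ≥ 0` because `φ_h` is feasible for the
continuous problem. This yields a quadratic inequality for `‖e‖` (`energyNorm_error_le`). The force
error follows from `Λ̂ - Λ̃ = (R - Λ̃) - a(e, ·)`.

The analytic core is a trace and a Poincaré inequality on patches with constants depending on `ρ`
only. Both rest on one identity: the field `v(x) (x - P)` has no flux through the two sides at the
vertex `P`, so the divergence theorem expresses the integral of `v` over the opposite side as an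
area integral (`integral_hull_div`). With `v = f w` it becomes a family of moment identities that
survive `L²` limits (`SideMoments`). They give Green's formula, and they compare the mean over an
element with the mean over a side. Two neighbours share their side mean, the elements at a node are
connected through sides (`nodeGraph_preconnected`, where the shape of the boundary enters), and
there are at most `ρ²` of them. Chaining therefore gives the Poincaré inequality on patches that
need not be convex. -/

theorem integrable_fun_sub {f g : α → F} (hf : Integrable f μ) (hg : Integrable g μ) :
    Integrable (fun x => f x - g x) μ := hf.sub hg

theorem memLp_fun_sub {f g : α → F} (hf : MemLp f 2 μ) (hg : MemLp g 2 μ) :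
    MemLp (fun x => f x - g x) 2 μ := hf.sub hg

theorem memLp_fun_add {f g : α → F} (hf : MemLp f 2 μ) (hg : MemLp g 2 μ) :
    MemLp (fun x => f x + g x) 2 μ := hf.add hg

/-- The `L²` norm as a real number. -/
def l2n (μ : Measure α) (f : α → F) : ℝ := (eLpNorm f 2 μ).toReal

theorem l2n_nonneg (f : α → F) : 0 ≤ l2n μ f := ENNReal.toReal_nonneg

theorem l2n_sq {f : α → F} (hf : MemLp f 2 μ) : l2n μ f ^ 2 = ∫ x, ‖f x‖ ^ 2 ∂μ := by
  have h := hf.eLpNorm_eq_integral_rpow_norm (by norm_num) (by norm_num)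
  have h0 : 0 ≤ ∫ x, ‖f x‖ ^ (2 : ℝ) ∂μ := integral_nonneg fun x => by positivity
  simp only [ENNReal.toReal_ofNat] at h
  rw [l2n, h, ENNReal.toReal_ofReal (by positivity), ← Real.rpow_natCast, ← Real.rpow_mul h0]
  norm_num

theorem l2n_eq_sqrt {f : α → F} (hf : MemLp f 2 μ) : l2n μ f = √(∫ x, ‖f x‖ ^ 2 ∂μ) := by
  rw [← l2n_sq hf, Real.sqrt_sq (l2n_nonneg f)]

theorem l2n_sub_comm {f g : α → F} :
    l2n μ (fun x => f x - g x) = l2n μ (fun x => g x - f x) := by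
  rw [l2n, l2n]
  congr 1
  exact eLpNorm_sub_comm f g 2 μ

theorem l2n_add_le {f g : α → F} (hf : MemLp f 2 μ) (hg : MemLp g 2 μ) :
    l2n μ (fun x => f x + g x) ≤ l2n μ f + l2n μ g := by
  rw [l2n, l2n, l2n, ← ENNReal.toReal_add hf.eLpNorm_ne_top hg.eLpNorm_ne_top]
  refine ENNReal.toReal_mono (by simp [hf.eLpNorm_ne_top, hg.eLpNorm_ne_top]) ?_
  exact eLpNorm_add_le hf.1 hg.1 (by norm_num)

theorem l2n_mono {G : Type*} [NormedAddCommGroup G] [InnerProductSpace ℝ G]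
    {f : α → F} {g : α → G} (hg : MemLp g 2 μ) {c : ℝ} (hc : 0 ≤ c)
    (h : ∀ᵐ x ∂μ, ‖f x‖ ≤ c * ‖g x‖) : l2n μ f ≤ c * l2n μ g := by
  have h1 := eLpNorm_le_mul_eLpNorm_of_ae_le_mul h 2
  have h2 := ENNReal.toReal_mono (by finiteness [hg.eLpNorm_ne_top]) h1
  simpa [l2n, ENNReal.toReal_mul, ENNReal.toReal_ofReal hc] using h2

theorem integrable_inner_of_memLp {f g : α → F} (hf : MemLp f 2 μ) (hg : MemLp g 2 μ) :
    Integrable (fun x => (inner ℝ (f x) (g x) : ℝ)) μ := by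
  have h := L2.integrable_inner (𝕜 := ℝ) (hf.toLp f) (hg.toLp g)
  refine h.congr ?_
  filter_upwards [hf.coeFn_toLp, hg.coeFn_toLp] with x h1 h2
  rw [h1, h2]

theorem abs_integral_inner_le {f g : α → F} (hf : MemLp f 2 μ) (hg : MemLp g 2 μ) :
    |∫ x, (inner ℝ (f x) (g x) : ℝ) ∂μ| ≤ l2n μ f * l2n μ g := by
  have h := abs_real_inner_le_norm (hf.toLp f) (hg.toLp g)
  rw [L2.inner_def, Lp.norm_toLp, Lp.norm_toLp] at h
  have h2 : ∫ x, (inner ℝ (f x) (g x) : ℝ) ∂μ =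
      ∫ a, (inner ℝ ((hf.toLp f : Lp F 2 μ) a) ((hg.toLp g : Lp F 2 μ) a) : ℝ) ∂μ := by
    refine integral_congr_ae ?_
    filter_upwards [hf.coeFn_toLp, hg.coeFn_toLp] with x h1 h2
    rw [h1, h2]
  rw [h2]
  exact h

theorem abs_integral_mul_le {f g : α → ℝ} (hf : MemLp f 2 μ) (hg : MemLp g 2 μ) :
    |∫ x, f x * g x ∂μ| ≤ l2n μ f * l2n μ g := by
  have := abs_integral_inner_le hg hf
  simpa [mul_comm] using this

theorem integrable_mul_of_memLp {f g : α → ℝ} (hf : MemLp f 2 μ) (hg : MemLp g 2 μ) :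
    Integrable (fun x => f x * g x) μ := by
  simpa using integrable_inner_of_memLp hg hf

theorem l2n_const [IsFiniteMeasure μ] (c : ℝ) :
    l2n μ (fun _ : α => c) = |c| * √(μ.real Set.univ) := by
  rw [l2n_eq_sqrt (memLp_const c)]
  simp only [Real.norm_eq_abs, sq_abs, integral_const, smul_eq_mul]
  rw [Real.sqrt_mul (measureReal_nonneg), Real.sqrt_sq_eq_abs, mul_comm]

theorem l2n_mono_measure {ν : Measure α} (h : ν ≤ μ) {f : α → F} (hf : MemLp f 2 μ) :
    l2n ν f ≤ l2n μ f :=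
  ENNReal.toReal_mono hf.eLpNorm_ne_top (eLpNorm_mono_measure f h)

/-- Convergence in `L²`. -/
def L2Lim (μ : Measure α) (f : ℕ → α → F) (u : α → F) : Prop :=
  Tendsto (fun k => eLpNorm (fun x => f k x - u x) 2 μ) atTop (𝓝 0)

theorem L2Lim.mono {ν : Measure α} {f : ℕ → α → F} {u : α → F} (h : L2Lim μ f u) (hν : ν ≤ μ) :
    L2Lim ν f u :=
  tendsto_of_tendsto_of_tendsto_of_le_of_le tendsto_const_nhds h (fun _ => zero_le)
    (fun _ => eLpNorm_mono_measure _ hν)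

theorem L2Lim.congr {f : ℕ → α → F} {u v : α → F} (h : L2Lim μ f u) (huv : u =ᵐ[μ] v) :
    L2Lim μ f v := by
  refine Tendsto.congr (fun k => ?_) h
  refine eLpNorm_congr_ae ?_
  filter_upwards [huv] with x hx
  rw [hx]

theorem L2Lim.tendsto_sub {f : ℕ → α → F} {u : α → F} (h : L2Lim μ f u) :
    Tendsto (fun k => l2n μ (fun x => f k x - u x)) atTop (𝓝 0) := by
  have := (ENNReal.tendsto_toReal ENNReal.zero_ne_top).comp h
  simpa [l2n, Function.comp_def] using this

theorem L2Lim.tendsto_l2n {f : ℕ → α → F} {u : α → F} (h : L2Lim μ f u) (hf : ∀ k, MemLp (f k) 2 μ)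
    (hu : MemLp u 2 μ) : Tendsto (fun k => l2n μ (f k)) atTop (𝓝 (l2n μ u)) := by
  have h0 := h.tendsto_sub
  rw [tendsto_iff_dist_tendsto_zero]
  refine squeeze_zero (fun _ => dist_nonneg) (fun k => ?_) h0
  rw [Real.dist_eq, abs_le]
  have h1 := l2n_add_le ((hf k).sub hu) hu
  have h2 := l2n_add_le (hu.sub (hf k)) (hf k)
  have e1 : l2n μ (u - f k) = l2n μ (fun x => f k x - u x) := l2n_sub_comm
  have e2 : l2n μ (f k - u) = l2n μ (fun x => f k x - u x) := rfl
  simp only [Pi.sub_apply, sub_add_cancel] at h1 h2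
  rw [e1] at h2
  rw [e2] at h1
  constructor <;> linarith

/-- Cauchy–Schwarz bounds the error by the norm of the fixed factor times the distance to the limit.
Every integral identity proved for smooth functions is carried over to Sobolev functions in this
way. -/
theorem L2Lim.integral_inner {f : ℕ → α → F} {u a : α → F} (h : L2Lim μ f u)
    (hf : ∀ k, MemLp (f k) 2 μ) (hu : MemLp u 2 μ) (ha : MemLp a 2 μ) :
    Tendsto (fun k => ∫ x, (inner ℝ (a x) (f k x) : ℝ) ∂μ) atTop
      (𝓝 (∫ x, (inner ℝ (a x) (u x) : ℝ) ∂μ)) := by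
  rw [tendsto_iff_dist_tendsto_zero]
  refine squeeze_zero (fun _ => dist_nonneg) (fun k => ?_) (g := fun k => l2n μ a * l2n μ (fun x => f k x - u x)) ?_
  · rw [Real.dist_eq, ← integral_sub (integrable_inner_of_memLp ha (hf k))
      (integrable_inner_of_memLp ha hu)]
    simp_rw [← inner_sub_right]
    exact abs_integral_inner_le ha ((hf k).sub hu)
  · simpa using h.tendsto_sub.const_mul (l2n μ a)

theorem L2Lim.integral_mul {f : ℕ → α → ℝ} {u a : α → ℝ} (h : L2Lim μ f u)
    (hf : ∀ k, MemLp (f k) 2 μ) (hu : MemLp u 2 μ) (ha : MemLp a 2 μ) :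
    Tendsto (fun k => ∫ x, f k x * a x ∂μ) atTop (𝓝 (∫ x, u x * a x ∂μ)) := by
  simpa using h.integral_inner hf hu ha

end L2

/-! ### Triangles and barycentric coordinates -/

/-- Three affinely independent points. -/
def IsTri (T : Finset E) : Prop := T.card = 3 ∧ AffineIndependent ℝ ((↑) : T → E)

/-- The vertices of a triangle as an affine basis of the plane. -/
def triBasis {T : Finset E} (h : IsTri T) : AffineBasis T ℝ E :=
  ⟨(↑), h.2, by
    rw [h.2.affineSpan_eq_top_iff_card_eq_finrank_add_one]
    simp [h.1]⟩

theorem triBasis_apply {T : Finset E} (h : IsTri T) (q : T) : triBasis h q = (q : E) := rfl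

open Classical in
/-- The barycentric coordinate of `q` with respect to the triangle `T`. -/
def bary (T : Finset E) (q : E) : E →ᵃ[ℝ] ℝ :=
  if h : IsTri T ∧ q ∈ T then (triBasis h.1).coord ⟨q, h.2⟩ else 0

namespace IsTri

variable {T : Finset E} (h : IsTri T)
include h

theorem bary_eq {q : E} (hq : q ∈ T) : bary T q = (triBasis h).coord ⟨q, hq⟩ := by
  rw [bary, dif_pos ⟨h, hq⟩]

theorem bary_self {q : E} (hq : q ∈ T) : bary T q q = 1 := by
  rw [h.bary_eq hq]
  exact (triBasis h).coord_apply_eq ⟨q, hq⟩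

theorem bary_of_ne {q r : E} (hr : r ∈ T) (hqr : q ≠ r) : bary T q r = 0 := by
  by_cases hq : q ∈ T
  · rw [h.bary_eq hq]
    exact (triBasis h).coord_apply_ne (i := ⟨q, hq⟩) (j := ⟨r, hr⟩) (by simpa using hqr)
  · rw [bary, dif_neg (by tauto)]
    simp

theorem sum_bary (x : E) : ∑ q ∈ T, bary T q x = 1 := by
  rw [← Finset.sum_coe_sort, ← (triBasis h).sum_coord_apply_eq_one x]
  exact Finset.sum_congr rfl fun q _ => by rw [h.bary_eq q.2]

theorem sum_bary_smul (x : E) : ∑ q ∈ T, bary T q x • q = x := by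
  conv_rhs => rw [← (triBasis h).linear_combination_coord_eq_self x]
  rw [← Finset.sum_coe_sort]
  exact Finset.sum_congr rfl fun q _ => by rw [h.bary_eq q.2]; rfl

theorem map_eq_sum {V : Type*} [NormedAddCommGroup V] [NormedSpace ℝ V] (f : E →ᵃ[ℝ] V) (x : E) :
    f x = ∑ q ∈ T, bary T q x • f q := by
  have h1 := h.sum_bary_smul x
  have h2 := h.sum_bary x
  have h3 : f x = f.linear x + f 0 := by
    have := f.map_vadd 0 x
    simpa using this
  have h4 : ∀ q : E, f q = f.linear q + f 0 := by
    intro q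
    have := f.map_vadd 0 q
    simpa using this
  rw [h3, Finset.sum_congr rfl fun q _ => by rw [h4 q, smul_add], Finset.sum_add_distrib,
    ← Finset.sum_smul, h2, one_smul]
  conv_lhs => rw [← h1]
  simp only [map_sum, map_smul]

/-- Uniqueness of barycentric coordinates. The weights need not be nonnegative, so a coordinate can
be read off from any affine representation of a point. -/
theorem bary_sum {w : E → ℝ} (hw : ∑ q ∈ T, w q = 1) {q : E} (hq : q ∈ T) :
    bary T q (∑ r ∈ T, w r • r) = w q := by
  have h1 : bary T q (∑ r ∈ T, w r • r) = ∑ r ∈ T, w r * bary T q r := by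
    have h4 : ∀ y : E, bary T q y = (bary T q).linear y + bary T q 0 := by
      intro y
      have := (bary T q).map_vadd 0 y
      simpa using this
    rw [h4, Finset.sum_congr (f := fun r => w r * bary T q r) rfl fun r _ => by rw [h4 r, mul_add],
      Finset.sum_add_distrib, ← Finset.sum_mul, hw, one_mul]
    simp only [map_sum, map_smul, smul_eq_mul]
  rw [h1, Finset.sum_eq_single q]
  · rw [h.bary_self hq, mul_one]
  · intro r hr hrq
    rw [h.bary_of_ne hr hrq.symm, mul_zero]
  · exact fun hh => absurd hq hh

theorem mem_hull_iff {x : E} : x ∈ convexHull ℝ (T : Set E) ↔ ∀ q ∈ T, 0 ≤ bary T q x := by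
  have h1 : (T : Set E) = Set.range (triBasis h) := by
    ext y
    simp [triBasis_apply]
  rw [h1, AffineBasis.convexHull_eq_nonneg_coord]
  constructor
  · intro hx q hq
    rw [h.bary_eq hq]
    exact hx _
  · intro hx q
    rw [← h.bary_eq q.2]
    exact hx q q.2

theorem mem_interior_iff {x : E} :
    x ∈ interior (convexHull ℝ (T : Set E)) ↔ ∀ q ∈ T, 0 < bary T q x := by
  have h1 : (T : Set E) = Set.range (triBasis h) := by
    ext y
    simp [triBasis_apply]
  rw [h1, AffineBasis.interior_convexHull]
  constructor
  · intro hx q hq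
    rw [h.bary_eq hq]
    exact hx _
  · intro hx q
    rw [← h.bary_eq q.2]
    exact hx q q.2

/-- Faces of a triangle are the zero sets of the remaining coordinates. In this form conformity of
the mesh becomes a statement about coordinates. -/
theorem mem_hull_subset_iff {s : Finset E} (hs : s ⊆ T) {x : E} :
    x ∈ convexHull ℝ (s : Set E) ↔
      x ∈ convexHull ℝ (T : Set E) ∧ ∀ q ∈ T, q ∉ s → bary T q x = 0 := by
  classical
  constructor
  · intro hx
    refine ⟨convexHull_mono (by exact_mod_cast hs) hx, fun q hq hqs => ?_⟩
    rw [Finset.convexHull_eq] at hx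
    obtain ⟨w, hw0, hw1, hw2⟩ := hx
    rw [Finset.centerMass_eq_of_sum_1 _ _ hw1] at hw2
    have := h.bary_sum (w := fun q => if q ∈ s then w q else 0) ?_ hq
    · rw [if_neg hqs] at this
      rw [← this, ← hw2]
      congr 1
      rw [← Finset.sum_subset hs]
      · exact Finset.sum_congr rfl fun r hr => by simp [hr]
      · intro r _ hr
        simp [hr]
    · rw [← hw1, ← Finset.sum_subset hs]
      · exact Finset.sum_congr rfl fun r hr => by simp [hr]
      · intro r _ hr
        simp [hr]
  · rintro ⟨hx, hx0⟩
    rw [h.mem_hull_iff] at hx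
    rw [Finset.convexHull_eq]
    have h1 : ∑ q ∈ s, bary T q x = 1 := by
      rw [← h.sum_bary x]
      exact Finset.sum_subset hs fun q hq hqs => hx0 q hq hqs
    refine ⟨fun q => bary T q x, fun q hq => hx q (hs hq), h1, ?_⟩
    rw [Finset.centerMass_eq_of_sum_1 _ _ h1]
    conv_rhs => rw [← h.sum_bary_smul x]
    refine Finset.sum_subset hs fun q hq hqs => ?_
    simp [hx0 q hq hqs]

end IsTri

/-- The gradient of an affine function. -/
def agrad (f : E →ᵃ[ℝ] ℝ) : E := gradient f 0

theorem hasGradientAt_affine (f : E →ᵃ[ℝ] ℝ) (x : E) : HasGradientAt f (agrad f) x := by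
  have h1 : ∀ y, HasFDerivAt f (LinearMap.toContinuousLinearMap f.linear) y := by
    intro y
    have h2 : (f : E → ℝ) = fun z => LinearMap.toContinuousLinearMap f.linear z + f 0 := by
      ext z
      have := f.map_vadd 0 z
      simpa using this
    rw [h2]
    exact (ContinuousLinearMap.hasFDerivAt _).add_const _
  have h3 : HasGradientAt f ((InnerProductSpace.toDual ℝ E).symm
      (LinearMap.toContinuousLinearMap f.linear)) x := (h1 x).hasGradientAt
  have h4 : HasGradientAt f ((InnerProductSpace.toDual ℝ E).symm
      (LinearMap.toContinuousLinearMap f.linear)) 0 := (h1 0).hasGradientAt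
  rw [agrad, h4.gradient]
  exact h3

theorem linear_eq_inner_agrad (f : E →ᵃ[ℝ] ℝ) (e : E) : f.linear e = inner ℝ (agrad f) e := by
  have h1 : HasFDerivAt f (LinearMap.toContinuousLinearMap f.linear) 0 := by
    have h2 : (f : E → ℝ) = fun z => LinearMap.toContinuousLinearMap f.linear z + f 0 := by
      ext z
      have := f.map_vadd 0 z
      simpa using this
    rw [h2]
    exact (ContinuousLinearMap.hasFDerivAt _).add_const _
  have h3 := (hasGradientAt_affine f 0).hasFDerivAt.unique h1
  have := congrArg (fun L => L e) h3
  simpa using this.symm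

theorem affine_sub_eq_inner (f : E →ᵃ[ℝ] ℝ) (x y : E) : f x - f y = inner ℝ (agrad f) (x - y) := by
  rw [← linear_eq_inner_agrad]
  have := f.linearMap_vsub x y
  simpa using this.symm

theorem contDiff_affine {n : WithTop ℕ∞} (f : E →ᵃ[ℝ] ℝ) : ContDiff ℝ n f := by
  have h2 : (f : E → ℝ) = fun z => LinearMap.toContinuousLinearMap f.linear z + f 0 := by
    ext z
    have := f.map_vadd 0 z
    simpa using this
  rw [h2]
  exact (ContinuousLinearMap.contDiff _).add contDiff_const

/-! ### Gradients of barycentric coordinates, null boundary and positive area of a triangle. -/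

namespace IsTri

variable {T : Finset E} (h : IsTri T)
include h

theorem sum_agrad_bary : ∑ q ∈ T, agrad (bary T q) = 0 := by
  refine ext_inner_right ℝ fun e => ?_
  have h1 := h.sum_bary e
  have h2 := h.sum_bary 0
  rw [sum_inner, inner_zero_left]
  have : ∀ q ∈ T, inner ℝ (agrad (bary T q)) e = bary T q e - bary T q 0 := fun q _ => by
    rw [affine_sub_eq_inner, sub_zero]
  rw [Finset.sum_congr rfl this, Finset.sum_sub_distrib, h1, h2, sub_self]

theorem sum_inner_agrad_smul (e : E) : ∑ q ∈ T, (inner ℝ (agrad (bary T q)) e : ℝ) • q = e := by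
  have h1 := h.sum_bary_smul e
  have h2 := h.sum_bary_smul 0
  have : ∀ q ∈ T, inner ℝ (agrad (bary T q)) e = bary T q e - bary T q 0 := fun q _ => by
    rw [affine_sub_eq_inner, sub_zero]
  rw [Finset.sum_congr rfl fun q hq => by rw [this q hq, sub_smul], Finset.sum_sub_distrib, h1, h2,
    sub_zero]

/-- The gradient of an affine function in terms of its vertex values, tested with the position
vectors relative to the vertices. -/
theorem sum_inner_agrad_smul_sub (e x : E) :
    ∑ q ∈ T, (inner ℝ (agrad (bary T q)) e : ℝ) • (x - q) = - e := by
  simp_rw [smul_sub, Finset.sum_sub_distrib, h.sum_inner_agrad_smul, ← Finset.sum_smul, ← sum_inner,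
    h.sum_agrad_bary]
  simp

theorem isCompact_hull : IsCompact (convexHull ℝ (T : Set E)) :=
  T.finite_toSet.isCompact_convexHull ℝ

theorem measurableSet_hull : MeasurableSet (convexHull ℝ (T : Set E)) :=
  h.isCompact_hull.isClosed.measurableSet

theorem interior_nonempty : (interior (convexHull ℝ (T : Set E))).Nonempty := by
  refine ⟨∑ q ∈ T, (1 / 3 : ℝ) • q, ?_⟩
  rw [h.mem_interior_iff]
  intro q hq
  have := h.bary_sum (w := fun _ => 1 / 3) (by simp [h.1]) hq
  rw [this]
  norm_num

theorem barycentre_mem : barycentre T ∈ interior (convexHull ℝ (T : Set E)) := by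
  rw [h.mem_interior_iff]
  intro q hq
  have := h.bary_sum (w := fun _ => 1 / 3) (by simp [h.1]) hq
  rw [barycentre, Finset.smul_sum, this]
  norm_num

theorem closure_interior : closure (interior (convexHull ℝ (T : Set E))) = convexHull ℝ (T : Set E) := by
  rw [(convex_convexHull ℝ _).closure_interior_eq_closure_of_nonempty_interior h.interior_nonempty]
  exact h.isCompact_hull.isClosed.closure_eq

/-- The frontier of a convex set is a null set. Pointwise formulas valid inside an element thereby
become almost everywhere formulas on the closed element. -/
theorem ae_mem_interior : ∀ᵐ x ∂(volume.restrict (convexHull ℝ (T : Set E))),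
    x ∈ interior (convexHull ℝ (T : Set E)) := by
  have h1 : (volume : Measure E) (frontier (convexHull ℝ (T : Set E))) = 0 :=
    (convex_convexHull ℝ _).addHaar_frontier volume
  rw [ae_restrict_iff' h.measurableSet_hull]
  have h2 : ∀ᵐ x ∂(volume : Measure E), x ∉ frontier (convexHull ℝ (T : Set E)) := by
    rw [ae_iff]
    simpa using h1
  filter_upwards [h2] with x hx hxT
  rw [frontier, h.isCompact_hull.isClosed.closure_eq] at hx
  by_contra hcon
  exact hx ⟨hxT, hcon⟩

/-- The area of a triangle is positive. -/
theorem area_pos : 0 < volume.real (convexHull ℝ (T : Set E)) := by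
  rw [measureReal_def, ENNReal.toReal_pos_iff]
  refine ⟨?_, h.isCompact_hull.measure_lt_top⟩
  exact (isOpen_interior.measure_pos volume h.interior_nonempty).trans_le
    (measure_mono interior_subset)

end IsTri

/-! ### Integration over triangles -/

/-- The determinant of two vectors of the plane. -/
def cross (u w : E) : ℝ := u 0 * w 1 - u 1 * w 0

/-- The affine parametrization of the plane that maps the unit triangle to the triangle `P Q R`. -/
def triParam (P Q R : E) (z : ℝ × ℝ) : E := P + (z.1 • (Q - P) + z.2 • (R - P))

theorem continuous_triParam (P Q R : E) : Continuous (triParam P Q R) := by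
  unfold triParam
  fun_prop

/-- The parametrization is a measure preserving identification of `ℝ × ℝ` with the plane, followed
by a linear map with determinant `cross`, followed by a translation. -/
theorem map_triParam {P Q R : E} (hD : cross (Q - P) (R - P) ≠ 0) :
    Measure.map (triParam P Q R) volume =
      ENNReal.ofReal |(cross (Q - P) (R - P))⁻¹| • (volume : Measure E) := by
  set u := Q - P
  set w := R - P
  let L : E →ₗ[ℝ] E :=
    { toFun := fun y => y 0 • u + y 1 • w
      map_add' := fun x y => by simp only [PiLp.add_apply, add_smul]; abel
      map_smul' := fun c y => by simp [smul_smul] }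
  have hLapp : ∀ y, L y = y 0 • u + y 1 • w := fun _ => rfl
  have hdet : LinearMap.det L = cross u w := by
    rw [← LinearMap.det_toMatrix (EuclideanSpace.basisFun (Fin 2) ℝ).toBasis, Matrix.det_fin_two]
    simp only [LinearMap.toMatrix_apply, OrthonormalBasis.coe_toBasis, EuclideanSpace.basisFun_apply,
      OrthonormalBasis.coe_toBasis_repr_apply, EuclideanSpace.basisFun_repr, hLapp]
    simp [cross]
    ring
  let e : ℝ × ℝ → E := (MeasurableEquiv.toLp 2 (Fin 2 → ℝ)) ∘ (MeasurableEquiv.finTwoArrow).symm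
  have he : MeasurePreserving e volume volume :=
    ((EuclideanSpace.volume_preserving_symm_measurableEquiv_toLp (Fin 2)).symm).comp
      ((volume_preserving_finTwoArrow ℝ).symm)
  have hfun : triParam P Q R = (fun x => P + x) ∘ (L ∘ e) := by
    ext1 z
    simp [triParam, hLapp, e, u, w, MeasurableEquiv.finTwoArrow]
  have hL : Measurable L := (LinearMap.continuous_of_finiteDimensional L).measurable
  rw [hfun, ← Measure.map_map (by fun_prop) (hL.comp he.measurable),
    ← Measure.map_map hL he.measurable, he.map_eq,
    Measure.map_linearMap_addHaar_eq_smul_addHaar _ (by rwa [hdet]), Measure.map_smul,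
    map_add_left_eq_self, hdet]

theorem triParam_injective {P Q R : E} (hD : cross (Q - P) (R - P) ≠ 0) :
    Function.Injective (triParam P Q R) := by
  intro z z' hz
  simp only [triParam, add_right_inj] at hz
  have h0 := congrArg (fun v : E => v 0) hz
  have h1 := congrArg (fun v : E => v 1) hz
  simp only [PiLp.add_apply, PiLp.smul_apply, smul_eq_mul] at h0 h1
  set u := Q - P
  set w := R - P
  have e1 : (z.1 - z'.1) * cross u w = 0 := by
    unfold cross; linear_combination (w 1) * h0 - (w 0) * h1
  have e2 : (z.2 - z'.2) * cross u w = 0 := by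
    unfold cross; linear_combination (u 0) * h1 - (u 1) * h0
  ext
  · simpa [hD, sub_eq_zero] using e1
  · simpa [hD, sub_eq_zero] using e2

/-- The closed unit triangle. -/
def unitTri : Set (ℝ × ℝ) := {z | 0 ≤ z.1 ∧ 0 ≤ z.2 ∧ z.1 + z.2 ≤ 1}

theorem isCompact_unitTri : IsCompact unitTri := by
  refine (isCompact_Icc (a := ((0 : ℝ), (0 : ℝ))) (b := (1, 1))).of_isClosed_subset ?_ ?_
  · have h1 : IsClosed {z : ℝ × ℝ | 0 ≤ z.1} := isClosed_le continuous_const continuous_fst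
    have h2 : IsClosed {z : ℝ × ℝ | 0 ≤ z.2} := isClosed_le continuous_const continuous_snd
    have h3 : IsClosed {z : ℝ × ℝ | z.1 + z.2 ≤ 1} :=
      isClosed_le (continuous_fst.add continuous_snd) continuous_const
    exact h1.inter (h2.inter h3)
  · rintro z ⟨h1, h2, h3⟩
    exact ⟨⟨h1, h2⟩, ⟨by linarith, by linarith⟩⟩

theorem setIntegral_unitTri {F : ℝ × ℝ → ℝ} (hF : Continuous F) :
    ∫ z in unitTri, F z = ∫ a in (0 : ℝ)..1, ∫ b in (0 : ℝ)..(1 - a), F (a, b) := by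
  have hm : MeasurableSet unitTri := isCompact_unitTri.isClosed.measurableSet
  have hi : Integrable (unitTri.indicator F) (volume.prod volume) := by
    rw [integrable_indicator_iff hm]
    exact hF.continuousOn.integrableOn_compact isCompact_unitTri
  rw [← integral_indicator hm, Measure.volume_eq_prod, integral_prod _ hi,
    intervalIntegral.integral_of_le zero_le_one, ← integral_Icc_eq_integral_Ioc,
    ← integral_indicator measurableSet_Icc]
  congr 1
  ext1 a
  by_cases ha : a ∈ Set.Icc (0 : ℝ) 1
  · rw [Set.indicator_of_mem ha, intervalIntegral.integral_of_le (by linarith [ha.2]),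
      ← integral_Icc_eq_integral_Ioc, ← integral_indicator measurableSet_Icc]
    congr 1
    ext1 b
    have hiff : (a, b) ∈ unitTri ↔ b ∈ Set.Icc (0 : ℝ) (1 - a) :=
      ⟨fun h => ⟨h.2.1, by linarith [h.2.2]⟩, fun h => ⟨ha.1, h.1, by
        have := h.2
        simp only
        linarith⟩⟩
    simp only [Set.indicator, hiff]
  · rw [Set.indicator_of_notMem ha]
    have : ∀ b, unitTri.indicator F (a, b) = 0 := fun b => by
      refine Set.indicator_of_notMem (fun h => ha ⟨h.1, ?_⟩) _
      have h1 := h.2.1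
      have h2 := h.2.2
      simp only at h1 h2
      linarith
    simp [this]

theorem setIntegral_unitTri_swap {F : ℝ × ℝ → ℝ} (hF : Continuous F) :
    ∫ z in unitTri, F z = ∫ b in (0 : ℝ)..1, ∫ a in (0 : ℝ)..(1 - b), F (a, b) := by
  have h1 := setIntegral_unitTri (F := fun z => F z.swap) (hF.comp continuous_swap)
  simp only [Prod.swap_prod_mk] at h1
  rw [← h1, Measure.volume_eq_prod]
  have h2 : MeasurePreserving (Prod.swap : ℝ × ℝ → ℝ × ℝ) (volume.prod volume) (volume.prod volume) :=
    Measure.measurePreserving_swap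
  have h3 : Prod.swap ⁻¹' unitTri = unitTri := by
    ext z
    simp only [unitTri, Set.mem_preimage, Set.mem_ofPred_eq, Prod.fst_swap, Prod.snd_swap]
    constructor <;> rintro ⟨h1, h2, h3⟩ <;> exact ⟨h2, h1, by linarith⟩
  have h4 := h2.setIntegral_preimage_emb
    (MeasurableEquiv.prodComm : ℝ × ℝ ≃ᵐ ℝ × ℝ).measurableEmbedding F unitTri
  rw [h3] at h4
  exact h4.symm

theorem area_unitTri : (volume : Measure (ℝ × ℝ)).real unitTri = 1 / 2 := by
  have h1 := setIntegral_unitTri (F := fun _ => 1) continuous_const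
  simp only [setIntegral_const, smul_eq_mul, mul_one, intervalIntegral.integral_const, sub_zero] at h1
  rw [h1, intervalIntegral.integral_sub (by simp) (by simp)]
  simp
  norm_num

/-- The divergence theorem for a function times the position vector on the unit triangle. -/
theorem integral_unitTri_div {g ga gb : ℝ × ℝ → ℝ} (hg : Continuous g) (hga : Continuous ga)
    (hgb : Continuous gb)
    (hda : ∀ a b, HasDerivAt (fun t => g (t, b)) (ga (a, b)) a)
    (hdb : ∀ a b, HasDerivAt (fun t => g (a, t)) (gb (a, b)) b) :
    ∫ z in unitTri, (2 * g z + (z.1 * ga z + z.2 * gb z)) = ∫ t in (0 : ℝ)..1, g (1 - t, t) := by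
  -- The integrand splits into the exact derivatives of `a g` in `a` and of `b g` in `b`. Only the
  -- values on the hypotenuse survive, with weights `1 - b` and `b`, which add up to one.
  have hA : ∫ z in unitTri, (g z + z.1 * ga z) = ∫ b in (0 : ℝ)..1, (1 - b) * g (1 - b, b) := by
    rw [setIntegral_unitTri_swap (by fun_prop)]
    refine intervalIntegral.integral_congr fun b _ => ?_
    have := intervalIntegral.integral_eq_sub_of_hasDerivAt (a := 0) (b := 1 - b)
      (f := fun a => a * g (a, b)) (f' := fun a => g (a, b) + a * ga (a, b)) ?_ ?_
    · simpa using this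
    · intro a _
      exact ((hasDerivAt_id' a).mul (hda a b)).congr_deriv (by simp)
    · exact Continuous.intervalIntegrable (by fun_prop) _ _
  have hB : ∫ z in unitTri, (g z + z.2 * gb z) = ∫ b in (0 : ℝ)..1, b * g (1 - b, b) := by
    rw [setIntegral_unitTri (by fun_prop)]
    have h1 : ∫ b in (0 : ℝ)..1, b * g (1 - b, b) = ∫ a in (0 : ℝ)..1, (1 - a) * g (a, 1 - a) := by
      have := intervalIntegral.integral_comp_sub_left (a := 0) (b := 1)
        (fun a => (1 - a) * g (a, 1 - a)) 1
      simpa using this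
    rw [h1]
    refine intervalIntegral.integral_congr fun a _ => ?_
    have := intervalIntegral.integral_eq_sub_of_hasDerivAt (a := 0) (b := 1 - a)
      (f := fun b => b * g (a, b)) (f' := fun b => g (a, b) + b * gb (a, b)) ?_ ?_
    · simpa using this
    · intro b _
      exact ((hasDerivAt_id' b).mul (hdb a b)).congr_deriv (by simp)
    · exact Continuous.intervalIntegrable (by fun_prop) _ _
  have hint : ∀ F : ℝ × ℝ → ℝ, Continuous F → IntegrableOn F unitTri := fun F hF =>
    hF.continuousOn.integrableOn_compact isCompact_unitTri
  have h1 : ∀ z : ℝ × ℝ, 2 * g z + (z.1 * ga z + z.2 * gb z)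
      = (g z + z.1 * ga z) + (g z + z.2 * gb z) := fun z => by ring
  rw [integral_congr_ae (Eventually.of_forall h1), integral_add (hint _ (by fun_prop)) (hint _ (by fun_prop)), hA, hB,
    ← intervalIntegral.integral_add (Continuous.intervalIntegrable (by fun_prop) _ _)
      (Continuous.intervalIntegrable (by fun_prop) _ _)]
  refine intervalIntegral.integral_congr fun b _ => ?_
  ring

/-- The length measure on a segment is the scaled image of Lebesgue measure. -/
theorem sideMeasure_eq_map (Q R : E) :
    sideMeasure {Q, R} = ENNReal.ofReal (dist Q R) •
      Measure.map (AffineMap.lineMap Q R : ℝ → E) (volume.restrict (Set.Icc 0 1)) := by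
  have hc : Continuous (AffineMap.lineMap Q R : ℝ → E) := AffineMap.lineMap_continuous
  have hs : convexHull ℝ (((({Q, R} : Finset E)) : Set E)) = segment ℝ Q R := by
    rw [Finset.coe_pair, convexHull_pair]
  ext A hA
  rw [sideMeasure, Measure.restrict_apply hA, hs, Measure.smul_apply, Measure.map_apply hc.measurable hA,
    Measure.restrict_apply (hc.measurable hA), segment_eq_image_lineMap, Set.inter_comm,
    ← Set.image_inter_preimage, hausdorffMeasure_lineMap_image, Set.inter_comm, smul_eq_mul,
    hausdorffMeasure_real]
  congr 1
  rw [← coe_nndist, Real.toNNReal_coe]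

theorem integral_sideMeasure (Q R : E) {f : E → ℝ} (hf : AEStronglyMeasurable f
    (Measure.map (AffineMap.lineMap Q R : ℝ → E) (volume.restrict (Set.Icc 0 1)))) :
    ∫ x, f x ∂(sideMeasure {Q, R}) =
      dist Q R * ∫ t in (0 : ℝ)..1, f (AffineMap.lineMap Q R t) := by
  have hc : Continuous (AffineMap.lineMap Q R : ℝ → E) := AffineMap.lineMap_continuous
  rw [sideMeasure_eq_map, integral_smul_measure, integral_map hc.aemeasurable hf,
    intervalIntegral.integral_of_le zero_le_one, ← integral_Icc_eq_integral_Ioc,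
    ENNReal.toReal_ofReal dist_nonneg, smul_eq_mul]

theorem isFiniteMeasure_sideMeasure (Q R : E) : IsFiniteMeasure (sideMeasure {Q, R}) := by
  constructor
  have hc : Continuous (AffineMap.lineMap Q R : ℝ → E) := AffineMap.lineMap_continuous
  rw [sideMeasure_eq_map, Measure.smul_apply, Measure.map_apply hc.measurable MeasurableSet.univ]
  simp

/-! ### Integrals over a triangle with named vertices. -/

section Vertices

variable {P Q R : E} (h : IsTri {P, Q, R}) (hPQ : P ≠ Q) (hPR : P ≠ R) (hQR : Q ≠ R)
include h hPQ hPR hQR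

theorem bary_triParam (z : ℝ × ℝ) :
    bary {P, Q, R} P (triParam P Q R z) = 1 - z.1 - z.2 ∧
    bary {P, Q, R} Q (triParam P Q R z) = z.1 ∧
    bary {P, Q, R} R (triParam P Q R z) = z.2 := by
  classical
  let w : E → ℝ := fun q => if q = P then 1 - z.1 - z.2 else if q = Q then z.1 else z.2
  have hs : ∀ {V : Type} [AddCommMonoid V] (f : E → V), ∑ q ∈ ({P, Q, R} : Finset E), f q
      = f P + (f Q + f R) := fun f => by
    rw [Finset.sum_insert (by simp [hPQ, hPR]), Finset.sum_pair hQR]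
  have hw : ∑ q ∈ ({P, Q, R} : Finset E), w q = 1 := by
    rw [hs]
    simp [w, hPQ.symm, hPR.symm, hQR.symm]
  have hx : ∑ q ∈ ({P, Q, R} : Finset E), w q • q = triParam P Q R z := by
    rw [hs]
    simp only [w, if_true, hPQ.symm, hPR.symm, hQR.symm, if_false, triParam]
    module
  have key := fun {q : E} (hq : q ∈ ({P, Q, R} : Finset E)) => h.bary_sum hw hq
  rw [hx] at key
  refine ⟨?_, ?_, ?_⟩
  · rw [key (by simp)]; simp [w]
  · rw [key (by simp)]; simp [w, hPQ.symm]
  · rw [key (by simp)]; simp [w, hPR.symm, hQR.symm]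

theorem preimage_triParam :
    triParam P Q R ⁻¹' (convexHull ℝ (({P, Q, R} : Finset E) : Set E)) = unitTri := by
  ext z
  obtain ⟨h1, h2, h3⟩ := bary_triParam h hPQ hPR hQR z
  rw [Set.mem_preimage, h.mem_hull_iff]
  simp only [Finset.mem_insert, Finset.mem_singleton, forall_eq_or_imp, forall_eq, h1, h2, h3, unitTri,
    Set.mem_ofPred_eq]
  constructor
  · rintro ⟨a, b, c⟩
    exact ⟨b, c, by linarith⟩
  · rintro ⟨a, b, c⟩
    exact ⟨by linarith, a, b⟩

/-- If the determinant vanished, `w 1 • u = u 1 • w` and `w 0 • u = u 0 • w`. The gradient of the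
coordinate of `Q` pairs to `1` with `u` and to `0` with `w`, so both components of `w` would vanish
and `R` would equal `P`. -/
theorem cross_ne_zero : cross (Q - P) (R - P) ≠ 0 := by
  intro hD
  obtain ⟨u, hu⟩ : ∃ u, u = Q - P := ⟨_, rfl⟩
  obtain ⟨w, hw⟩ : ∃ w, w = R - P := ⟨_, rfl⟩
  rw [← hu, ← hw, cross] at hD
  have e1 : (w 1) • u - (u 1) • w = 0 := by
    ext i
    fin_cases i
    · simp; linarith
    · simp; ring
  have e2 : (w 0) • u - (u 0) • w = 0 := by
    ext i
    fin_cases i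
    · simp; ring
    · simp; linarith
  have hgu : inner ℝ (agrad (bary {P, Q, R} Q)) u = 1 := by
    rw [hu, ← affine_sub_eq_inner, h.bary_self (by simp), h.bary_of_ne (by simp) hPQ.symm, sub_zero]
  have hgw : inner ℝ (agrad (bary {P, Q, R} Q)) w = 0 := by
    rw [hw, ← affine_sub_eq_inner, h.bary_of_ne (by simp) hQR, h.bary_of_ne (by simp) hPQ.symm, sub_zero]
  have k1 := congrArg (fun v : E => (inner ℝ (agrad (bary {P, Q, R} Q)) v : ℝ)) e1
  have k2 := congrArg (fun v : E => (inner ℝ (agrad (bary {P, Q, R} Q)) v : ℝ)) e2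
  simp only [inner_sub_right, inner_smul_right, hgu, hgw, inner_zero_right, mul_one, mul_zero,
    sub_zero] at k1 k2
  have hw0 : w = 0 := by
    ext i
    fin_cases i
    · exact k2
    · exact k1
  rw [hw, sub_eq_zero] at hw0
  exact hPR hw0.symm

theorem setIntegral_hull (f : E → ℝ) :
    ∫ x in convexHull ℝ (({P, Q, R} : Finset E) : Set E), f x =
      |cross (Q - P) (R - P)| * ∫ z in unitTri, f (triParam P Q R z) := by
  have hD := cross_ne_zero h hPQ hPR hQR
  have hemb : MeasurableEmbedding (triParam P Q R) :=
    (continuous_triParam P Q R).measurableEmbedding (triParam_injective hD)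
  have h1 := hemb.setIntegral_map (μ := volume) f (convexHull ℝ (({P, Q, R} : Finset E) : Set E))
  rw [preimage_triParam h hPQ hPR hQR, map_triParam hD, Measure.restrict_smul,
    integral_smul_measure, ENNReal.toReal_ofReal (abs_nonneg _)] at h1
  rw [← h1, smul_eq_mul, ← mul_assoc, abs_inv, mul_inv_cancel₀ (abs_ne_zero.mpr hD), one_mul]

theorem area_eq_cross :
    (volume : Measure E).real (convexHull ℝ (({P, Q, R} : Finset E) : Set E)) =
      |cross (Q - P) (R - P)| / 2 := by
  have h1 := setIntegral_hull h hPQ hPR hQR (fun _ => 1)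
  simp only [setIntegral_const, smul_eq_mul, mul_one, area_unitTri] at h1
  rw [h1]
  ring

/-- The norm of the gradient is the reciprocal of the height over `Q R`. Cramer's rule for its
pairings with `R - Q` and `Q - P` shows that the determinant times the gradient is `R - Q` turned by
a right angle. -/
theorem two_area_mul_norm_agrad :
    2 * (volume : Measure E).real (convexHull ℝ (({P, Q, R} : Finset E) : Set E)) *
      ‖agrad (bary {P, Q, R} P)‖ = dist Q R := by
  rw [area_eq_cross h hPQ hPR hQR]
  set g := agrad (bary {P, Q, R} P) with hg
  have h1 : inner ℝ g (R - Q) = 0 := by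
    rw [hg, ← affine_sub_eq_inner, h.bary_of_ne (by simp) hPR, h.bary_of_ne (by simp) hPQ, sub_zero]
  have h2 : inner ℝ g (Q - P) = -1 := by
    rw [hg, ← affine_sub_eq_inner, h.bary_of_ne (by simp) hPQ, h.bary_self (by simp)]
    norm_num
  simp only [PiLp.inner_apply, Fin.sum_univ_two, RCLike.inner_apply, conj_trivial, PiLp.sub_apply] at h1 h2
  have h3 : |cross (Q - P) (R - P)| * ‖g‖ = dist Q R := by
    rw [dist_eq_norm, ← abs_of_nonneg (norm_nonneg g), ← abs_mul,
      ← abs_of_nonneg (norm_nonneg (Q - R)), ← sq_eq_sq_iff_abs_eq_abs, mul_pow,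
      EuclideanSpace.norm_sq_eq, EuclideanSpace.norm_sq_eq]
    simp only [Fin.sum_univ_two, Real.norm_eq_abs, sq_abs, PiLp.sub_apply, cross]
    have a0 : ((Q 0 - P 0) * (R 1 - P 1) - (Q 1 - P 1) * (R 0 - P 0)) * g 0 = - (R 1 - Q 1) := by
      linear_combination (R 1 - Q 1) * h2 - (Q 1 - P 1) * h1
    have a1 : ((Q 0 - P 0) * (R 1 - P 1) - (Q 1 - P 1) * (R 0 - P 0)) * g 1 = R 0 - Q 0 := by
      linear_combination (Q 0 - P 0) * h1 - (R 0 - Q 0) * h2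
    linear_combination (((Q 0 - P 0) * (R 1 - P 1) - (Q 1 - P 1) * (R 0 - P 0)) * g 0 - (R 1 - Q 1)) * a0
      + (((Q 0 - P 0) * (R 1 - P 1) - (Q 1 - P 1) * (R 0 - P 0)) * g 1 + (R 0 - Q 0)) * a1
  linarith

/-- The mean of a smooth function over a side as an integral over the triangle. -/
theorem integral_hull_div {v : E → ℝ} (hv : ContDiff ℝ 1 v) :
    ∫ x in convexHull ℝ (({P, Q, R} : Finset E) : Set E),
        (2 * v x + (inner ℝ (gradient v x) (x - P) : ℝ)) =
      2 * (volume : Measure E).real (convexHull ℝ (({P, Q, R} : Finset E) : Set E)) *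
        ∫ t in (0 : ℝ)..1, v (AffineMap.lineMap Q R t) := by
  rw [setIntegral_hull h hPQ hPR hQR, area_eq_cross h hPQ hPR hQR]
  have hder : Continuous (fderiv ℝ v) := hv.continuous_fderiv one_ne_zero
  have hpar := continuous_triParam P Q R
  have hda : ∀ (x : E), HasFDerivAt v (fderiv ℝ v x) x := fun x =>
    (hv.differentiable one_ne_zero x).hasFDerivAt
  have key := integral_unitTri_div (g := fun z => v (triParam P Q R z))
    (ga := fun z => fderiv ℝ v (triParam P Q R z) (Q - P))
    (gb := fun z => fderiv ℝ v (triParam P Q R z) (R - P))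
    (hv.continuous.comp hpar) ((hder.comp hpar).clm_apply continuous_const)
    ((hder.comp hpar).clm_apply continuous_const) ?_ ?_
  · have e1 : ∀ z : ℝ × ℝ, 2 * v (triParam P Q R z) +
        (inner ℝ (gradient v (triParam P Q R z)) (triParam P Q R z - P) : ℝ) =
        2 * v (triParam P Q R z) + (z.1 * fderiv ℝ v (triParam P Q R z) (Q - P) +
          z.2 * fderiv ℝ v (triParam P Q R z) (R - P)) := fun z => by
      rw [inner_gradient_left]
      have : triParam P Q R z - P = z.1 • (Q - P) + z.2 • (R - P) := add_sub_cancel_left _ _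
      rw [this]
      simp
    simp_rw [e1]
    rw [key]
    have e2 : ∀ t : ℝ, triParam P Q R (1 - t, t) = AffineMap.lineMap Q R t := fun t => by
      simp only [triParam, AffineMap.lineMap_apply_module]
      module
    simp_rw [e2]
    ring
  · intro a b
    have h1 : HasDerivAt (fun t : ℝ => triParam P Q R (t, b)) (Q - P) a := by
      have := (((hasDerivAt_id a).smul_const (Q - P)).add_const (b • (R - P))).const_add P
      simpa [triParam] using this
    exact (hda _).comp_hasDerivAt a h1
  · intro a b
    have h1 : HasDerivAt (fun t : ℝ => triParam P Q R (a, t)) (R - P) b := by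
      have := (((hasDerivAt_id b).smul_const (R - P)).const_add (a • (Q - P))).const_add P
      simpa [triParam] using this
    exact (hda _).comp_hasDerivAt b h1

end Vertices

/-! ### The Poincaré inequality on convex sets -/

theorem continuous_gradient {f : E → ℝ} (hf : ContDiff ℝ 1 f) : Continuous (gradient f) := by
  have h := hf.continuous_fderiv one_ne_zero
  exact (InnerProductSpace.toDual ℝ E).symm.continuous.comp h

/-- Convexity keeps the image of the homothety inside `K`, and its Jacobian `t ^ 2` is at least `1 /
4`. -/
theorem lintegral_homothety_le {K : Set E} (hK : Convex ℝ K) (hKm : MeasurableSet K) {x : E} (hx : x ∈ K)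
    {t : ℝ} (ht : 1 / 2 ≤ t) (ht1 : t ≤ 1) (g : E → ℝ≥0∞) :
    ∫⁻ y in K, g (x + t • (y - x)) ≤ 4 * ∫⁻ y in K, g y := by
  have h0 : (0 : ℝ) < t := by linarith
  have hder : ∀ y ∈ K, HasFDerivWithinAt (fun y => x + t • (y - x)) (t • ContinuousLinearMap.id ℝ E) K y := by
    intro y _
    exact ((((hasFDerivAt_id y).sub_const x).const_smul t).const_add x).hasFDerivWithinAt
  have hinj : Set.InjOn (fun y => x + t • (y - x)) K := by
    intro y _ z _ hyz
    simpa [h0.ne'] using hyz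
  have h1 := lintegral_image_eq_lintegral_abs_det_fderiv_mul volume hKm hder hinj g
  have hdet : (t • ContinuousLinearMap.id ℝ E).det = t ^ 2 := by
    have : ((t • ContinuousLinearMap.id ℝ E : E →L[ℝ] E) : E →ₗ[ℝ] E) = t • LinearMap.id := rfl
    rw [ContinuousLinearMap.det, this, LinearMap.det_smul]
    simp
  rw [hdet, lintegral_const_mul' _ _ ENNReal.ofReal_ne_top] at h1
  have hsub : (fun y => x + t • (y - x)) '' K ⊆ K := by
    rintro _ ⟨y, hy, rfl⟩
    have := hK hx hy (a := 1 - t) (b := t) (by linarith) h0.le (by ring)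
    convert this using 1
    module
  have h2 : ENNReal.ofReal |t ^ 2| * ∫⁻ y in K, g (x + t • (y - x)) ≤ ∫⁻ y in K, g y := by
    rw [← h1]
    exact lintegral_mono_set hsub
  have h3 : (1 : ℝ≥0∞) ≤ 4 * ENNReal.ofReal |t ^ 2| := by
    have : (4 : ℝ≥0∞) = ENNReal.ofReal 4 := by simp
    rw [this, ← ENNReal.ofReal_mul (by norm_num), ← ENNReal.ofReal_one]
    apply ENNReal.ofReal_le_ofReal
    rw [abs_of_nonneg (by positivity)]
    nlinarith
  calc ∫⁻ y in K, g (x + t • (y - x)) = 1 * ∫⁻ y in K, g (x + t • (y - x)) := (one_mul _).symm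
    _ ≤ (4 * ENNReal.ofReal |t ^ 2|) * ∫⁻ y in K, g (x + t • (y - x)) := by gcongr
    _ ≤ 4 * ∫⁻ y in K, g y := by
      rw [mul_assoc]
      gcongr

/-- For `t ≥ 1 / 2` the inner integral is a homothety about `x`. For `t ≤ 1 / 2` the two
integrations are exchanged and the same point is reached by the homothety about `y` with ratio `1 -
t`. The Jacobian thus never degenerates. -/
theorem lintegral_lintegral_segment_le {K : Set E} (hK : Convex ℝ K) (hKm : MeasurableSet K)
    {t : ℝ} (ht : 0 ≤ t) (ht1 : t ≤ 1) {g : E → ℝ≥0∞} (hg : Measurable g) :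
    ∫⁻ x in K, ∫⁻ y in K, g (x + t • (y - x)) ≤ volume K * (4 * ∫⁻ y in K, g y) := by
  have key : ∀ {s : ℝ}, 1 / 2 ≤ s → s ≤ 1 →
      ∫⁻ x in K, ∫⁻ y in K, g (x + s • (y - x)) ≤ volume K * (4 * ∫⁻ y in K, g y) := by
    intro s hs hs1
    calc ∫⁻ x in K, ∫⁻ y in K, g (x + s • (y - x)) ≤ ∫⁻ _ in K, 4 * ∫⁻ y in K, g y :=
          setLIntegral_mono' hKm fun x hx => lintegral_homothety_le hK hKm hx hs hs1 g
      _ = volume K * (4 * ∫⁻ y in K, g y) := by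
          rw [setLIntegral_const, mul_comm]
  rcases le_total (1 / 2) t with h | h
  · exact key h ht1
  · rw [lintegral_lintegral_swap]
    · have : ∀ x y : E, x + t • (y - x) = y + (1 - t) • (x - y) := fun x y => by module
      simp_rw [this]
      exact key (by linarith) (by linarith)
    · have : Measurable fun p : E × E => p.1 + t • (p.2 - p.1) := by fun_prop
      exact (hg.comp this).aemeasurable

theorem sq_sub_le_integral_segment {f : E → ℝ} (hf : ContDiff ℝ 1 f) {h : ℝ} (x y : E)
    (hxy : ‖y - x‖ ≤ h) :
    ENNReal.ofReal ((f x - f y) ^ 2) ≤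
      ∫⁻ t in Set.Icc (0 : ℝ) 1, ENNReal.ofReal (h ^ 2 * ‖gradient f (x + t • (y - x))‖ ^ 2) := by
  have hgc := continuous_gradient hf
  have hpath : Continuous fun t : ℝ => x + t • (y - x) := by fun_prop
  have hder : ∀ t ∈ Set.uIcc (0 : ℝ) 1, HasDerivAt (fun t : ℝ => f (x + t • (y - x)))
      (inner ℝ (gradient f (x + t • (y - x))) (y - x)) t := by
    intro t _
    have h1 : HasDerivAt (fun t : ℝ => x + t • (y - x)) (y - x) t := by
      simpa using ((hasDerivAt_id t).smul_const (y - x)).const_add x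
    have h2 := (hf.differentiable one_ne_zero (x + t • (y - x))).hasFDerivAt.comp_hasDerivAt t h1
    rw [inner_gradient_left]
    exact h2
  have hcont : Continuous fun t : ℝ => (inner ℝ (gradient f (x + t • (y - x))) (y - x) : ℝ) :=
    (hgc.comp hpath).inner continuous_const
  have hftc := intervalIntegral.integral_eq_sub_of_hasDerivAt hder (hcont.intervalIntegrable _ _)
  have hfin : IsFiniteMeasure (volume.restrict (Set.Icc (0 : ℝ) 1)) := inferInstance
  have hm : MemLp (fun t : ℝ => (inner ℝ (gradient f (x + t • (y - x))) (y - x) : ℝ)) 2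
      (volume.restrict (Set.Icc (0 : ℝ) 1)) := by
    rw [memLp_two_iff_integrable_sq hcont.aestronglyMeasurable]
    exact (hcont.pow 2).continuousOn.integrableOn_compact isCompact_Icc
  have hcs := abs_integral_mul_le hm (memLp_const (1 : ℝ))
  have hone : l2n (volume.restrict (Set.Icc (0 : ℝ) 1)) (fun _ : ℝ => (1 : ℝ)) = 1 := by
    rw [l2n_const]
    simp
  rw [hone, mul_one] at hcs
  simp only [mul_one] at hcs
  rw [integral_Icc_eq_integral_Ioc, ← intervalIntegral.integral_of_le zero_le_one, hftc] at hcs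
  have hsq : (f x - f y) ^ 2 ≤
      ∫ t in Set.Icc (0 : ℝ) 1, (inner ℝ (gradient f (x + t • (y - x))) (y - x) : ℝ) ^ 2 := by
    have h3 := l2n_sq hm
    simp only [Real.norm_eq_abs, sq_abs] at h3
    rw [← h3]
    have h4 : (f x - f y) ^ 2 = |f (x + (1 : ℝ) • (y - x)) - f (x + (0 : ℝ) • (y - x))| ^ 2 := by
      rw [sq_abs]
      simp
      ring
    rw [h4]
    exact pow_le_pow_left₀ (abs_nonneg _) hcs 2
  refine (ENNReal.ofReal_le_ofReal hsq).trans ?_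
  rw [ofReal_integral_eq_lintegral_ofReal
    (f := fun t => (inner ℝ (gradient f (x + t • (y - x))) (y - x) : ℝ) ^ 2)
    ((hcont.pow 2).continuousOn.integrableOn_compact isCompact_Icc)
    (Eventually.of_forall fun t => sq_nonneg _)]
  refine lintegral_mono fun t => ENNReal.ofReal_le_ofReal ?_
  have h5 := abs_real_inner_le_norm (gradient f (x + t • (y - x))) (y - x)
  have h6 : |(inner ℝ (gradient f (x + t • (y - x))) (y - x) : ℝ)| ≤
      h * ‖gradient f (x + t • (y - x))‖ := by
    refine h5.trans ?_
    rw [mul_comm]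
    gcongr
  calc (inner ℝ (gradient f (x + t • (y - x))) (y - x) : ℝ) ^ 2
      = |(inner ℝ (gradient f (x + t • (y - x))) (y - x) : ℝ)| ^ 2 := (sq_abs _).symm
    _ ≤ (h * ‖gradient f (x + t • (y - x))‖) ^ 2 := pow_le_pow_left₀ (abs_nonneg _) h6 2
    _ = h ^ 2 * ‖gradient f (x + t • (y - x))‖ ^ 2 := by ring

/-- The fundamental theorem of calculus along the segment from `x` to `y` is squared by
Cauchy–Schwarz. Tonelli then moves the segment parameter outside, where the uniform bound for each
fixed parameter applies. -/
theorem integral_prod_sq_sub_le {K : Set E} (hK : Convex ℝ K) (hKc : IsCompact K) {f : E → ℝ}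
    (hf : ContDiff ℝ 1 f) {h : ℝ} (hh : ∀ x ∈ K, ∀ y ∈ K, ‖y - x‖ ≤ h) :
    ∫ z, (f z.1 - f z.2) ^ 2 ∂((volume.restrict K).prod (volume.restrict K)) ≤
      4 * volume.real K * h ^ 2 * ∫ x in K, ‖gradient f x‖ ^ 2 := by
  have hKm := hKc.isClosed.measurableSet
  have hgc := continuous_gradient hf
  have hgi : IntegrableOn (fun x => ‖gradient f x‖ ^ 2) K :=
    (hgc.norm.pow 2).continuousOn.integrableOn_compact hKc
  have hcont : Continuous fun z : E × E => (f z.1 - f z.2) ^ 2 :=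
    ((hf.continuous.comp continuous_fst).sub (hf.continuous.comp continuous_snd)).pow 2
  have hint : Integrable (fun z : E × E => (f z.1 - f z.2) ^ 2)
      ((volume.restrict K).prod (volume.restrict K)) := by
    rw [Measure.prod_restrict]
    exact hcont.continuousOn.integrableOn_compact (hKc.prod hKc)
  have hR : 0 ≤ 4 * volume.real K * h ^ 2 * ∫ x in K, ‖gradient f x‖ ^ 2 := by positivity
  rw [← ENNReal.ofReal_le_ofReal_iff hR, ofReal_integral_eq_lintegral_ofReal hint
    (Eventually.of_forall fun z => sq_nonneg _), lintegral_prod _ hcont.measurable.ennreal_ofReal.aemeasurable]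
  have hmeas : Measurable fun p : E × E × ℝ => ENNReal.ofReal
      (h ^ 2 * ‖gradient f (p.1 + p.2.2 • (p.2.1 - p.1))‖ ^ 2) := by
    have : Continuous fun p : E × E × ℝ => h ^ 2 * ‖gradient f (p.1 + p.2.2 • (p.2.1 - p.1))‖ ^ 2 := by
      fun_prop
    exact this.measurable.ennreal_ofReal
  have hG : Measurable fun x => ENNReal.ofReal (h ^ 2 * ‖gradient f x‖ ^ 2) := by
    have : Continuous fun x => h ^ 2 * ‖gradient f x‖ ^ 2 := by fun_prop
    exact this.measurable.ennreal_ofReal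
  calc ∫⁻ x in K, ∫⁻ y in K, ENNReal.ofReal ((f x - f y) ^ 2)
      ≤ ∫⁻ x in K, ∫⁻ y in K, ∫⁻ t in Set.Icc (0 : ℝ) 1,
          ENNReal.ofReal (h ^ 2 * ‖gradient f (x + t • (y - x))‖ ^ 2) :=
        setLIntegral_mono' hKm fun x hx => setLIntegral_mono' hKm fun y hy =>
          sq_sub_le_integral_segment hf x y (hh x hx y hy)
    _ = ∫⁻ x in K, ∫⁻ t in Set.Icc (0 : ℝ) 1, ∫⁻ y in K,
          ENNReal.ofReal (h ^ 2 * ‖gradient f (x + t • (y - x))‖ ^ 2) := by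
        refine lintegral_congr fun x => lintegral_lintegral_swap ?_
        have : Measurable fun p : E × ℝ => (x, p) := by fun_prop
        exact (hmeas.comp this).aemeasurable
    _ = ∫⁻ t in Set.Icc (0 : ℝ) 1, ∫⁻ x in K, ∫⁻ y in K,
          ENNReal.ofReal (h ^ 2 * ‖gradient f (x + t • (y - x))‖ ^ 2) := by
        refine lintegral_lintegral_swap ?_
        refine Measurable.aemeasurable ?_
        have h7 : Measurable fun p : (E × ℝ) × E => ENNReal.ofReal
            (h ^ 2 * ‖gradient f (p.1.1 + p.1.2 • (p.2 - p.1.1))‖ ^ 2) :=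
          hmeas.comp (f := fun p : (E × ℝ) × E => (p.1.1, p.2, p.1.2)) (by fun_prop)
        exact h7.lintegral_prod_right'
    _ ≤ ∫⁻ _ in Set.Icc (0 : ℝ) 1, volume K *
          (4 * ∫⁻ y in K, ENNReal.ofReal (h ^ 2 * ‖gradient f y‖ ^ 2)) :=
        setLIntegral_mono' measurableSet_Icc fun t ht =>
          lintegral_lintegral_segment_le hK hKm ht.1 ht.2 hG
    _ = ENNReal.ofReal (4 * volume.real K * h ^ 2 * ∫ x in K, ‖gradient f x‖ ^ 2) := by
        rw [setLIntegral_const, Real.volume_Icc, sub_zero, ENNReal.ofReal_one, mul_one,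
          ← ofReal_integral_eq_lintegral_ofReal (hgi.const_mul _)
            (Eventually.of_forall fun z => by positivity), integral_const_mul,
          ← ENNReal.ofReal_toReal hKc.measure_lt_top.ne]
        have h4 : (4 : ℝ≥0∞) = ENNReal.ofReal 4 := by simp
        rw [h4, ← ENNReal.ofReal_mul (by norm_num), ← ENNReal.ofReal_mul ENNReal.toReal_nonneg,
          measureReal_def]
        congr 1
        ring

/-- The mean value of a function on a set. -/
def avg (K : Set E) (f : E → ℝ) : ℝ := (volume.real K)⁻¹ * ∫ x in K, f x

theorem memLp_of_continuous {F : Type*} [NormedAddCommGroup F] {K : Set E}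
    (hKc : IsCompact K) {f : E → F} (hf : Continuous f) :
    MemLp f 2 (volume.restrict K) := by
  obtain ⟨C, hC⟩ := hKc.exists_bound_of_continuousOn hf.continuousOn
  have : IsFiniteMeasure (volume.restrict K) := ⟨by simpa using hKc.measure_lt_top⟩
  exact MemLp.of_bound (hf.continuousOn.aestronglyMeasurable_of_isCompact hKc hKc.isClosed.measurableSet) C
    ((ae_restrict_iff' hKc.isClosed.measurableSet).mpr (Eventually.of_forall hC))

/-- The double integral of `(f x - f y) ^ 2` is `2 |K|` times the variance. Its bound by `4 |K| h ^
2` times the squared gradient norm gives the factor `2 h ^ 2`, which is relaxed to `(2 h) ^ 2`. -/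
theorem poincare_smooth {K : Set E} (hK : Convex ℝ K) (hKc : IsCompact K) (hpos : 0 < volume.real K)
    {f : E → ℝ} (hf : ContDiff ℝ 1 f) {h : ℝ} (h0 : 0 ≤ h) (hh : ∀ x ∈ K, ∀ y ∈ K, ‖y - x‖ ≤ h) :
    l2n (volume.restrict K) (fun x => f x - avg K f) ≤
      2 * h * l2n (volume.restrict K) (gradient f) := by
  have : IsFiniteMeasure (volume.restrict K) := ⟨by simpa using hKc.measure_lt_top⟩
  have hfL := memLp_of_continuous hKc hf.continuous
  have hgL := memLp_of_continuous hKc (continuous_gradient hf)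
  have hfi : Integrable f (volume.restrict K) := hfL.integrable (by norm_num)
  have hfi2 : Integrable (fun x => f x ^ 2) (volume.restrict K) := hfL.integrable_sq
  have h1 := integral_prod_sq_sub_le hK hKc hf hh
  have hexp : ∫ z, (f z.1 - f z.2) ^ 2 ∂((volume.restrict K).prod (volume.restrict K)) =
      2 * volume.real K * (∫ x in K, f x ^ 2) - 2 * (∫ x in K, f x) ^ 2 := by
    have e1 : ∀ z : E × E, (f z.1 - f z.2) ^ 2 =
        (f z.1 ^ 2 * 1 + 1 * f z.2 ^ 2) - 2 * (f z.1 * f z.2) := fun z => by ring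
    have i1 : Integrable (fun z : E × E => f z.1 ^ 2 * 1) ((volume.restrict K).prod (volume.restrict K)) :=
      hfi2.mul_prod (integrable_const 1)
    have i2 : Integrable (fun z : E × E => 1 * f z.2 ^ 2) ((volume.restrict K).prod (volume.restrict K)) :=
      (integrable_const 1).mul_prod hfi2
    have i3 : Integrable (fun z : E × E => f z.1 * f z.2) ((volume.restrict K).prod (volume.restrict K)) :=
      hfi.mul_prod hfi
    rw [integral_congr_ae (Eventually.of_forall e1), integral_sub (i1.fun_add i2) (i3.const_mul 2),
      integral_add i1 i2, integral_prod_mul (fun x => f x ^ 2) (fun _ => (1 : ℝ)),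
      integral_prod_mul (fun _ => (1 : ℝ)) (fun x => f x ^ 2), integral_const_mul,
      integral_prod_mul f f]
    simp
    ring
  have hvar : volume.real K * ∫ x in K, (f x - avg K f) ^ 2 =
      volume.real K * (∫ x in K, f x ^ 2) - (∫ x in K, f x) ^ 2 := by
    have e1 : ∀ x, (f x - avg K f) ^ 2 = f x ^ 2 - 2 * avg K f * f x + avg K f ^ 2 := fun x => by ring
    rw [integral_congr_ae (Eventually.of_forall e1),
      integral_add (integrable_fun_sub hfi2 (hfi.const_mul _)) (integrable_const _),
      integral_sub hfi2 (hfi.const_mul _), integral_const_mul, integral_const, measureReal_restrict_apply_univ]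
    have hne := hpos.ne'
    simp only [avg, smul_eq_mul]
    field_simp
    ring
  have hsq : l2n (volume.restrict K) (fun x => f x - avg K f) ^ 2 ≤
      (2 * h * l2n (volume.restrict K) (gradient f)) ^ 2 := by
    rw [mul_pow, l2n_sq (memLp_fun_sub hfL (memLp_const _)), l2n_sq hgL]
    simp only [Real.norm_eq_abs, sq_abs]
    rw [hexp] at h1
    have h2 : volume.real K * ∫ x in K, (f x - avg K f) ^ 2 ≤
        volume.real K * (2 * h ^ 2 * ∫ x in K, ‖gradient f x‖ ^ 2) := by linarith
    have h3 := le_of_mul_le_mul_left h2 hpos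
    have h4 : 0 ≤ h ^ 2 * ∫ x in K, ‖gradient f x‖ ^ 2 := by positivity
    have h5 : ∫ x in K, (f x - avg K f) ^ 2 ≤ (2 * h) ^ 2 * ∫ x in K, ‖gradient f x‖ ^ 2 := by
      linarith
    exact h5
  exact le_of_sq_le_sq hsq (by have := l2n_nonneg (μ := volume.restrict K) (gradient f); positivity)

/-! ### Density of smooth functions -/

section Mollify

variable {F : Type*} [NormedAddCommGroup F] [NormedSpace ℝ F] [CompleteSpace F]

/-- Mollification followed by a contraction of the argument towards `c`. -/
def mollify (φ : ContDiffBump (0 : E)) (c : E) (m : ℝ) (w : E → F) (x : E) : F :=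
  convolution (φ.normed volume) w (ContinuousLinearMap.lsmul ℝ ℝ) volume (c + m • (x - c))

/-- The kernel has mass one. Splitting it as a product of two square roots, Hölder's inequality
bounds the squared convolution pointwise by the convolution of the square, and Tonelli finishes. -/
theorem eLpNorm_convolution_normed_le (φ : ContDiffBump (0 : E)) {w : E → F}
    (hw : AEStronglyMeasurable w volume) :
    eLpNorm (convolution (φ.normed volume) w (ContinuousLinearMap.lsmul ℝ ℝ) volume) 2 volume ≤
      eLpNorm w 2 volume := by
  set k : E → ℝ≥0∞ := fun t => ENNReal.ofReal (φ.normed volume t) with hk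
  have hkm : Measurable k := (φ.continuous_normed).measurable.ennreal_ofReal
  have hk1 : ∫⁻ t, k t = 1 := by
    rw [← ofReal_integral_eq_lintegral_ofReal φ.integrable_normed
      (Eventually.of_forall φ.nonneg_normed), φ.integral_normed, ENNReal.ofReal_one]
  have hpt : ∀ x, ‖convolution (φ.normed volume) w (ContinuousLinearMap.lsmul ℝ ℝ) volume x‖ₑ ^ (2 : ℝ) ≤
      ∫⁻ t, k t * ‖w (x - t)‖ₑ ^ (2 : ℝ) := by
    intro x
    have hwx : AEStronglyMeasurable (fun t => w (x - t)) volume :=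
      hw.comp_quasiMeasurePreserving (quasiMeasurePreserving_sub_left volume x)
    have h1 : ‖convolution (φ.normed volume) w (ContinuousLinearMap.lsmul ℝ ℝ) volume x‖ₑ ≤
        ∫⁻ t, k t * ‖w (x - t)‖ₑ := by
      refine (enorm_integral_le_lintegral_enorm _).trans (lintegral_mono fun t => ?_)
      simp only [ContinuousLinearMap.lsmul_apply, enorm_smul, hk]
      rw [Real.enorm_eq_ofReal (φ.nonneg_normed t)]
    have h2 : ∫⁻ t, k t * ‖w (x - t)‖ₑ ≤
        (∫⁻ t, k t * ‖w (x - t)‖ₑ ^ (2 : ℝ)) ^ (1 / 2 : ℝ) := by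
      have hpq : (2 : ℝ).HolderConjugate 2 := Real.HolderConjugate.two_two
      have h3 := ENNReal.lintegral_mul_le_Lp_mul_Lq volume hpq
        (f := fun t => k t ^ (1 / 2 : ℝ) * ‖w (x - t)‖ₑ) (g := fun t => k t ^ (1 / 2 : ℝ))
        ((hkm.pow_const _).aemeasurable.mul hwx.enorm) (hkm.pow_const _).aemeasurable
      have e1 : ∀ t, (k t ^ (1 / 2 : ℝ)) ^ (2 : ℝ) = k t := fun t => by
        rw [← ENNReal.rpow_mul]; norm_num
      have e2 : ∀ t, k t ^ (1 / 2 : ℝ) * k t ^ (1 / 2 : ℝ) = k t := fun t => by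
        rw [← ENNReal.rpow_add_of_nonneg _ _ (by norm_num) (by norm_num)]; norm_num
      simp only [Pi.mul_apply, ENNReal.mul_rpow_of_nonneg _ _ (zero_le_two : (0 : ℝ) ≤ 2), e1, hk1,
        ENNReal.one_rpow, mul_one] at h3
      refine le_trans (le_of_eq ?_) h3
      refine lintegral_congr fun t => ?_
      rw [mul_right_comm, e2]
    calc _ ≤ ((∫⁻ t, k t * ‖w (x - t)‖ₑ ^ (2 : ℝ)) ^ (1 / 2 : ℝ)) ^ (2 : ℝ) := by
          gcongr
          exact h1.trans h2
      _ = _ := by rw [← ENNReal.rpow_mul]; norm_num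
  rw [eLpNorm_eq_lintegral_rpow_enorm_toReal (by norm_num) (by norm_num),
    eLpNorm_eq_lintegral_rpow_enorm_toReal (by norm_num) (by norm_num)]
  simp only [ENNReal.toReal_ofNat]
  gcongr ?_ ^ _
  calc _ ≤ ∫⁻ x, ∫⁻ t, k t * ‖w (x - t)‖ₑ ^ (2 : ℝ) := lintegral_mono hpt
    _ = ∫⁻ t, ∫⁻ x, k t * ‖w (x - t)‖ₑ ^ (2 : ℝ) := by
        refine lintegral_lintegral_swap ?_
        have h1 : AEStronglyMeasurable (fun p : E × E => w (p.1 - p.2)) (volume.prod volume) :=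
          hw.comp_quasiMeasurePreserving (quasiMeasurePreserving_sub_of_right_invariant volume volume)
        exact ((hkm.comp measurable_snd).aemeasurable).mul (h1.enorm.pow_const _)
    _ = ∫⁻ t, k t * ∫⁻ x, ‖w x‖ₑ ^ (2 : ℝ) := by
        refine lintegral_congr fun t => ?_
        rw [lintegral_const_mul' _ _ (by simp [hk])]
        congr 1
        exact lintegral_sub_right_eq_self (fun x => ‖w x‖ₑ ^ (2 : ℝ)) t
    _ = ∫⁻ x, ‖w x‖ₑ ^ (2 : ℝ) := by
        rw [lintegral_mul_const _ hkm, hk1, one_mul]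

theorem continuous_convolution_normed (φ : ContDiffBump (0 : E)) {w : E → F}
    (hw : LocallyIntegrable w volume) :
    Continuous (convolution (φ.normed volume) w (ContinuousLinearMap.lsmul ℝ ℝ) volume) :=
  (φ.hasCompactSupport_normed.contDiff_convolution_left (n := 0) _
    (φ.contDiff_normed) hw).continuous

/-- The contraction of the argument contributes the Jacobian `m ^ (-2) ≤ 4`, hence a factor 2 in the
norm. The bound is uniform in the mollifier and in `m`, as the density argument requires. -/
theorem eLpNorm_mollify_le (φ : ContDiffBump (0 : E)) (c : E) {m : ℝ} (hm : 1 / 2 ≤ m) {w : E → F}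
    (hw : MemLp w 2 volume) :
    eLpNorm (mollify φ c m w) 2 volume ≤ 2 * eLpNorm w 2 volume := by
  have hm0 : m ≠ 0 := by linarith
  have hwl : LocallyIntegrable w volume := hw.locallyIntegrable (by norm_num)
  have hmap : Measure.map (fun x : E => c + m • (x - c)) volume =
      ENNReal.ofReal |(m ^ 2)⁻¹| • (volume : Measure E) := by
    have e1 : (fun x : E => c + m • (x - c)) = (fun x => (c - m • c) + x) ∘ fun x => m • x := by
      ext1 x; simp only [Function.comp]; module
    rw [e1, ← Measure.map_map (by fun_prop) (by fun_prop), Measure.map_addHaar_smul volume hm0,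
      Measure.map_smul, map_add_left_eq_self]
    simp
  have hcomp : eLpNorm (mollify φ c m w) 2 volume =
      eLpNorm (convolution (φ.normed volume) w (ContinuousLinearMap.lsmul ℝ ℝ) volume) 2
        (ENNReal.ofReal |(m ^ 2)⁻¹| • volume) := by
    rw [← hmap, eLpNorm_map_measure]
    · rfl
    · rw [hmap]
      exact ((continuous_convolution_normed φ hwl).aestronglyMeasurable)
    · fun_prop
  rw [hcomp, eLpNorm_smul_measure_of_ne_top (by norm_num)]
  have h4 : ENNReal.ofReal |(m ^ 2)⁻¹| ^ (1 / (2 : ℝ≥0∞)).toReal ≤ 2 := by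
    have e2 : (2 : ℝ≥0∞) = (ENNReal.ofReal 4) ^ (1 / (2 : ℝ≥0∞)).toReal := by
      rw [ENNReal.ofReal_rpow_of_pos (by norm_num)]
      have : (4 : ℝ) = 2 ^ (2 : ℝ) := by norm_num
      rw [this, ← Real.rpow_mul (by norm_num)]
      simp
    conv_rhs => rw [e2]
    gcongr
    rw [abs_of_pos (by positivity), inv_le_comm₀ (by positivity) (by norm_num)]
    nlinarith
  rw [smul_eq_mul]
  gcongr
  exact eLpNorm_convolution_normed_le φ hw.1

theorem mollify_sub (φ : ContDiffBump (0 : E)) (c : E) (m : ℝ) {w v : E → F}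
    (hw : LocallyIntegrable w volume) (hv : LocallyIntegrable v volume) (x : E) :
    mollify φ c m (fun y => w y - v y) x = mollify φ c m w x - mollify φ c m v x := by
  have hex : ∀ {u : E → F}, LocallyIntegrable u volume →
      ConvolutionExistsAt (φ.normed volume) u (c + m • (x - c)) (ContinuousLinearMap.lsmul ℝ ℝ)
        volume := fun hu =>
    φ.hasCompactSupport_normed.convolutionExists_left _ φ.continuous_normed hu _
  simp only [mollify, convolution]
  rw [← integral_sub (hex hw) (hex hv)]
  refine integral_congr_ae (Eventually.of_forall fun t => ?_)
  simp [smul_sub]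

/-- Mollified and contracted functions converge in `L²` of bounded sets. -/
theorem tendsto_mollify {φ : ℕ → ContDiffBump (0 : E)} (hφ : Tendsto (fun n => (φ n).rOut) atTop (𝓝 0))
    (c : E) {m : ℕ → ℝ} (hm : Tendsto m atTop (𝓝 1)) {w : E → F} (hw : MemLp w 2 volume)
    {U : Set E} (hU : Bornology.IsBounded U) (hUm : MeasurableSet U) :
    L2Lim (volume.restrict U) (fun n => mollify (φ n) c (m n) w) w := by
  have hwl : LocallyIntegrable w volume := hw.locallyIntegrable (by norm_num)
  obtain ⟨R, hR⟩ := hU.subset_closedBall c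
  have hvU : volume U < ⊤ := hU.measure_lt_top
  rw [L2Lim, ENNReal.tendsto_nhds_zero]
  intro ε hε
  by_cases hεt : ε = ⊤
  · exact Eventually.of_forall fun n => by simp [hεt]
  have hε8 : ε / 4 ≠ 0 := (ENNReal.div_pos hε.ne' (by norm_num)).ne'
  -- The error is split through a compactly supported continuous `g`. Mollifying `w - g` costs at
  -- most `2 * (ε / 4)`, while the mollification error of `g` and the distance from `g` to `w` cost
  -- `ε / 4` each.
  obtain ⟨g, hgs, hgw, hgc, hgL⟩ := hw.exists_hasCompactSupport_eLpNorm_sub_le (by norm_num) hε8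
  have hgl : LocallyIntegrable g volume := hgc.locallyIntegrable
  have hguc := hgs.uniformContinuous_of_continuous hgc
  -- A function bounded by `η` on `U` then has norm at most `ε / 4`. Dividing by `A + 1` avoids a
  -- case distinction when `U` is a null set.
  obtain ⟨η, hη, hηU⟩ : ∃ η : ℝ, 0 < η ∧
      (volume.restrict U) Set.univ ^ (2 : ℝ≥0∞).toReal⁻¹ * ENNReal.ofReal η ≤ ε / 4 := by
    have hfin : (volume.restrict U) Set.univ ^ (2 : ℝ≥0∞).toReal⁻¹ ≠ ⊤ := by
      rw [Measure.restrict_apply_univ]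
      exact ENNReal.rpow_ne_top_of_nonneg (by simp) hvU.ne
    set A := (volume.restrict U) Set.univ ^ (2 : ℝ≥0∞).toReal⁻¹ with hA
    refine ⟨(ε / 4 / (A + 1)).toReal, ?_, ?_⟩
    · apply ENNReal.toReal_pos
      · exact (ENNReal.div_pos hε8 (by simp [hfin])).ne'
      · exact ENNReal.div_ne_top (ENNReal.div_ne_top hεt (by norm_num)) (by simp)
    · rw [ENNReal.ofReal_toReal (ENNReal.div_ne_top (ENNReal.div_ne_top hεt (by norm_num)) (by simp))]
      calc A * (ε / 4 / (A + 1)) ≤ (A + 1) * (ε / 4 / (A + 1)) := by gcongr; simp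
        _ = ε / 4 := ENNReal.mul_div_cancel (by simp) (by simp [hfin])
  obtain ⟨δ, hδ, hgδ⟩ := Metric.uniformContinuous_iff.mp hguc (η / 2) (by linarith)
  have ev1 : ∀ᶠ n in atTop, (φ n).rOut < δ / 2 := hφ.eventually_lt_const (by linarith)
  have ev2 : ∀ᶠ n in atTop, |m n - 1| * (|R| + 1) < δ / 2 := by
    have : Tendsto (fun n => |m n - 1| * (|R| + 1)) atTop (𝓝 0) := by
      have h1 := ((hm.sub_const 1).abs).mul_const (|R| + 1)
      simpa using h1
    exact this.eventually_lt_const (by linarith)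
  have ev3 : ∀ᶠ n in atTop, 1 / 2 ≤ m n := hm.eventually_const_le (by norm_num)
  filter_upwards [ev1, ev2, ev3] with n h1 h2 h3
  have hclose : ∀ x ∈ U, ‖mollify (φ n) c (m n) g x - g x‖ ≤ η := by
    intro x hx
    have hxR := hR hx
    rw [Metric.mem_closedBall, dist_eq_norm] at hxR
    set y := c + m n • (x - c) with hy
    have hyx : dist y x < δ / 2 := by
      rw [dist_eq_norm, hy]
      have : c + m n • (x - c) - x = (m n - 1) • (x - c) := by module
      rw [this, norm_smul, Real.norm_eq_abs]
      refine lt_of_le_of_lt ?_ h2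
      gcongr
      exact hxR.trans (by linarith [le_abs_self R])
    have h4 : dist (mollify (φ n) c (m n) g x) (g y) ≤ η / 2 := by
      refine ContDiffBump.dist_normed_convolution_le hgc.aestronglyMeasurable fun z hz => (hgδ ?_).le
      rw [Metric.mem_ball] at hz
      linarith
    have h5 : dist (g y) (g x) ≤ η / 2 := (hgδ (by linarith)).le
    rw [← dist_eq_norm]
    linarith [dist_triangle (mollify (φ n) c (m n) g x) (g y) (g x)]
  have hcm : ∀ {v : E → F}, LocallyIntegrable v volume →
      AEStronglyMeasurable (mollify (φ n) c (m n) v) (volume.restrict U) := fun hv =>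
    (Continuous.aestronglyMeasurable
      ((continuous_convolution_normed (φ n) hv).comp
        (by fun_prop : Continuous fun x : E => c + m n • (x - c))))
  have hsplit : (fun x => mollify (φ n) c (m n) w x - w x) =
      (mollify (φ n) c (m n) (fun y => w y - g y)) +
        ((fun x => mollify (φ n) c (m n) g x - g x) + (fun x => g x - w x)) := by
    ext1 x
    simp only [Pi.add_apply]
    rw [mollify_sub _ _ _ hwl hgl]
    abel
  rw [hsplit]
  have hwg : MemLp (fun y => w y - g y) 2 volume := hw.sub hgL
  have b1 : eLpNorm (mollify (φ n) c (m n) (fun y => w y - g y)) 2 (volume.restrict U) ≤ 2 * (ε / 4) :=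
    (eLpNorm_mono_measure _ Measure.restrict_le_self).trans
      ((eLpNorm_mollify_le (φ n) c h3 hwg).trans (by gcongr; exact hgw))
  have b2 : eLpNorm (fun x => mollify (φ n) c (m n) g x - g x) 2 (volume.restrict U) ≤ ε / 4 := by
    refine (eLpNorm_le_of_ae_bound ?_).trans hηU
    rw [ae_restrict_iff' hUm]
    exact Eventually.of_forall hclose
  have b3 : eLpNorm (fun x => g x - w x) 2 (volume.restrict U) ≤ ε / 4 := by
    refine (eLpNorm_mono_measure _ Measure.restrict_le_self).trans ?_
    have := eLpNorm_sub_comm g w 2 volume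
    exact this.le.trans hgw
  have m2 : AEStronglyMeasurable (fun x => mollify (φ n) c (m n) g x - g x) (volume.restrict U) :=
    (hcm hgl).sub hgc.aestronglyMeasurable
  have m3 : AEStronglyMeasurable (fun x => g x - w x) (volume.restrict U) :=
    hgc.aestronglyMeasurable.sub hw.1.restrict
  calc _ ≤ _ := eLpNorm_add_le (hcm (hwg.locallyIntegrable (by norm_num))) (m2.add m3) (by norm_num)
    _ ≤ 2 * (ε / 4) + (ε / 4 + ε / 4) := by
        gcongr
        exact (eLpNorm_add_le m2 m3 (by norm_num)).trans (by gcongr)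
    _ = ε := by
        have : 2 * (ε / 4) + (ε / 4 + ε / 4) = 4 * (ε / 4) := by ring
        rw [this, ENNReal.mul_div_cancel (by norm_num) (by norm_num)]

end Mollify

/-- The derivative of the convolution falls on the kernel. Since the ball around `y` lies in `U`,
the reflected kernel `z ↦ k (y - z)` is an admissible test function, and the definition of the weak
gradient moves the derivative onto `ψ`. -/
theorem hasGradientAt_convolution_normed (φ : ContDiffBump (0 : E)) {U : Set E} (hU : IsOpen U)
    {ψ : E → ℝ} {G : E → E} (hψ : LocallyIntegrable (U.indicator ψ) volume)
    (hw : HasWeakGrad U ψ G) {y : E}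
    (hy : Metric.closedBall y φ.rOut ⊆ U) :
    HasGradientAt (convolution (φ.normed volume) (U.indicator ψ) (ContinuousLinearMap.lsmul ℝ ℝ) volume)
      (convolution (φ.normed volume) (U.indicator G) (ContinuousLinearMap.lsmul ℝ ℝ) volume y) y := by
  set k := φ.normed (volume : Measure E) with hk
  have hkc : ContDiff ℝ ∞ k := φ.contDiff_normed
  have hks : HasCompactSupport k := φ.hasCompactSupport_normed
  have hder := hks.hasFDerivAt_convolution_left (μ := volume) (ContinuousLinearMap.lsmul ℝ ℝ)
    (hkc.of_le (by simp)) hψ y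
  rw [hasGradientAt_iff_hasFDerivAt]
  refine hder.congr_fderiv (ContinuousLinearMap.ext fun e => ?_)
  let η : E → ℝ := fun z => k (y - z)
  have hηc : ContDiff ℝ ∞ η := hkc.comp (contDiff_const.sub contDiff_id)
  have hηsub : tsupport η ⊆ Metric.closedBall y φ.rOut := by
    refine closure_minimal ?_ Metric.isClosed_closedBall
    intro z hz
    have h1 : y - z ∈ Function.support k := hz
    rw [hk, φ.support_normed_eq, Metric.mem_ball, dist_zero_right] at h1
    rw [Metric.mem_closedBall, dist_comm, dist_eq_norm]
    exact h1.le
  have hηs : HasCompactSupport η := (isCompact_closedBall y φ.rOut).of_isClosed_subset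
    (isClosed_tsupport η) hηsub
  have hηd : ∀ z, HasFDerivAt η (-(fderiv ℝ k (y - z))) z := by
    intro z
    have h1 := (hkc.differentiable (by simp) (y - z)).hasFDerivAt
    have h2 : HasFDerivAt (fun z : E => y - z) (-(ContinuousLinearMap.id ℝ E)) z :=
      (hasFDerivAt_id z).const_sub y
    have h3 := h1.comp z h2
    exact h3.congr_fderiv (by ext; simp)
  have hηgrad : ∀ z, (inner ℝ (gradient η z) e : ℝ) = -(fderiv ℝ k (y - z) e) := by
    intro z
    rw [inner_gradient_left, (hηd z).fderiv]
    rfl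
  have hηgc : Continuous (gradient η) := continuous_gradient (hηc.of_le (by simp))
  have hηgs : HasCompactSupport (gradient η) := by
    refine hηs.mono' fun z hz => ?_
    by_contra hcon
    refine hz ?_
    have : η =ᶠ[𝓝 z] 0 := by
      have := (isClosed_tsupport η).isOpen_compl.mem_nhds hcon
      filter_upwards [this] with x hx
      exact image_eq_zero_of_notMem_tsupport hx
    rw [gradient, this.fderiv_eq]
    simp
  have hweak := hw η hηc hηs (hηsub.trans hy)
  have hL : (inner ℝ (convolution k (U.indicator G) (ContinuousLinearMap.lsmul ℝ ℝ) volume y) e : ℝ) =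
      inner ℝ (∫ z in U, η z • G z) e := by
    congr 1
    rw [convolution_eq_swap, ← integral_indicator hU.measurableSet]
    refine integral_congr_ae (Eventually.of_forall fun z => ?_)
    simp [η, Set.indicator_smul]
  have hR : (convolution (fderiv ℝ k) (U.indicator ψ)
      (ContinuousLinearMap.precompL E (ContinuousLinearMap.lsmul ℝ ℝ)) volume y) e =
      - (inner ℝ (∫ z in U, ψ z • gradient η z) e : ℝ) := by
    have hce : ConvolutionExistsAt (fderiv ℝ k) (U.indicator ψ) y
        (ContinuousLinearMap.precompL E (ContinuousLinearMap.lsmul ℝ ℝ)) volume :=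
      (hks.fderiv (𝕜 := ℝ)).convolutionExists_left _ (hkc.continuous_fderiv (by simp)) hψ y
    have hint : Integrable (fun z => U.indicator ψ z • gradient η z) volume :=
      hψ.integrable_smul_right_of_hasCompactSupport hηgc hηgs
    rw [convolution, ContinuousLinearMap.integral_apply hce, ← integral_indicator hU.measurableSet]
    have e1 : U.indicator (fun z => ψ z • gradient η z) = fun z => U.indicator ψ z • gradient η z := by
      ext1 z
      by_cases hz : z ∈ U <;> simp [hz]
    rw [e1, real_inner_comm, ← integral_inner hint, ← integral_neg,
      ← integral_sub_left_eq_self _ volume y]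
    refine integral_congr_ae (Eventually.of_forall fun z => ?_)
    simp only [ContinuousLinearMap.precompL_apply, ContinuousLinearMap.lsmul_apply, inner_smul_right,
      sub_sub_cancel, smul_eq_mul]
    rw [real_inner_comm, hηgrad]
    ring
  rw [InnerProductSpace.toDual_apply_apply, hL, hR, hweak, inner_neg_left, neg_neg]

/-- Smooth functions are dense in `H¹(U)` if `U` is bounded and its closure can be contracted into `U`. -/
theorem exists_smooth_approx {U : Set E} (hU : IsOpen U) (hb : Bornology.IsBounded U) {c : E}
    (hc : ∀ m : ℝ, 0 ≤ m → m < 1 → ∀ x ∈ closure U, c + m • (x - c) ∈ U) {ψ : E → ℝ} {G : E → E}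
    (hψ : MemLp ψ 2 (volume.restrict U)) (hG : HasL2WeakGrad U ψ G) :
    ∃ f : ℕ → E → ℝ, (∀ k, ContDiff ℝ ∞ (f k)) ∧ L2Lim (volume.restrict U) f ψ ∧
      L2Lim (volume.restrict U) (fun k => gradient (f k)) G := by
  have hu : MemLp (U.indicator ψ) 2 volume := (memLp_indicator_iff_restrict hU.measurableSet).mpr hψ
  have hΓ : MemLp (U.indicator G) 2 volume := (memLp_indicator_iff_restrict hU.measurableSet).mpr hG.1
  have hul := hu.locallyIntegrable (by norm_num)
  have hΓl := hΓ.locallyIntegrable (by norm_num)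
  let m : ℕ → ℝ := fun n => 1 - 1 / ((n : ℝ) + 1)
  have hm : Tendsto m atTop (𝓝 1) := by
    have := (tendsto_one_div_add_atTop_nhds_zero_nat (𝕜 := ℝ)).const_sub 1
    simpa [m] using this
  have hm0 : ∀ n : ℕ, 0 ≤ m n := fun n => by
    have : 1 / ((n : ℝ) + 1) ≤ 1 := by
      rw [div_le_one (by positivity)]; linarith [(Nat.cast_nonneg n : (0 : ℝ) ≤ n)]
    simp only [m]; linarith
  have hm1 : ∀ n : ℕ, m n < 1 := fun n => by
    have : 0 < 1 / ((n : ℝ) + 1) := by positivity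
    simp only [m]; linarith
  -- The contracted closure is a compact subset of the open set `U`, so a mollifier of sufficiently
  -- small radius sees only values of `ψ` inside `U`.
  have hδ : ∀ n : ℕ, ∃ δ : ℝ, 0 < δ ∧ δ ≤ 1 / ((n : ℝ) + 1) ∧
      ∀ x ∈ U, Metric.closedBall (c + m n • (x - c)) δ ⊆ U := by
    intro n
    have hK : IsCompact ((fun x => c + m n • (x - c)) '' closure U) :=
      (hb.isCompact_closure).image (by fun_prop)
    have hKU : (fun x => c + m n • (x - c)) '' closure U ⊆ U := by
      rintro _ ⟨x, hx, rfl⟩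
      exact hc _ (hm0 n) (hm1 n) x hx
    obtain ⟨δ, hδ, hsub⟩ := hK.exists_cthickening_subset_open hU hKU
    refine ⟨min δ (1 / ((n : ℝ) + 1)), lt_min hδ (by positivity), min_le_right _ _, fun x hx => ?_⟩
    have hmem : c + m n • (x - c) ∈ (fun x => c + m n • (x - c)) '' closure U :=
      ⟨x, subset_closure hx, rfl⟩
    have h1 := Metric.closedBall_subset_cthickening hmem δ
    exact (Metric.closedBall_subset_closedBall (min_le_left _ _)).trans (h1.trans hsub)
  choose δ hδ0 hδn hδU using hδ
  let φ : ℕ → ContDiffBump (0 : E) := fun n => ⟨δ n / 2, δ n, by linarith [hδ0 n], by linarith [hδ0 n]⟩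
  have hφ : Tendsto (fun n => (φ n).rOut) atTop (𝓝 0) :=
    squeeze_zero (fun n => (hδ0 n).le) hδn tendsto_one_div_add_atTop_nhds_zero_nat
  have hconvC : ∀ n, ContDiff ℝ ∞ (convolution ((φ n).normed volume) (U.indicator ψ)
      (ContinuousLinearMap.lsmul ℝ ℝ) volume) := fun n =>
    (φ n).hasCompactSupport_normed.contDiff_convolution_left _ (φ n).contDiff_normed hul
  have hind : ∀ {V : Type} [Zero V] (w : E → V), U.indicator w =ᵐ[volume.restrict U] w := fun w => by
    filter_upwards [ae_restrict_mem hU.measurableSet] with x hx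
    exact Set.indicator_of_mem hx w
  refine ⟨fun n => mollify (φ n) c (m n) (U.indicator ψ), fun n => ?_, ?_, ?_⟩
  · exact (hconvC n).comp (by fun_prop : ContDiff ℝ ∞ fun x : E => c + m n • (x - c))
  · exact (tendsto_mollify hφ c hm hu hb hU.measurableSet).congr (hind ψ)
  -- The chain rule leaves a factor `m n` in front of the mollified gradient. It tends to one, so
  -- the additional error `(m n - 1) • G` vanishes in the limit.
  · have hgrad : ∀ n, ∀ x ∈ U, gradient (mollify (φ n) c (m n) (U.indicator ψ)) x =
        m n • mollify (φ n) c (m n) (U.indicator G) x := by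
      intro n x hx
      have h1 := (hasGradientAt_convolution_normed (φ n) hU hul hG.2 (hδU n x hx)).hasFDerivAt
      have h2 : HasFDerivAt (fun x : E => c + m n • (x - c)) (m n • ContinuousLinearMap.id ℝ E) x :=
        (((hasFDerivAt_id x).sub_const c).const_smul (m n)).const_add c
      have h3 := h1.comp x h2
      apply HasGradientAt.gradient
      rw [hasGradientAt_iff_hasFDerivAt]
      refine h3.congr_fderiv (ContinuousLinearMap.ext fun e => ?_)
      simp [mollify]
    have h1 := (tendsto_mollify hφ c hm hΓ hb hU.measurableSet).congr (hind G)
    have h2 : Tendsto (fun n => ENNReal.ofReal |m n - 1| * eLpNorm G 2 (volume.restrict U)) atTop (𝓝 0) := by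
      have h3 : Tendsto (fun n => ENNReal.ofReal |m n - 1|) atTop (𝓝 0) := by
        have := ENNReal.tendsto_ofReal ((hm.sub_const 1).abs)
        simpa using this
      have := ENNReal.Tendsto.mul_const h3 (Or.inr hG.1.eLpNorm_ne_top)
      simpa using this
    have h4 := h1.add h2
    rw [add_zero] at h4
    refine tendsto_of_tendsto_of_tendsto_of_le_of_le tendsto_const_nhds h4 (fun _ => zero_le) fun n => ?_
    have hcm : AEStronglyMeasurable (mollify (φ n) c (m n) (U.indicator G)) (volume.restrict U) :=
      (Continuous.aestronglyMeasurable
        ((continuous_convolution_normed (φ n) hΓl).comp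
          (by fun_prop : Continuous fun x : E => c + m n • (x - c))))
    have e1 : eLpNorm (fun x => gradient (mollify (φ n) c (m n) (U.indicator ψ)) x - G x) 2
        (volume.restrict U) = eLpNorm ((m n • fun x => (mollify (φ n) c (m n) (U.indicator G) x - G x)) +
          (m n - 1) • G) 2 (volume.restrict U) := by
      refine eLpNorm_congr_ae ?_
      filter_upwards [ae_restrict_mem hU.measurableSet] with x hx
      rw [hgrad n x hx]
      simp only [Pi.add_apply, Pi.smul_apply]
      module
    simp only at e1 ⊢
    rw [e1]
    refine (eLpNorm_add_le ((hcm.sub hG.1.1).const_smul _) (hG.1.1.const_smul _) (by norm_num)).trans ?_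
    rw [eLpNorm_const_smul, eLpNorm_const_smul, Real.enorm_eq_ofReal_abs, Real.enorm_eq_ofReal_abs]
    gcongr
    refine mul_le_of_le_one_left zero_le ?_
    rw [ENNReal.ofReal_le_one, abs_of_nonneg (hm0 n)]
    exact (hm1 n).le

/-! ### Weak gradients -/

/-- The fundamental lemma of the calculus of variations. It makes the arbitrary choice in `weakGrad`
harmless on open sets. -/
theorem HasL2WeakGrad.ae_eq {U : Set E} (hU : IsOpen U) {ψ : E → ℝ} {G H : E → E}
    (hG : HasL2WeakGrad U ψ G) (hH : HasL2WeakGrad U ψ H) : G =ᵐ[volume.restrict U] H := by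
  have hloc : ∀ {K : E → E}, MemLp K 2 (volume.restrict U) → LocallyIntegrable (U.indicator K) volume :=
    fun hK => ((memLp_indicator_iff_restrict hU.measurableSet).mpr hK).locallyIntegrable (by norm_num)
  have h1 : LocallyIntegrableOn (U.indicator G - U.indicator H) U volume :=
    ((hloc hG.1).sub (hloc hH.1)).locallyIntegrableOn U
  have h2 := hU.ae_eq_zero_of_integral_contDiff_smul_eq_zero h1 fun η hη hηs hηU => by
    have e1 := hG.2 η hη hηs hηU
    have e2 := hH.2 η hη hηs hηU
    have i1 := (hloc hG.1).integrable_smul_left_of_hasCompactSupport hη.continuous hηs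
    have i2 := (hloc hH.1).integrable_smul_left_of_hasCompactSupport hη.continuous hηs
    have e3 : ∀ K : E → E, ∫ x in U, η x • K x = ∫ x, η x • U.indicator K x := fun K => by
      rw [← integral_indicator hU.measurableSet]
      congr 1
      ext1 x
      by_cases hx : x ∈ U <;> simp [hx]
    simp only [Pi.sub_apply, smul_sub]
    rw [integral_sub i1 i2, ← e3, ← e3]
    rw [e1, neg_inj] at e2
    rw [e2, sub_self]
  rw [Filter.EventuallyEq, ae_restrict_iff' hU.measurableSet]
  filter_upwards [h2] with x hx hxU
  have := hx hxU
  simpa [hxU, sub_eq_zero] using this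

theorem HasL2WeakGrad.mono {U V : Set E} (hV : MeasurableSet V) (hUV : U ⊆ V)
    {ψ : E → ℝ} {G : E → E}
    (hG : HasL2WeakGrad V ψ G) : HasL2WeakGrad U ψ G := by
  refine ⟨hG.1.mono_measure (Measure.restrict_mono hUV le_rfl), fun η hη hηs hηU => ?_⟩
  have h := hG.2 η hη hηs (hηU.trans hUV)
  have key : ∀ K : E → E, (∀ x, x ∉ U → K x = 0) → ∫ x in V, K x = ∫ x in U, K x := fun K hK =>
    setIntegral_eq_of_subset_of_forall_sdiff_eq_zero hV hUV fun x hx => hK x hx.2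
  have hη0 : ∀ x, x ∉ U → η x = 0 := fun x hx =>
    image_eq_zero_of_notMem_tsupport fun hxs => hx (hηU hxs)
  rw [key, key] at h
  · exact h
  · intro x hx
    rw [hη0 x hx, zero_smul]
  · intro x hx
    have : η =ᶠ[𝓝 x] 0 := by
      have := (isClosed_tsupport η).isOpen_compl.mem_nhds (fun hxs => hx (hηU hxs))
      filter_upwards [this] with z hz
      exact image_eq_zero_of_notMem_tsupport hz
    rw [gradient, this.fderiv_eq]
    simp

theorem HasL2WeakGrad.congr {U : Set E} {ψ ψ' : E → ℝ} {G G' : E → E} (hG : HasL2WeakGrad U ψ G)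
    (h1 : ψ =ᵐ[volume.restrict U] ψ') (h2 : G =ᵐ[volume.restrict U] G') : HasL2WeakGrad U ψ' G' := by
  refine ⟨hG.1.ae_eq h2, fun η hη hηs hηU => ?_⟩
  rw [← integral_congr_ae (f := fun x => ψ x • gradient η x), hG.2 η hη hηs hηU]
  · congr 1
    refine integral_congr_ae ?_
    filter_upwards [h2] with x hx
    rw [hx]
  · filter_upwards [h1] with x hx
    rw [hx]

theorem memLp_gradient_test {U : Set E} {η : E → ℝ} (hη : ContDiff ℝ ∞ η) (hηs : HasCompactSupport η) :
    MemLp (gradient η) 2 (volume.restrict U) ∧ MemLp η 2 (volume.restrict U) := by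
  have hc := continuous_gradient (hη.of_le (by simp))
  have hs : HasCompactSupport (gradient η) := by
    refine hηs.mono' fun z hz => ?_
    by_contra hcon
    refine hz ?_
    have : η =ᶠ[𝓝 z] 0 := by
      have := (isClosed_tsupport η).isOpen_compl.mem_nhds hcon
      filter_upwards [this] with x hx
      exact image_eq_zero_of_notMem_tsupport hx
    rw [gradient, this.fderiv_eq]
    simp
  exact ⟨(hc.memLp_of_hasCompactSupport hs).restrict U,
    (hη.continuous.memLp_of_hasCompactSupport hηs).restrict U⟩

theorem MemH1.hasL2WeakGrad {U : Set E} {ψ : E → ℝ} (h : MemH1 U ψ) :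
    HasL2WeakGrad U ψ (weakGrad U ψ) := by
  rw [weakGrad, dif_pos h.2]
  exact h.2.choose_spec

theorem HasL2WeakGrad.weakGrad_ae_eq {U : Set E} (hU : IsOpen U) {ψ : E → ℝ} {G : E → E}
    (hG : HasL2WeakGrad U ψ G) : weakGrad U ψ =ᵐ[volume.restrict U] G := by
  have h : ∃ G, HasL2WeakGrad U ψ G := ⟨G, hG⟩
  have h2 : HasL2WeakGrad U ψ (weakGrad U ψ) := by
    rw [weakGrad, dif_pos h]
    exact h.choose_spec
  exact h2.ae_eq hU hG

theorem HasL2WeakGrad.linear_comb {U : Set E} {ψ ζ : E → ℝ} {G H : E → E}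
    (hψ : MemLp ψ 2 (volume.restrict U)) (hζ : MemLp ζ 2 (volume.restrict U))
    (hG : HasL2WeakGrad U ψ G) (hH : HasL2WeakGrad U ζ H) (a b : ℝ) :
    HasL2WeakGrad U (fun x => a * ψ x + b * ζ x) (fun x => a • G x + b • H x) := by
  refine ⟨(hG.1.const_smul a).add (hH.1.const_smul b), fun η hη hηs hηU => ?_⟩
  obtain ⟨g1, g2⟩ := memLp_gradient_test (U := U) hη hηs
  have i1 : ∀ {w : E → ℝ}, MemLp w 2 (volume.restrict U) →
      Integrable (fun x => w x • gradient η x) (volume.restrict U) := fun hw =>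
    memLp_one_iff_integrable.mp (g1.smul hw)
  have i2 : ∀ {w : E → E}, MemLp w 2 (volume.restrict U) →
      Integrable (fun x => η x • w x) (volume.restrict U) := fun hw =>
    memLp_one_iff_integrable.mp (hw.smul g2)
  have e1 : ∀ x, (a * ψ x + b * ζ x) • gradient η x =
      a • (ψ x • gradient η x) + b • (ζ x • gradient η x) := fun x => by module
  have e2 : ∀ x, η x • (a • G x + b • H x) = a • (η x • G x) + b • (η x • H x) := fun x => by module
  simp_rw [e1, e2]
  have j1 : Integrable (fun x => a • (ψ x • gradient η x)) (volume.restrict U) := (i1 hψ).smul a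
  have j2 : Integrable (fun x => b • (ζ x • gradient η x)) (volume.restrict U) := (i1 hζ).smul b
  have j3 : Integrable (fun x => a • (η x • G x)) (volume.restrict U) := (i2 hG.1).smul a
  have j4 : Integrable (fun x => b • (η x • H x)) (volume.restrict U) := (i2 hH.1).smul b
  rw [integral_add j1 j2, integral_add j3 j4, integral_smul, integral_smul, integral_smul,
    integral_smul, hG.2 η hη hηs hηU, hH.2 η hη hηs hηU]
  module

/-! ### Sides, normals and traces on a triangle -/

/-- The closed triangle or segment with the given vertices. -/
abbrev hull (T : Finset E) : Set E := convexHull ℝ (T : Set E)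

/-- The area of a triangle. -/
def area (T : Finset E) : ℝ := (volume : Measure E).real (hull T)

/-- The length of a side. -/
def len (s : Finset E) : ℝ := (sideMeasure s).real Set.univ

/-- `s` is the side of the triangle `T` opposite to the vertex `P`. -/
structure IsOpp (T s : Finset E) (P : E) : Prop where
  tri : IsTri T
  subset : s ⊆ T
  card : s.card = 2
  mem : P ∈ T
  notMem : P ∉ s

theorem IsTri.exists_opp {T s : Finset E} (h : IsTri T) (hs : s ⊆ T) (hc : s.card = 2) :
    ∃ P, IsOpp T s P := by
  obtain ⟨P, hP, hPs⟩ : ∃ P ∈ T, P ∉ s := by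
    by_contra! hcon
    have := Finset.card_le_card (show T ⊆ s from hcon)
    rw [h.1, hc] at this
    omega
  exact ⟨P, h, hs, hc, hP, hPs⟩

theorem IsTri.isOpp_erase {T : Finset E} (h : IsTri T) {P : E} (hP : P ∈ T) :
    IsOpp T (T.erase P) P :=
  ⟨h, Finset.erase_subset _ _, by rw [Finset.card_erase_of_mem hP, h.1], hP, Finset.notMem_erase _ _⟩

theorem IsOpp.eq_erase {T s : Finset E} {P : E} (h : IsOpp T s P) : s = T.erase P := by
  refine Finset.eq_of_subset_of_card_le ?_ ?_
  · intro q hq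
    rw [Finset.mem_erase]
    exact ⟨fun hqP => h.notMem (hqP ▸ hq), h.subset hq⟩
  · rw [Finset.card_erase_of_mem h.mem, h.tri.1, h.card]

theorem IsOpp.eq_or_mem {T s : Finset E} {P : E} (h : IsOpp T s P) {q : E} (hq : q ∈ T) :
    q = P ∨ q ∈ s := by
  rw [h.eq_erase, Finset.mem_erase]
  tauto

theorem IsOpp.vertices {T s : Finset E} {P : E} (h : IsOpp T s P) :
    ∃ Q R, P ≠ Q ∧ P ≠ R ∧ Q ≠ R ∧ T = {P, Q, R} ∧ s = {Q, R} := by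
  obtain ⟨Q, R, hQR, hs⟩ := Finset.card_eq_two.mp h.card
  refine ⟨Q, R, ?_, ?_, hQR, ?_, hs⟩
  · rintro rfl; exact h.notMem (by rw [hs]; simp)
  · rintro rfl; exact h.notMem (by rw [hs]; simp)
  · rw [← hs, h.eq_erase, Finset.insert_erase h.mem]

theorem len_pair (Q R : E) : len {Q, R} = dist Q R := by
  have h := integral_sideMeasure Q R (f := fun _ => 1) aestronglyMeasurable_const
  simpa [len] using h

theorem isFiniteMeasure_side {s : Finset E} (hs : s.card = 2) : IsFiniteMeasure (sideMeasure s) := by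
  obtain ⟨Q, R, _, rfl⟩ := Finset.card_eq_two.mp hs
  exact isFiniteMeasure_sideMeasure Q R

theorem len_pos {s : Finset E} (hs : s.card = 2) : 0 < len s := by
  obtain ⟨Q, R, hQR, rfl⟩ := Finset.card_eq_two.mp hs
  rw [len_pair]
  exact dist_pos.mpr hQR

theorem IsOpp.two_area_mul_norm {T s : Finset E} {P : E} (h : IsOpp T s P) :
    2 * area T * ‖agrad (bary T P)‖ = len s := by
  obtain ⟨Q, R, hPQ, hPR, hQR, rfl, rfl⟩ := h.vertices
  rw [len_pair]
  exact two_area_mul_norm_agrad h.tri hPQ hPR hQR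

theorem IsOpp.inner_agrad_side {T s : Finset E} {P : E} (h : IsOpp T s P) {x y : E} (hx : x ∈ s)
    (hy : y ∈ s) : (inner ℝ (agrad (bary T P)) (y - x) : ℝ) = 0 := by
  rw [← affine_sub_eq_inner, h.tri.bary_of_ne (h.subset hx), h.tri.bary_of_ne (h.subset hy), sub_zero]
  · rintro rfl; exact h.notMem hy
  · rintro rfl; exact h.notMem hx

/-- The outer normal scaled by the length of the side. -/
theorem IsOpp.len_smul_normal {T s : Finset E} {P : E} (h : IsOpp T s P) :
    len s • outwardNormal T s = -(2 * area T) • agrad (bary T P) := by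
  obtain ⟨Q, R, hPQ, hPR, hQR, hT, hs⟩ := h.vertices
  set g := agrad (bary T P) with hg
  have hlen := h.two_area_mul_norm
  have hlp := len_pos h.card
  have hap : 0 < area T := h.tri.area_pos
  have hgn : 0 < ‖g‖ := by
    rw [← hg] at hlen
    by_contra hcon
    have : ‖g‖ = 0 := le_antisymm (not_lt.mp hcon) (norm_nonneg _)
    rw [this, mul_zero] at hlen
    linarith
  have hQs : Q ∈ s := by rw [hs]; simp
  have hRs : R ∈ s := by rw [hs]; simp
  have hPg : ∀ x ∈ s, (inner ℝ g (P - x) : ℝ) = 1 := by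
    intro x hx
    rw [hg, ← affine_sub_eq_inner, h.tri.bary_self h.mem, h.tri.bary_of_ne (h.subset hx), sub_zero]
    rintro rfl; exact h.notMem hx
  -- The normal is defined by choice, so existence comes first, with the normalized negative
  -- gradient as witness. Uniqueness is seen afterwards: any admissible vector is orthogonal to `R -
  -- Q` and hence a multiple of the gradient, with a nonpositive factor fixed by the unit norm.
  have hex : ∃ n : E, ‖n‖ = 1 ∧ ∀ x ∈ s, ∀ y ∈ T, (inner ℝ n (y - x) : ℝ) ≤ 0 := by
    refine ⟨-(‖g‖⁻¹ • g), ?_, fun x hx y hy => ?_⟩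
    · rw [norm_neg, norm_smul, norm_inv, norm_norm, inv_mul_cancel₀ hgn.ne']
    · rw [inner_neg_left, inner_smul_left]
      have : 0 ≤ (inner ℝ g (y - x) : ℝ) := by
        rcases h.eq_or_mem hy with rfl | hys
        · rw [hPg x hx]; norm_num
        · rw [h.inner_agrad_side hx hys]
      simp only [conj_trivial]
      have h2 : 0 ≤ ‖g‖⁻¹ * (inner ℝ g (y - x) : ℝ) := by positivity
      linarith
  obtain ⟨hn1, hn2⟩ := Classical.epsilon_spec hex
  change ‖outwardNormal T s‖ = 1 at hn1
  change ∀ x ∈ s, ∀ y ∈ T, (inner ℝ (outwardNormal T s) (y - x) : ℝ) ≤ 0 at hn2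
  set n := outwardNormal T s
  have hQR0 : (inner ℝ n (R - Q) : ℝ) = 0 := by
    refine le_antisymm (hn2 Q hQs R (h.subset hRs)) ?_
    have := hn2 R hRs Q (h.subset hQs)
    rw [← neg_sub, inner_neg_right] at this
    linarith
  obtain ⟨a, ha⟩ : ∃ a : ℝ, a = inner ℝ n (P - Q) := ⟨_, rfl⟩
  have ha0 : a ≤ 0 := by rw [ha]; exact hn2 Q hQs P h.mem
  have hna : n = a • g := by
    refine ext_inner_right ℝ fun e => ?_
    have h1 := h.tri.sum_inner_agrad_smul e
    have h2 : ∑ q ∈ T, (inner ℝ (agrad (bary T q)) e : ℝ) = 0 := by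
      rw [← sum_inner, h.tri.sum_agrad_bary, inner_zero_left]
    have h3 : e = ∑ q ∈ T, (inner ℝ (agrad (bary T q)) e : ℝ) • (q - Q) := by
      simp_rw [smul_sub, Finset.sum_sub_distrib, ← Finset.sum_smul, h2, h1]
      simp
    conv_lhs => rw [h3]
    rw [inner_sum, Finset.sum_eq_single P]
    · rw [inner_smul_right, ← ha, inner_smul_left, ← hg]
      simp [mul_comm]
    · intro q hq hqP
      have hqs : q ∈ s := (h.eq_or_mem hq).resolve_left hqP
      rw [hs] at hqs
      simp only [Finset.mem_insert, Finset.mem_singleton] at hqs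
      rcases hqs with rfl | rfl
      · simp
      · rw [inner_smul_right, hQR0, mul_zero]
    · exact fun hh => absurd h.mem hh
  have h4 : -a * ‖g‖ = 1 := by
    rw [← hn1, hna, norm_smul, Real.norm_eq_abs, abs_of_nonpos ha0]
  rw [hna, smul_smul, ← hlen]
  congr 1
  linear_combination (-2 * area T) * h4

theorem memLp_smul_continuous {K : Set E} (hK : IsCompact K) {F : Type*} [NormedAddCommGroup F]
    [NormedSpace ℝ F] {a : E → ℝ} (ha : Continuous a) {G : E → F} (hG : MemLp G 2 (volume.restrict K)) :
    MemLp (fun x => a x • G x) 2 (volume.restrict K) := by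
  obtain ⟨C, hC⟩ := hK.exists_bound_of_continuousOn ha.continuousOn
  refine hG.of_le_mul (c := C) (ha.aestronglyMeasurable.smul hG.1) ?_
  rw [ae_restrict_iff' hK.isClosed.measurableSet]
  refine Eventually.of_forall fun x hx => ?_
  rw [norm_smul]
  gcongr
  exact hC x hx

theorem memLp_side_of_continuous {s : Finset E} (hs : s.card = 2) {f : E → ℝ} (hf : Continuous f) :
    MemLp f 2 (sideMeasure s) := by
  have := isFiniteMeasure_side hs
  have hK : IsCompact (hull s) := s.finite_toSet.isCompact_convexHull ℝ
  obtain ⟨C, hC⟩ := hK.exists_bound_of_continuousOn hf.continuousOn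
  exact MemLp.of_bound hf.aestronglyMeasurable C
    ((ae_restrict_iff' hK.isClosed.measurableSet).mpr (Eventually.of_forall hC))

theorem gradient_mul {f w : E → ℝ} {x : E} (hf : DifferentiableAt ℝ f x) (hw : DifferentiableAt ℝ w x) :
    gradient (fun y => f y * w y) x = f x • gradient w x + w x • gradient f x := by
  refine ext_inner_right ℝ fun e => ?_
  rw [inner_gradient_left, fderiv_fun_mul hf hw, inner_add_left, inner_smul_left, inner_smul_left,
    inner_gradient_left, inner_gradient_left]
  simp

theorem gradient_sub_const (f : E → ℝ) (c : ℝ) : gradient (fun x => f x - c) = gradient f := by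
  ext1 x
  rw [gradient, gradient, fderiv_sub_const]

/-- Integration over a side of a smooth function as an integral over the triangle. -/
theorem IsOpp.integral_side {T s : Finset E} {P : E} (h : IsOpp T s P) {v : E → ℝ}
    (hv : ContDiff ℝ 1 v) : ∫ x, v x ∂(sideMeasure s) =
      len s / (2 * area T) * ∫ x in hull T, (2 * v x + (inner ℝ (gradient v x) (x - P) : ℝ)) := by
  have hap : 0 < area T := h.tri.area_pos
  obtain ⟨Q, R, hPQ, hPR, hQR, rfl, rfl⟩ := h.vertices
  rw [integral_hull_div h.tri hPQ hPR hQR hv,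
    integral_sideMeasure Q R hv.continuous.aestronglyMeasurable, len_pair]
  change _ = _ * (2 * area {P, Q, R} * _)
  field_simp

/-- The moment identities satisfied by the trace `g` on the side `s` of an `H¹` function `ψ` with gradient
`G` on the triangle `T`. -/
def SideMoments (T s : Finset E) (P : E) (ψ : E → ℝ) (G : E → E) (g : E → ℝ) : Prop :=
  ∀ w : E → ℝ, ContDiff ℝ 1 w → ∫ x, g x * w x ∂(sideMeasure s) =
    len s / (2 * area T) * ((∫ x in hull T, ψ x * (2 * w x + (inner ℝ (gradient w x) (x - P) : ℝ))) +
      ∫ x in hull T, (inner ℝ (w x • (x - P)) (G x) : ℝ))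

/-- The divergence identity for the product `f * w`, sorted by whether the derivative falls on `w`
or on `f`. -/
theorem IsOpp.sideMoments_smooth {T s : Finset E} {P : E} (h : IsOpp T s P) {f : E → ℝ}
    (hf : ContDiff ℝ 1 f) : SideMoments T s P f (gradient f) f := by
  intro w hw
  have hK := h.tri.isCompact_hull
  have hfg := continuous_gradient hf
  have hwg := continuous_gradient hw
  have hfc := hf.continuous
  have hwc := hw.continuous
  rw [h.integral_side (hf.mul hw), ← integral_add]
  · congr 1
    refine integral_congr_ae (Eventually.of_forall fun x => ?_)
    simp only
    rw [gradient_mul (hf.differentiable one_ne_zero x) (hw.differentiable one_ne_zero x),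
      inner_add_left, inner_smul_left, inner_smul_left, inner_smul_left, real_inner_comm (x - P) (gradient f x)]
    simp
    ring
  · exact (ContinuousOn.integrableOn_compact hK (Continuous.continuousOn (by fun_prop)))
  · exact (ContinuousOn.integrableOn_compact hK (Continuous.continuousOn (by fun_prop)))

/-! ### Moment identities for limits of smooth functions. -/

section Limits

variable {T s : Finset E} {P : E} (h : IsOpp T s P) {f : ℕ → E → ℝ} (hf : ∀ k, ContDiff ℝ ∞ (f k))
  {ψ g : E → ℝ} {G : E → E} (hψ : MemLp ψ 2 (volume.restrict (hull T)))
  (hG : MemLp G 2 (volume.restrict (hull T)))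
  (h1 : L2Lim (volume.restrict (hull T)) f ψ)
  (h2 : L2Lim (volume.restrict (hull T)) (fun k => gradient (f k)) G)
include h hf hψ hG h1 h2

theorem IsOpp.sideMoments_of_tendsto (hg : MemLp g 2 (sideMeasure s)) (h3 : L2Lim (sideMeasure s) f g) :
    SideMoments T s P ψ G g := by
  intro w hw
  have hK := h.tri.isCompact_hull
  have hfc : ∀ k, ContDiff ℝ 1 (f k) := fun k => (hf k).of_le (by simp)
  have hwg := continuous_gradient hw
  have hwc := hw.continuous
  have l1 := h3.integral_mul (fun k => memLp_side_of_continuous h.card (hf k).continuous) hg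
    (memLp_side_of_continuous h.card hwc)
  have l2 := h1.integral_mul (fun k => memLp_of_continuous hK (hf k).continuous) hψ
    (memLp_of_continuous hK (by fun_prop : Continuous fun x => 2 * w x + (inner ℝ (gradient w x) (x - P) : ℝ)))
  have l3 := h2.integral_inner (fun k => memLp_of_continuous hK (continuous_gradient (hfc k))) hG
    (memLp_of_continuous hK (by fun_prop : Continuous fun x => w x • (x - P)))
  refine tendsto_nhds_unique l1 ?_
  refine Tendsto.congr (fun k => (h.sideMoments_smooth (hfc k) w hw).symm) ?_
  exact (l2.add l3).const_mul _

end Limits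

/-- The trace inequality for smooth functions. -/
theorem IsOpp.trace_ineq_smooth {T s : Finset E} {P : E} (h : IsOpp T s P) {f : E → ℝ}
    (hf : ContDiff ℝ 1 f) {d : ℝ} (hd : ∀ x ∈ hull T, ‖x - P‖ ≤ d) :
    l2n (sideMeasure s) f ^ 2 ≤ len s / area T * (l2n (volume.restrict (hull T)) f ^ 2 +
      d * l2n (volume.restrict (hull T)) f * l2n (volume.restrict (hull T)) (gradient f)) := by
  have hK := h.tri.isCompact_hull
  have hap : 0 < area T := h.tri.area_pos
  have hlp := len_pos h.card
  have hfg := continuous_gradient hf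
  have hfL := memLp_of_continuous hK hf.continuous
  have hgL := memLp_of_continuous hK hfg
  have hfc := hf.continuous
  have key := h.sideMoments_smooth hf f hf
  have hbL : MemLp (fun x => f x • (x - P)) 2 (volume.restrict (hull T)) :=
    memLp_of_continuous hK (by fun_prop)
  have hP : P ∈ hull T := subset_convexHull ℝ _ h.mem
  have hd0 : 0 ≤ d := (norm_nonneg _).trans (hd P hP)
  have hb : l2n (volume.restrict (hull T)) (fun x => f x • (x - P)) ≤
      d * l2n (volume.restrict (hull T)) f := by
    refine l2n_mono hfL hd0 ?_
    rw [ae_restrict_iff' h.tri.measurableSet_hull]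
    refine Eventually.of_forall fun x hx => ?_
    rw [norm_smul, mul_comm]
    gcongr
    exact hd x hx
  have hI : |∫ x in hull T, (inner ℝ (f x • (x - P)) (gradient f x) : ℝ)| ≤
      d * l2n (volume.restrict (hull T)) f * l2n (volume.restrict (hull T)) (gradient f) :=
    (abs_integral_inner_le hbL hgL).trans (by gcongr; exact l2n_nonneg _)
  -- With the weight equal to `f` itself, the term with the position vector occurs twice. The common
  -- factor 2 cancels against the `2 * area T` in the moment identity.
  have hsplit : ∫ x in hull T, f x * (2 * f x + (inner ℝ (gradient f x) (x - P) : ℝ)) =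
      2 * l2n (volume.restrict (hull T)) f ^ 2 +
        ∫ x in hull T, (inner ℝ (f x • (x - P)) (gradient f x) : ℝ) := by
    rw [l2n_sq hfL, ← integral_const_mul, ← integral_add]
    · refine integral_congr_ae (Eventually.of_forall fun x => ?_)
      simp only [Real.norm_eq_abs, sq_abs, inner_smul_left, conj_trivial]
      rw [real_inner_comm]
      ring
    · exact (ContinuousOn.integrableOn_compact hK (Continuous.continuousOn (by fun_prop)))
    · exact (ContinuousOn.integrableOn_compact hK (Continuous.continuousOn (by fun_prop)))
  have hside : l2n (sideMeasure s) f ^ 2 = ∫ x, f x * f x ∂(sideMeasure s) := by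
    rw [l2n_sq (memLp_side_of_continuous h.card hfc)]
    simp [sq]
  rw [hside, key, hsplit]
  have h5 := (abs_le.mp hI).2
  rw [div_mul_eq_mul_div, div_mul_eq_mul_div, div_le_div_iff₀ (by positivity) hap]
  nlinarith [mul_pos hlp hap]

/-! ### Trace inequality, existence of traces and Poincaré inequality on one element, by passage to
the limit. -/

section Limits

variable {T s : Finset E} {P : E} (h : IsOpp T s P) {f : ℕ → E → ℝ} (hf : ∀ k, ContDiff ℝ ∞ (f k))
  {ψ g : E → ℝ} {G : E → E} (hψ : MemLp ψ 2 (volume.restrict (hull T)))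
  (hG : MemLp G 2 (volume.restrict (hull T)))
  (h1 : L2Lim (volume.restrict (hull T)) f ψ)
  (h2 : L2Lim (volume.restrict (hull T)) (fun k => gradient (f k)) G)
include h hf hψ hG h1 h2

/-- All terms of the smooth inequality are continuous in the norms involved. Subtracting a constant
leaves the gradient unchanged, so it is built in here for later use with a mean value. -/
theorem IsOpp.trace_ineq_of_tendsto (hg : MemLp g 2 (sideMeasure s)) (h3 : L2Lim (sideMeasure s) f g)
    {d : ℝ} (hd : ∀ x ∈ hull T, ‖x - P‖ ≤ d) (c : ℝ) :
    l2n (sideMeasure s) (fun x => g x - c) ^ 2 ≤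
      len s / area T * (l2n (volume.restrict (hull T)) (fun x => ψ x - c) ^ 2 +
        d * l2n (volume.restrict (hull T)) (fun x => ψ x - c) * l2n (volume.restrict (hull T)) G) := by
  have hK := h.tri.isCompact_hull
  have := isFiniteMeasure_side h.card
  have : IsFiniteMeasure (volume.restrict (hull T)) := ⟨by simpa using hK.measure_lt_top⟩
  have hfc : ∀ k, ContDiff ℝ 1 (f k) := fun k => (hf k).of_le (by simp)
  have sub : ∀ {μ : Measure E} {u : E → ℝ}, L2Lim μ f u →
      L2Lim μ (fun k x => f k x - c) (fun x => u x - c) := fun hu => by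
    simpa [L2Lim] using hu
  have l1 := (sub h3).tendsto_l2n
    (fun k => memLp_side_of_continuous h.card ((hf k).continuous.sub continuous_const))
    (memLp_fun_sub hg (memLp_const c))
  have l2 := (sub h1).tendsto_l2n
    (fun k => memLp_of_continuous hK ((hf k).continuous.sub continuous_const))
    (memLp_fun_sub hψ (memLp_const c))
  have l3 := h2.tendsto_l2n (fun k => memLp_of_continuous hK (continuous_gradient (hfc k))) hG
  refine le_of_tendsto_of_tendsto (l1.pow 2)
    (((l2.pow 2).add ((l2.const_mul d).mul l3)).const_mul (len s / area T)) (Eventually.of_forall fun k => ?_)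
  have := h.trace_ineq_smooth ((hfc k).sub contDiff_const (g := fun _ => c)) hd
  rw [gradient_sub_const] at this
  exact this

/-- The trace inequality applied to `f k - f l` makes the restrictions a Cauchy sequence in `L²(s)`,
and completeness gives the limit. -/
theorem IsOpp.exists_trace_limit : ∃ g : E → ℝ, MemLp g 2 (sideMeasure s) ∧ L2Lim (sideMeasure s) f g := by
  have hK := h.tri.isCompact_hull
  have hfc : ∀ k, ContDiff ℝ 1 (f k) := fun k => (hf k).of_le (by simp)
  have hfs : ∀ k, MemLp (f k) 2 (sideMeasure s) := fun k => memLp_side_of_continuous h.card (hf k).continuous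
  have hfT : ∀ k, MemLp (f k) 2 (volume.restrict (hull T)) := fun k =>
    memLp_of_continuous hK (hf k).continuous
  have hgT : ∀ k, MemLp (gradient (f k)) 2 (volume.restrict (hull T)) := fun k =>
    memLp_of_continuous hK (continuous_gradient (hfc k))
  obtain ⟨d, hd⟩ : ∃ d, ∀ x ∈ hull T, ‖x - P‖ ≤ d :=
    hK.exists_bound_of_continuousOn (by fun_prop : Continuous fun x : E => x - P).continuousOn
  have hd0 : 0 ≤ d := (norm_nonneg _).trans (hd P (subset_convexHull ℝ _ h.mem))
  have hap : 0 < area T := h.tri.area_pos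
  have hlp := len_pos h.card
  set A := fun k => l2n (volume.restrict (hull T)) (fun x => f k x - ψ x)
  set B := fun k => l2n (volume.restrict (hull T)) (fun x => gradient (f k) x - G x)
  have hA : Tendsto A atTop (𝓝 0) := h1.tendsto_sub
  have hB : Tendsto B atTop (𝓝 0) := h2.tendsto_sub
  have hA0 : ∀ k, 0 ≤ A k := fun k => l2n_nonneg _
  have hB0 : ∀ k, 0 ≤ B k := fun k => l2n_nonneg _
  have tri : ∀ {F : Type} [NormedAddCommGroup F] [InnerProductSpace ℝ F] {μ : Measure E} {a b c : E → F},
      MemLp a 2 μ → MemLp b 2 μ → MemLp c 2 μ →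
      l2n μ (fun x => a x - b x) ≤ l2n μ (fun x => a x - c x) + l2n μ (fun x => b x - c x) := by
    intro F _ _ μ a b c ha hb hc
    have h5 := l2n_add_le (memLp_fun_sub ha hc) (memLp_fun_sub hc hb)
    simp only [sub_add_sub_cancel] at h5
    rwa [l2n_sub_comm (f := c) (g := b)] at h5
  have hdist : ∀ k l, dist ((hfs k).toLp) ((hfs l).toLp) ^ 2 ≤
      len s / area T * ((A k + A l) ^ 2 + d * (A k + A l) * (B k + B l)) := by
    intro k l
    have e1 : dist ((hfs k).toLp) ((hfs l).toLp) = l2n (sideMeasure s) (fun x => f k x - f l x) := by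
      rw [dist_eq_norm, ← MemLp.toLp_sub, Lp.norm_toLp]
      rfl
    rw [e1]
    refine (h.trace_ineq_smooth ((hfc k).sub (hfc l)) hd).trans ?_
    have e2 : gradient (fun x => f k x - f l x) = fun x => gradient (f k) x - gradient (f l) x := by
      ext1 x
      refine ext_inner_right ℝ fun e => ?_
      rw [inner_gradient_left, fderiv_fun_sub ((hfc k).differentiable one_ne_zero x)
        ((hfc l).differentiable one_ne_zero x), inner_sub_left, inner_gradient_left, inner_gradient_left]
      rfl
    rw [e2]
    have t1 := tri (hfT k) (hfT l) hψ
    have t2 := tri (hgT k) (hgT l) hG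
    have n1 := l2n_nonneg (μ := volume.restrict (hull T)) (fun x => f k x - f l x)
    have n2 := l2n_nonneg (μ := volume.restrict (hull T)) (fun x => gradient (f k) x - gradient (f l) x)
    have n3 : 0 ≤ d * (A k + A l) := mul_nonneg hd0 (add_nonneg (hA0 k) (hA0 l))
    gcongr
  have hcau : CauchySeq fun k => (hfs k).toLp := by
    rw [Metric.cauchySeq_iff']
    intro ε hε
    have hAB : Tendsto (fun p : ℕ × ℕ => len s / area T * ((A p.1 + A p.2) ^ 2 +
        d * (A p.1 + A p.2) * (B p.1 + B p.2))) (atTop ×ˢ atTop) (𝓝 0) := by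
      have a1 := hA.comp (tendsto_fst (f := (atTop : Filter ℕ)) (g := (atTop : Filter ℕ)))
      have a2 := hA.comp (tendsto_snd (f := (atTop : Filter ℕ)) (g := (atTop : Filter ℕ)))
      have b1 := hB.comp (tendsto_fst (f := (atTop : Filter ℕ)) (g := (atTop : Filter ℕ)))
      have b2 := hB.comp (tendsto_snd (f := (atTop : Filter ℕ)) (g := (atTop : Filter ℕ)))
      have := ((((a1.add a2).pow 2).add (((a1.add a2).const_mul d).mul (b1.add b2)))).const_mul
        (len s / area T)
      simpa using this
    have hev := hAB.eventually_lt_const (show (0 : ℝ) < ε ^ 2 by positivity)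
    rw [prod_atTop_atTop_eq, eventually_atTop] at hev
    obtain ⟨⟨N, M⟩, hN⟩ := hev
    refine ⟨max N M, fun n hn => ?_⟩
    have := (hdist n (max N M)).trans_lt (hN (n, max N M) ⟨(le_max_left N M).trans hn, le_max_right N M⟩)
    exact lt_of_pow_lt_pow_left₀ 2 hε.le this
  obtain ⟨g, hg⟩ := cauchySeq_tendsto_of_complete hcau
  refine ⟨g, Lp.memLp g, ?_⟩
  have h6 := (Lp.tendsto_Lp_iff_tendsto_eLpNorm' _ g).mp hg
  refine h6.congr fun k => ?_
  refine eLpNorm_congr_ae ?_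
  filter_upwards [(hfs k).coeFn_toLp] with x hx
  simp [hx]

/-- The smooth inequality passes to the limit, because the mean values converge together with the
functions. -/
theorem IsOpp.poincare_of_tendsto {d : ℝ} (hd : ∀ x ∈ hull T, ∀ y ∈ hull T, ‖y - x‖ ≤ d) :
    l2n (volume.restrict (hull T)) (fun x => ψ x - avg (hull T) ψ) ≤
      2 * d * l2n (volume.restrict (hull T)) G := by
  have hK := h.tri.isCompact_hull
  have : IsFiniteMeasure (volume.restrict (hull T)) := ⟨by simpa using hK.measure_lt_top⟩
  have hfc : ∀ k, ContDiff ℝ 1 (f k) := fun k => (hf k).of_le (by simp)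
  have hP : P ∈ hull T := subset_convexHull ℝ _ h.mem
  have hd0 : 0 ≤ d := (norm_nonneg _).trans (hd P hP P hP)
  have hfT : ∀ k, MemLp (f k) 2 (volume.restrict (hull T)) := fun k =>
    memLp_of_continuous hK (hf k).continuous
  have lavg : Tendsto (fun k => avg (hull T) (f k)) atTop (𝓝 (avg (hull T) ψ)) := by
    have := h1.integral_mul hfT hψ (memLp_const 1)
    simp only [mul_one] at this
    exact this.const_mul _
  have l1 : L2Lim (volume.restrict (hull T)) (fun k x => f k x - avg (hull T) (f k))
      (fun x => ψ x - avg (hull T) ψ) := by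
    have hc : Tendsto (fun k => eLpNorm (fun _ : E => avg (hull T) (f k) - avg (hull T) ψ) 2
        (volume.restrict (hull T))) atTop (𝓝 0) := by
      by_cases h0 : volume.restrict (hull T) = 0
      · simp [h0]
      · have e1 : ∀ k, eLpNorm (fun _ : E => avg (hull T) (f k) - avg (hull T) ψ) 2
            (volume.restrict (hull T)) = ‖avg (hull T) (f k) - avg (hull T) ψ‖ₑ *
              (volume.restrict (hull T)) Set.univ ^ (1 / (2 : ℝ≥0∞).toReal) := fun k =>
          eLpNorm_const _ (by norm_num) h0
        simp_rw [e1]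
        have h7 : Tendsto (fun k => ‖avg (hull T) (f k) - avg (hull T) ψ‖ₑ) atTop (𝓝 0) := by
          have := (lavg.sub_const (avg (hull T) ψ)).enorm
          simpa using this
        have := ENNReal.Tendsto.mul_const (b := (volume.restrict (hull T)) Set.univ ^ (1 / (2 : ℝ≥0∞).toReal)) h7
          (Or.inr (ENNReal.rpow_ne_top_of_nonneg (by simp) (measure_ne_top _ _)))
        simpa using this
    have h8 := Tendsto.add h1 hc
    rw [add_zero] at h8
    refine tendsto_of_tendsto_of_tendsto_of_le_of_le tendsto_const_nhds h8 (fun _ => zero_le) fun k => ?_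
    have e2 : (fun x => f k x - avg (hull T) (f k) - (ψ x - avg (hull T) ψ)) =
        (fun x => f k x - ψ x) - (fun _ => avg (hull T) (f k) - avg (hull T) ψ) := by
      ext1 x; simp only [Pi.sub_apply]; ring
    simp only
    rw [e2]
    exact eLpNorm_sub_le ((hfT k).sub hψ).1 aestronglyMeasurable_const (by norm_num)
  have l2 := l1.tendsto_l2n (fun k => memLp_fun_sub (hfT k) (memLp_const _))
    (memLp_fun_sub hψ (memLp_const _))
  have l3 := h2.tendsto_l2n (fun k => memLp_of_continuous hK (continuous_gradient (hfc k))) hG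
  exact le_of_tendsto_of_tendsto l2 (l3.const_mul (2 * d)) (Eventually.of_forall fun k =>
    poincare_smooth (convex_convexHull ℝ _) hK h.tri.area_pos (hfc k) hd0 hd)

end Limits

/-! ### Geometry of conforming triangulations -/

theorem affine_add_smul_sub (f : E →ᵃ[ℝ] ℝ) (c x : E) (t : ℝ) :
    f (c + t • (x - c)) = f c + t * (f x - f c) := by
  have h1 := affine_sub_eq_inner f (c + t • (x - c)) c
  rw [add_sub_cancel_left, inner_smul_right, ← affine_sub_eq_inner] at h1
  linarith

theorem IsOpp.hull_side_iff {T s : Finset E} {P : E} (h : IsOpp T s P) {x : E} :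
    x ∈ hull s ↔ x ∈ hull T ∧ bary T P x = 0 := by
  rw [h.tri.mem_hull_subset_iff h.subset]
  refine and_congr_right fun _ => ⟨fun hx => hx P h.mem h.notMem, fun hx q hq hqs => ?_⟩
  rw [(h.eq_or_mem hq).resolve_right hqs]
  exact hx

/-- The midpoint of a side. -/
def sideMid (s : Finset E) : E := ∑ q ∈ s, (1 / 2 : ℝ) • q

theorem IsOpp.bary_sideMid {T s : Finset E} {P : E} (h : IsOpp T s P) :
    (∀ q ∈ s, bary T q (sideMid s) = 1 / 2) ∧ bary T P (sideMid s) = 0 := by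
  classical
  have h1 : sideMid s = ∑ q ∈ T, (if q ∈ s then (1 / 2 : ℝ) else 0) • q := by
    rw [sideMid, ← Finset.sum_subset h.subset]
    · exact Finset.sum_congr rfl fun q hq => by rw [if_pos hq]
    · intro q _ hq
      rw [if_neg hq, zero_smul]
  have h2 : ∑ q ∈ T, (if q ∈ s then (1 / 2 : ℝ) else 0) = 1 := by
    rw [← Finset.sum_subset h.subset (f := fun q => if q ∈ s then (1 / 2 : ℝ) else 0)]
    · rw [Finset.sum_congr rfl fun q hq => if_pos hq, Finset.sum_const, h.card]
      norm_num
    · intro q _ hq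
      rw [if_neg hq]
  rw [h1]
  refine ⟨fun q hq => ?_, ?_⟩
  · rw [h.tri.bary_sum h2 (h.subset hq), if_pos hq]
  · rw [h.tri.bary_sum h2 h.mem, if_neg h.notMem]

namespace Triangulation

variable {Ω : Set E} (M : Triangulation Ω)

theorem tri {T : Finset E} (hT : T ∈ M.elems) : IsTri T := ⟨M.card_eq T hT, M.indep T hT⟩

theorem mem_elemsAt {s T : Finset E} : T ∈ M.elemsAt s ↔ T ∈ M.elems ∧ s ⊆ T := by
  classical
  simp [elemsAt]

theorem mem_sides {s : Finset E} : s ∈ M.sides ↔ ∃ T ∈ M.elems, s ⊆ T ∧ s.card = 2 := by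
  classical
  simp [sides]

theorem mem_nodes {p : E} : p ∈ M.nodes ↔ ∃ T ∈ M.elems, p ∈ T := by
  classical
  simp [nodes]

variable {M}

/-- By conformity a common point lies in the hull of the common vertices, so the coordinates at all
other vertices vanish. The coordinates from `T` then also represent the point in `T'`, and
uniqueness applies. For a `q` that is not a vertex the convention `bary = 0` keeps the statement
true. -/
theorem bary_eq_bary {T T' : Finset E} (hT : T ∈ M.elems) (hT' : T' ∈ M.elems) {x : E} (hx : x ∈ hull T)
    (hx' : x ∈ hull T') (q : E) : bary T q x = bary T' q x := by
  classical
  have h1 : x ∈ hull (T ∩ T') := by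
    rw [hull, Finset.coe_inter, ← M.conforming T hT T' hT']
    exact ⟨hx, hx'⟩
  have z1 := (((M.tri hT).mem_hull_subset_iff Finset.inter_subset_left).mp h1).2
  have z2 := (((M.tri hT').mem_hull_subset_iff Finset.inter_subset_right).mp h1).2
  have z1' : ∀ r, r ∉ T' → bary T r x = 0 := fun r hr => by
    by_cases hrT : r ∈ T
    · exact z1 r hrT fun hh => hr (Finset.mem_inter.mp hh).2
    · rw [bary, dif_neg (by tauto)]; simp
  have hsum1 : ∑ r ∈ T', bary T r x = 1 := by
    rw [← (M.tri hT).sum_bary x, ← Finset.sum_inter_add_sum_sdiff T' T, ← Finset.sum_inter_add_sum_sdiff T T',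
      Finset.inter_comm T' T]
    congr 1
    rw [Finset.sum_eq_zero, Finset.sum_eq_zero]
    · intro r hr; exact z1' r (Finset.mem_sdiff.mp hr).2
    · intro r hr
      rw [bary, dif_neg (by have := (Finset.mem_sdiff.mp hr).2; tauto)]; simp
  have hsum2 : ∑ r ∈ T', bary T r x • r = x := by
    conv_rhs => rw [← (M.tri hT).sum_bary_smul x]
    rw [← Finset.sum_inter_add_sum_sdiff T' T, ← Finset.sum_inter_add_sum_sdiff T T', Finset.inter_comm T' T]
    congr 1
    rw [Finset.sum_eq_zero, Finset.sum_eq_zero]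
    · intro r hr; rw [z1' r (Finset.mem_sdiff.mp hr).2, zero_smul]
    · intro r hr
      rw [bary, dif_neg (by have := (Finset.mem_sdiff.mp hr).2; tauto)]; simp
  by_cases hq : q ∈ T'
  · have := (M.tri hT').bary_sum hsum1 hq
    rw [hsum2] at this
    exact this.symm
  · rw [z1' q hq, bary, dif_neg (by tauto)]; simp

theorem bary_nonneg {T : Finset E} (hT : T ∈ M.elems) {x : E} (hx : x ∈ hull T) (q : E) : 0 ≤ bary T q x := by
  by_cases hq : q ∈ T
  · exact (M.tri hT).mem_hull_iff.mp hx q hq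
  · rw [bary, dif_neg (by tauto)]; simp

theorem mem_of_bary_pos {T T' : Finset E} (hT : T ∈ M.elems) (hT' : T' ∈ M.elems) {x : E}
    (hx : x ∈ hull T) (hx' : x ∈ hull T') {q : E} (hq : 0 < bary T q x) : q ∈ T' := by
  by_contra hcon
  rw [bary_eq_bary hT hT' hx hx' q, bary, dif_neg (by tauto)] at hq
  simp at hq

/-- In the interior all coordinates are positive, and a vertex with positive coordinate belongs to
every element containing the point. Two elements can therefore overlap only in null sets. -/
theorem eq_of_mem_interior {T T' : Finset E} (hT : T ∈ M.elems) (hT' : T' ∈ M.elems) {x : E}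
    (hx : x ∈ interior (hull T)) (hx' : x ∈ hull T') : T = T' := by
  have h1 := (M.tri hT).mem_interior_iff.mp hx
  refine Finset.eq_of_subset_of_card_le (fun q hq =>
    mem_of_bary_pos hT hT' (interior_subset hx) hx' (h1 q hq)) ?_
  rw [M.card_eq T hT, M.card_eq T' hT']

/-- The nodal basis function in terms of barycentric coordinates. -/
theorem hat_eq {T : Finset E} (hT : T ∈ M.elems) {x : E} (hx : x ∈ hull T) (p : E) :
    M.hat p x = bary T p x := by
  have hset : ∀ t ∈ {t : ℝ | ∃ T ∈ M.elemsAt {p}, ∃ w : E → ℝ, (∀ q ∈ T, 0 ≤ w q) ∧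
      ∑ q ∈ T, w q = 1 ∧ ∑ q ∈ T, w q • q = x ∧ t = w p}, t = bary T p x := by
    rintro t ⟨T', hT', w, hw0, hw1, hw2, rfl⟩
    rw [mem_elemsAt, Finset.singleton_subset_iff] at hT'
    have hb : ∀ q ∈ T', bary T' q x = w q := fun q hq => by
      rw [← hw2]; exact (M.tri hT'.1).bary_sum hw1 hq
    have hx' : x ∈ hull T' := by
      rw [(M.tri hT'.1).mem_hull_iff]
      intro q hq
      rw [hb q hq]
      exact hw0 q hq
    rw [← hb p hT'.2, bary_eq_bary hT hT'.1 hx hx']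
  rw [hat]
  by_cases hp : p ∈ T
  · have hmem : bary T p x ∈ {t : ℝ | ∃ T ∈ M.elemsAt {p}, ∃ w : E → ℝ, (∀ q ∈ T, 0 ≤ w q) ∧
        ∑ q ∈ T, w q = 1 ∧ ∑ q ∈ T, w q • q = x ∧ t = w p} :=
      ⟨T, M.mem_elemsAt.mpr ⟨hT, by simpa using hp⟩, fun q => bary T q x,
        fun q hq => (M.tri hT).mem_hull_iff.mp hx q hq, (M.tri hT).sum_bary x,
        (M.tri hT).sum_bary_smul x, rfl⟩
    rw [Set.eq_singleton_iff_nonempty_unique_mem.mpr ⟨⟨_, hmem⟩, hset⟩, csSup_singleton]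
  · have h0 : bary T p x = 0 := by rw [bary, dif_neg (by tauto)]; simp
    rw [h0] at hset ⊢
    rcases Set.eq_empty_or_nonempty {t : ℝ | ∃ T ∈ M.elemsAt {p}, ∃ w : E → ℝ, (∀ q ∈ T, 0 ≤ w q) ∧
      ∑ q ∈ T, w q = 1 ∧ ∑ q ∈ T, w q • q = x ∧ t = w p} with he | he
    · rw [he, Real.sSup_empty]
    · rw [Set.eq_singleton_iff_nonempty_unique_mem.mpr ⟨he, hset⟩, csSup_singleton]

theorem exists_mem_of_hat_ne_zero {p x : E} (h : M.hat p x ≠ 0) : ∃ T ∈ M.elemsAt {p}, x ∈ hull T := by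
  by_contra! hcon
  refine h ?_
  have hempty : {t : ℝ | ∃ T ∈ M.elemsAt {p}, ∃ w : E → ℝ, (∀ q ∈ T, 0 ≤ w q) ∧
      ∑ q ∈ T, w q = 1 ∧ ∑ q ∈ T, w q • q = x ∧ t = w p} = ∅ := ?_
  · rw [hat, hempty, Real.sSup_empty]
  rw [Set.eq_empty_iff_forall_notMem]
  rintro t ⟨T', hT', w, hw0, hw1, hw2, rfl⟩
  refine hcon T' hT' ?_
  rw [hull, Finset.convexHull_eq]
  refine ⟨w, hw0, hw1, ?_⟩
  rw [Finset.centerMass_eq_of_sum_1 _ _ hw1]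
  exact hw2

theorem hat_nonneg (p x : E) : 0 ≤ M.hat p x := by
  by_contra hcon
  obtain ⟨T, hT, hx⟩ := exists_mem_of_hat_ne_zero (M := M) (p := p) (x := x) (by intro h; simp [h] at hcon)
  rw [hat_eq (M.mem_elemsAt.mp hT).1 hx] at hcon
  exact hcon (bary_nonneg (M.mem_elemsAt.mp hT).1 hx p)

theorem hat_le_one (p x : E) : M.hat p x ≤ 1 := by
  by_contra hcon
  obtain ⟨T, hT, hx⟩ := exists_mem_of_hat_ne_zero (M := M) (p := p) (x := x) (by
    intro h; rw [h] at hcon; norm_num at hcon)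
  have hT' := M.mem_elemsAt.mp hT
  rw [hat_eq hT'.1 hx] at hcon
  have h1 := (M.tri hT'.1).sum_bary x
  have h2 := Finset.single_le_sum (f := fun q => bary T q x) (fun q _ => bary_nonneg hT'.1 hx q)
    (Finset.singleton_subset_iff.mp hT'.2)
  linarith

theorem sum_hat {T : Finset E} (hT : T ∈ M.elems) {x : E} (hx : x ∈ hull T) : ∑ p ∈ M.nodes, M.hat p x = 1 := by
  rw [← (M.tri hT).sum_bary x, Finset.sum_congr rfl fun p _ => hat_eq hT hx p]
  symm
  refine Finset.sum_subset (fun p hp => M.mem_nodes.mpr ⟨T, hT, hp⟩) fun p _ hp => ?_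
  rw [bary, dif_neg (by tauto)]; simp

theorem hull_subset {T : Finset E} (hT : T ∈ M.elems) : hull T ⊆ closure Ω := by
  rw [← M.cover]
  exact Set.subset_biUnion_of_mem (u := fun T : Finset E => hull T) hT

theorem exists_hull {x : E} (hx : x ∈ closure Ω) : ∃ T ∈ M.elems, x ∈ hull T := by
  rw [← M.cover] at hx
  simpa using hx

theorem interior_hull_subset (hΩ : IsPolygonalDomain Ω) {T : Finset E} (hT : T ∈ M.elems) :
    interior (hull T) ⊆ Ω := by
  rw [← hΩ.interior_closure]
  exact interior_mono (hull_subset hT)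

/-! #### Decomposition of integrals -/

/-- A point shared by two different elements is in the interior of neither, so overlaps are null and
the restricted measures add up exactly. -/
theorem restrict_biUnion {S : Finset (Finset E)} (hS : S ⊆ M.elems) :
    (volume : Measure E).restrict (⋃ T ∈ S, hull T) = ∑ T ∈ S, volume.restrict (hull T) := by
  classical
  induction S using Finset.induction_on with
  | empty => simp
  | insert T S hTS ih =>
    have hT : T ∈ M.elems := hS (Finset.mem_insert_self _ _)
    have hS' : S ⊆ M.elems := fun T' hT' => hS (Finset.mem_insert_of_mem hT')
    rw [Finset.set_biUnion_insert, Finset.sum_insert hTS, ← ih hS']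
    refine Measure.restrict_union₀ ?_ ?_
    · have h1 := (M.tri hT).ae_mem_interior
      rw [ae_restrict_iff' (M.tri hT).measurableSet_hull] at h1
      refine measure_mono_null ?_ (ae_iff.mp h1)
      rintro x ⟨hx, hx'⟩
      simp only [Set.mem_iUnion] at hx'
      obtain ⟨T', hT', hx'⟩ := hx'
      intro hcon
      have := eq_of_mem_interior hT (hS' hT') (hcon hx) hx'
      exact hTS (this ▸ hT')
    · exact (Finset.measurableSet_biUnion _ fun T' hT' => (M.tri (hS' hT')).measurableSet_hull).nullMeasurableSet

theorem biUnion_ae_eq {S : Finset (Finset E)} (hS : S ⊆ M.elems) {U : Set E}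
    (h1 : ∀ T ∈ S, interior (hull T) ⊆ U) (h2 : U ⊆ ⋃ T ∈ S, hull T) :
    U =ᵐ[volume] ⋃ T ∈ S, hull T := by
  have h3 : ∀ᵐ x ∂(volume : Measure E), ∀ T ∈ S, x ∈ hull T → x ∈ interior (hull T) := by
    refine (ae_ball_iff (S := (S : Set (Finset E))) (Finset.countable_toSet S)).mpr ?_
    intro T hT
    have := (M.tri (hS hT)).ae_mem_interior
    rwa [ae_restrict_iff' (M.tri (hS hT)).measurableSet_hull] at this
  filter_upwards [h3] with x hx
  refine propext ⟨fun hxU => h2 hxU, fun hxS => ?_⟩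
  have hxS' : x ∈ ⋃ T ∈ S, hull T := hxS
  simp only [Set.mem_iUnion] at hxS'
  obtain ⟨T, hT, hxT⟩ := hxS'
  exact h1 T hT (hx T hT hxT)

theorem restrict_domain (hΩ : IsPolygonalDomain Ω) :
    (volume : Measure E).restrict Ω = ∑ T ∈ M.elems, volume.restrict (hull T) := by
  rw [← restrict_biUnion (M := M) subset_rfl]
  refine Measure.restrict_congr_set (biUnion_ae_eq (M := M) subset_rfl
    (fun T hT => interior_hull_subset hΩ hT) ?_)
  rw [M.cover]
  exact subset_closure

theorem elemsAt_subset (s : Finset E) : M.elemsAt s ⊆ M.elems := fun _ hT => (M.mem_elemsAt.mp hT).1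

theorem interior_hull_subset_patch {s T : Finset E} (hT : T ∈ M.elemsAt s) :
    interior (hull T) ⊆ M.patch s :=
  interior_mono (Set.subset_biUnion_of_mem (u := fun T : Finset E => hull T) hT)

theorem patch_subset_biUnion (s : Finset E) : M.patch s ⊆ ⋃ T ∈ M.elemsAt s, hull T := interior_subset

theorem restrict_patch (s : Finset E) :
    (volume : Measure E).restrict (M.patch s) = ∑ T ∈ M.elemsAt s, volume.restrict (hull T) := by
  rw [← restrict_biUnion (elemsAt_subset s)]
  exact Measure.restrict_congr_set (biUnion_ae_eq (elemsAt_subset s)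
    (fun T hT => interior_hull_subset_patch hT) (patch_subset_biUnion s))

theorem patch_subset (hΩ : IsPolygonalDomain Ω) (s : Finset E) : M.patch s ⊆ Ω := by
  refine (interior_mono ?_).trans hΩ.interior_closure.subset
  simp only [Set.iUnion_subset_iff]
  exact fun T hT => hull_subset (M.mem_elemsAt.mp hT).1

theorem isOpen_patch (s : Finset E) : IsOpen (M.patch s) := isOpen_interior

theorem hull_subset_closure_patch {s T : Finset E} (hT : T ∈ M.elemsAt s) : hull T ⊆ closure (M.patch s) := by
  refine (M.tri (elemsAt_subset s hT)).closure_interior.symm.subset.trans ?_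
  exact closure_mono (interior_hull_subset_patch hT)

theorem isCompact_biUnion {S : Finset (Finset E)} (hS : S ⊆ M.elems) : IsCompact (⋃ T ∈ S, hull T) :=
  S.isCompact_biUnion fun _ hT => (M.tri (hS hT)).isCompact_hull

theorem closure_patch (s : Finset E) : closure (M.patch s) = ⋃ T ∈ M.elemsAt s, hull T := by
  refine Set.Subset.antisymm ?_ ?_
  · exact closure_minimal (patch_subset_biUnion s) (isCompact_biUnion (elemsAt_subset s)).isClosed
  · simp only [Set.iUnion_subset_iff]
    exact fun T hT => hull_subset_closure_patch hT

theorem isBounded_patch (s : Finset E) : Bornology.IsBounded (M.patch s) :=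
  (isCompact_biUnion (elemsAt_subset s)).isBounded.subset (patch_subset_biUnion s)

/-! #### Sides -/

/-- Two elements with a common side lie on opposite sides of it. Otherwise a short step from the
midpoint of the side towards `P'` would reach the interior of `T'` while staying in `T`, forcing `T
= T'`. -/
theorem bary_opp_neg {T T' s : Finset E} {P P' : E} (hT : T ∈ M.elems) (hT' : T' ∈ M.elems) (hne : T ≠ T')
    (h : IsOpp T s P) (h' : IsOpp T' s P') : bary T P P' < 0 := by
  by_contra! hcon
  obtain ⟨m1, m2⟩ := h.bary_sideMid
  obtain ⟨m1', m2'⟩ := h'.bary_sideMid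
  set m := sideMid s
  have hev : ∀ᶠ t in 𝓝[>] (0 : ℝ), ∀ q ∈ s, 0 < bary T q (m + t • (P' - m)) := by
    rw [eventually_all_finset]
    intro q hq
    have hc : Continuous fun t : ℝ => bary T q (m + t • (P' - m)) :=
      (contDiff_affine (n := 0) _).continuous.comp (by fun_prop)
    have := hc.tendsto 0
    simp only [zero_smul, add_zero] at this
    exact nhdsWithin_le_nhds (this.eventually_const_lt (by rw [m1 q hq]; norm_num))
  have hev2 : ∀ᶠ t in 𝓝[>] (0 : ℝ), t < 1 := nhdsWithin_le_nhds (eventually_lt_nhds (by norm_num))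
  have hev3 : ∀ᶠ t in 𝓝[>] (0 : ℝ), 0 < t := eventually_mem_nhdsWithin
  obtain ⟨t, ht, ht1, ht0⟩ := (hev.and (hev2.and hev3)).exists
  refine hne (eq_of_mem_interior hT' hT (x := m + t • (P' - m)) ?_ ?_).symm
  · rw [h'.tri.mem_interior_iff]
    intro q hq
    rw [affine_add_smul_sub]
    rcases h'.eq_or_mem hq with rfl | hqs
    · rw [m2', h'.tri.bary_self h'.mem]
      linarith
    · rw [m1' q hqs, h'.tri.bary_of_ne h'.mem (by rintro rfl; exact h'.notMem hqs)]
      linarith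
  · rw [h.tri.mem_hull_iff]
    intro q hq
    rcases h.eq_or_mem hq with rfl | hqs
    · rw [affine_add_smul_sub, m2]
      have := mul_nonneg ht0.le hcon
      linarith
    · exact (ht q hqs).le

/-- The barycentric coordinates of the opposite vertices of two triangles with a common side are
proportional. -/
theorem bary_opp_eq {T T' s : Finset E} {P P' : E} (h : IsOpp T s P) (h' : IsOpp T' s P') (x : E) :
    bary T P x = bary T P P' * bary T' P' x := by
  rw [h'.tri.map_eq_sum (bary T P) x, Finset.sum_eq_single P']
  · rw [smul_eq_mul, mul_comm]
  · intro q hq hqP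
    have hqs := (h'.eq_or_mem hq).resolve_left hqP
    rw [h.tri.bary_of_ne (h.subset hqs) (by rintro rfl; exact h.notMem hqs), smul_zero]
  · exact fun hh => absurd h'.mem hh

/-- Among three elements at one side, the coordinate for the first one at the third opposite vertex
would be the product of two negative numbers, yet it must be negative itself. -/
theorem card_elemsAt {s : Finset E} (hs : s ∈ M.sides) :
    (M.elemsAt s).card = 1 ∨ (M.elemsAt s).card = 2 := by
  obtain ⟨T, hT, hsT, hc⟩ := M.mem_sides.mp hs
  have h1 : 0 < (M.elemsAt s).card := Finset.card_pos.mpr ⟨T, M.mem_elemsAt.mpr ⟨hT, hsT⟩⟩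
  have h2 : (M.elemsAt s).card < 3 := by
    by_contra! hcon
    obtain ⟨T1, hT1, T2, hT2, T3, hT3, h12, h13, h23⟩ := Finset.two_lt_card.mp hcon
    rw [mem_elemsAt] at hT1 hT2 hT3
    obtain ⟨P1, o1⟩ := (M.tri hT1.1).exists_opp hT1.2 hc
    obtain ⟨P2, o2⟩ := (M.tri hT2.1).exists_opp hT2.2 hc
    obtain ⟨P3, o3⟩ := (M.tri hT3.1).exists_opp hT3.2 hc
    have n12 := bary_opp_neg hT1.1 hT2.1 h12 o1 o2
    have n13 := bary_opp_neg hT1.1 hT3.1 h13 o1 o3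
    have n23 := bary_opp_neg hT2.1 hT3.1 h23 o2 o3
    rw [bary_opp_eq o1 o2] at n13
    nlinarith
  omega

/-- The gradients of the two opposite coordinates differ by a negative factor `κ`. Comparing their
norms with the common length of the side gives `area T * κ = -area T'`, so the two scaled normals
cancel. -/
theorem normal_neg {T T' s : Finset E} {P P' : E} (hT : T ∈ M.elems) (hT' : T' ∈ M.elems) (hne : T ≠ T')
    (h : IsOpp T s P) (h' : IsOpp T' s P') : outwardNormal T s = -outwardNormal T' s := by
  have hk := bary_opp_neg hT hT' hne h h'
  set κ := bary T P P'
  have hg : agrad (bary T P) = κ • agrad (bary T' P') := by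
    refine ext_inner_right ℝ fun e => ?_
    have h1 := affine_sub_eq_inner (bary T P) e 0
    have h2 := affine_sub_eq_inner (bary T' P') e 0
    rw [bary_opp_eq h h' e, bary_opp_eq h h' 0, sub_zero] at h1
    rw [sub_zero] at h2
    rw [← h1, inner_smul_left, ← h2]
    simp only [conj_trivial]
    ring
  have e1 := h.len_smul_normal
  have e2 := h'.len_smul_normal
  have a1 := h.tri.area_pos
  have a2 := h'.tri.area_pos
  change 0 < area T at a1
  change 0 < area T' at a2
  have hl := len_pos h.card
  have n1 := h.two_area_mul_norm
  have n2 := h'.two_area_mul_norm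
  rw [hg, norm_smul, Real.norm_eq_abs, abs_of_neg hk] at n1
  have hgn : 0 < ‖agrad (bary T' P')‖ := by
    by_contra hcon
    have h0 : ‖agrad (bary T' P')‖ = 0 := le_antisymm (not_lt.mp hcon) (norm_nonneg _)
    rw [h0] at n2
    linarith
  have hka : area T * κ = -area T' := by
    have : (2 * (area T * κ + area T')) * ‖agrad (bary T' P')‖ = 0 := by linarith
    rcases mul_eq_zero.mp this with h3 | h3
    · linarith
    · exact absurd h3 hgn.ne'
  have h3 : len s • (outwardNormal T s + outwardNormal T' s) = 0 := by
    rw [smul_add, e1, e2, hg, smul_smul, ← add_smul]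
    have : -(2 * area T) * κ + -(2 * area T') = 0 := by linarith
    rw [this, zero_smul]
  rw [eq_neg_iff_add_eq_zero]
  exact (smul_eq_zero.mp h3).resolve_left hl.ne'

/-- The patch of a side can be contracted into itself. -/
theorem exists_center {s : Finset E} (hs : s ∈ M.sides) : ∃ c : E, ∀ m : ℝ, 0 ≤ m → m < 1 →
    ∀ x ∈ closure (M.patch s), c + m • (x - c) ∈ M.patch s := by
  have hsc : s.card = 2 := (M.mem_sides.mp hs).choose_spec.2.2
  rcases card_elemsAt hs with h1 | h2
  · obtain ⟨T, hT⟩ := Finset.card_eq_one.mp h1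
    have hTe : T ∈ M.elems := elemsAt_subset s (by rw [hT]; simp)
    refine ⟨barycentre T, fun m hm0 hm1 x hx => ?_⟩
    rw [closure_patch, hT] at hx
    rw [patch, hT]
    simp only [Finset.mem_singleton, Set.iUnion_iUnion_eq_left] at hx ⊢
    rw [(M.tri hTe).mem_interior_iff]
    intro q hq
    have hb := (M.tri hTe).mem_interior_iff.mp (M.tri hTe).barycentre_mem q hq
    have hxq := (M.tri hTe).mem_hull_iff.mp hx q hq
    rw [affine_add_smul_sub]
    nlinarith
  · obtain ⟨T1, T2, hne, hT12⟩ := Finset.card_eq_two.mp h2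
    refine ⟨sideMid s, fun m hm0 hm1 x hx => ?_⟩
    have key : ∀ T T', T ∈ M.elemsAt s → T' ∈ M.elemsAt s → T ≠ T' → x ∈ hull T →
        sideMid s + m • (x - sideMid s) ∈ M.patch s := by
      intro T T' hT hT' hTT' hxT
      obtain ⟨hTe, hsT⟩ := M.mem_elemsAt.mp hT
      obtain ⟨hTe', hsT'⟩ := M.mem_elemsAt.mp hT'
      obtain ⟨P, h⟩ := (M.tri hTe).exists_opp hsT hsc
      obtain ⟨P', h'⟩ := (M.tri hTe').exists_opp hsT' hsc
      obtain ⟨m1, m2⟩ := h.bary_sideMid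
      have hxq := fun q hq => (M.tri hTe).mem_hull_iff.mp hxT q hq
      set y := sideMid s + m • (x - sideMid s) with hy
      have hyq : ∀ q ∈ s, 0 < bary T q y := fun q hq => by
        rw [hy, affine_add_smul_sub, m1 q hq]
        nlinarith [hxq q (h.subset hq)]
      have hyP : 0 ≤ bary T P y := by
        rw [hy, affine_add_smul_sub, m2]
        nlinarith [hxq P h.mem]
      have hyT : y ∈ hull T := by
        rw [h.tri.mem_hull_iff]
        intro q hq
        rcases h.eq_or_mem hq with rfl | hqs
        · exact hyP
        · exact (hyq q hqs).le
      rcases hyP.eq_or_lt with h0 | hpos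
      -- Here the contracted point is in the relative interior of the common side. Nearby points
      -- with nonnegative coordinate at `P` stay in `T`; for the others the proportionality with
      -- negative factor makes the coordinate at `P'` positive, which puts them into `T'`.
      · have hys : y ∈ hull s := h.hull_side_iff.mpr ⟨hyT, h0.symm⟩
        have hyT' : y ∈ hull T' := (h'.hull_side_iff.mp hys).1
        have hyq' : ∀ q ∈ s, 0 < bary T' q y := fun q hq => by
          rw [bary_eq_bary hTe' hTe hyT' hyT]; exact hyq q hq
        have hκ := bary_opp_neg hTe hTe' hTT' h h'
        rw [patch, mem_interior_iff_mem_nhds]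
        have hc : ∀ (T : Finset E) (q : E), Continuous (bary T q) := fun T q =>
          (contDiff_affine (n := 0) _).continuous
        have ev1 : ∀ᶠ z in 𝓝 y, ∀ q ∈ s, 0 < bary T q z := by
          rw [eventually_all_finset]
          exact fun q hq => (hc T q).continuousAt.eventually_const_lt (hyq q hq)
        have ev2 : ∀ᶠ z in 𝓝 y, ∀ q ∈ s, 0 < bary T' q z := by
          rw [eventually_all_finset]
          exact fun q hq => (hc T' q).continuousAt.eventually_const_lt (hyq' q hq)
        filter_upwards [ev1, ev2] with z hz1 hz2
        rw [Set.mem_iUnion₂]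
        by_cases hzP : 0 ≤ bary T P z
        · refine ⟨T, hT, ?_⟩
          rw [h.tri.mem_hull_iff]
          intro q hq
          rcases h.eq_or_mem hq with rfl | hqs
          · exact hzP
          · exact (hz1 q hqs).le
        · refine ⟨T', hT', ?_⟩
          rw [h'.tri.mem_hull_iff]
          intro q hq
          rcases h'.eq_or_mem hq with rfl | hqs
          · rw [bary_opp_eq h h'] at hzP
            nlinarith
          · exact (hz2 q hqs).le
      · refine interior_hull_subset_patch hT ?_
        rw [h.tri.mem_interior_iff]
        intro q hq
        rcases h.eq_or_mem hq with rfl | hqs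
        · exact hpos
        · exact hyq q hqs
    rw [closure_patch, hT12] at hx
    have t1 : T1 ∈ M.elemsAt s := by rw [hT12]; simp
    have t2 : T2 ∈ M.elemsAt s := by rw [hT12]; simp
    simp only [Finset.mem_insert, Finset.mem_singleton, Set.iUnion_iUnion_eq_or_left,
      Set.iUnion_iUnion_eq_left] at hx
    rcases hx with hx | hx
    · exact key T1 T2 t1 t2 hne hx
    · exact key T2 T1 t2 t1 hne.symm hx

/-- Near a point only the elements that contain it matter. -/
theorem eventually_mem_imp (x : E) : ∀ᶠ z in 𝓝 x, ∀ T ∈ M.elems, z ∈ hull T → x ∈ hull T := by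
  rw [eventually_all_finset]
  intro T hT
  by_cases hx : x ∈ hull T
  · exact Eventually.of_forall fun _ _ => hx
  · filter_upwards [(M.tri hT).isCompact_hull.isClosed.isOpen_compl.mem_nhds hx] with z hz hzT
    exact absurd hzT hz

/-- Sides that belong to only one element lie on the boundary. -/
theorem hull_side_disjoint (hΩ : IsPolygonalDomain Ω) {s : Finset E} (hs : s ∈ M.sides)
    (h1 : (M.elemsAt s).card = 1) : ∀ x ∈ hull s, x ∉ Ω := by
  have hsc : s.card = 2 := (M.mem_sides.mp hs).choose_spec.2.2
  obtain ⟨T, hT⟩ := Finset.card_eq_one.mp h1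
  have hTs : T ∈ M.elemsAt s := by rw [hT]; simp
  obtain ⟨hTe, hsT⟩ := M.mem_elemsAt.mp hTs
  obtain ⟨P, h⟩ := (M.tri hTe).exists_opp hsT hsc
  have hc : ∀ (q : E), Continuous (bary T q) := fun q => (contDiff_affine (n := 0) _).continuous
  -- For a relative interior point of the side in `Ω`, a small step away from `P` stays in `Ω` and
  -- hence in some element. That element contains the point and therefore both vertices of `s`, so
  -- it is `T`, although the coordinate at `P` has become negative.
  have key : ∀ y, y ∈ hull s → (∀ q ∈ s, 0 < bary T q y) → y ∉ Ω := by
    intro y hy hyq hyΩ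
    obtain ⟨hyT, hyP⟩ := h.hull_side_iff.mp hy
    have hpath : Continuous fun t : ℝ => y + t • (P - y) := by fun_prop
    have ht : Tendsto (fun t : ℝ => y + t • (P - y)) (𝓝[<] 0) (𝓝 y) := by
      have := hpath.tendsto 0
      simp only [zero_smul, add_zero] at this
      exact this.mono_left nhdsWithin_le_nhds
    have hev := ht.eventually ((eventually_mem_imp (M := M) y).and (hΩ.isOpen.mem_nhds hyΩ))
    have hneg : ∀ᶠ t in 𝓝[<] (0 : ℝ), t < 0 := eventually_mem_nhdsWithin
    obtain ⟨t, ⟨ht1, ht2⟩, ht0⟩ := (hev.and hneg).exists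
    obtain ⟨T', hT', hzT'⟩ := exists_hull (M := M) (subset_closure ht2)
    have hyT' := ht1 T' hT' hzT'
    have hTT' : T' ∈ M.elemsAt s :=
      M.mem_elemsAt.mpr ⟨hT', fun q hq => mem_of_bary_pos hTe hT' hyT hyT' (hyq q hq)⟩
    rw [hT, Finset.mem_singleton] at hTT'
    rw [hTT', h.tri.mem_hull_iff] at hzT'
    have := hzT' P h.mem
    rw [affine_add_smul_sub, hyP, h.tri.bary_self h.mem] at this
    linarith
  intro x hx hxΩ
  obtain ⟨hxT, hxP⟩ := h.hull_side_iff.mp hx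
  obtain ⟨m1, m2⟩ := h.bary_sideMid
  have hpath : Continuous fun t : ℝ => x + t • (sideMid s - x) := by fun_prop
  -- End points are reduced to the previous case: since `Ω` is open, a slight move towards the
  -- midpoint stays in `Ω` and ends in the relative interior of the side.
  have ht : Tendsto (fun t : ℝ => x + t • (sideMid s - x)) (𝓝[>] 0) (𝓝 x) := by
    have := hpath.tendsto 0
    simp only [zero_smul, add_zero] at this
    exact this.mono_left nhdsWithin_le_nhds
  have hpos : ∀ᶠ t in 𝓝[>] (0 : ℝ), 0 < t := eventually_mem_nhdsWithin
  have hlt : ∀ᶠ t in 𝓝[>] (0 : ℝ), t < 1 := nhdsWithin_le_nhds (eventually_lt_nhds (by norm_num))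
  obtain ⟨t, ht2, ht0, ht1⟩ := ((ht.eventually (hΩ.isOpen.mem_nhds hxΩ)).and (hpos.and hlt)).exists
  have hq : ∀ q ∈ s, 0 < bary T q (x + t • (sideMid s - x)) := fun q hq => by
    rw [affine_add_smul_sub, m1 q hq]
    nlinarith [h.tri.mem_hull_iff.mp hxT q (h.subset hq)]
  refine key _ ?_ hq ht2
  have hP : bary T P (x + t • (sideMid s - x)) = 0 := by
    rw [affine_add_smul_sub, m2, hxP]; ring
  refine h.hull_side_iff.mpr ⟨?_, hP⟩
  rw [h.tri.mem_hull_iff]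
  intro q hqT
  rcases h.eq_or_mem hqT with rfl | hqs
  · rw [hP]
  · exact (hq q hqs).le

theorem mem_closure_of_node {p : E} (hp : p ∈ M.nodes) : p ∈ closure Ω := by
  obtain ⟨T, hT, hpT⟩ := M.mem_nodes.mp hp
  exact hull_subset hT (subset_convexHull ℝ _ hpT)

theorem card_elemsAt_of_interior_node (hΩ : IsPolygonalDomain Ω) {p : E} (hp : p ∈ Ω) {s : Finset E}
    (hs : s ∈ M.sides) (hps : p ∈ s) : (M.elemsAt s).card = 2 := by
  refine (card_elemsAt hs).resolve_left fun h1 => ?_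
  exact hull_side_disjoint hΩ hs h1 p (subset_convexHull ℝ _ hps) hp

/-! #### Piecewise affine functions -/

theorem IsP1.exists_affine {v : E → ℝ} (hv : M.IsP1 v) {T : Finset E} (hT : T ∈ M.elems) :
    ∃ A : E →ᵃ[ℝ] ℝ, Set.EqOn v A (hull T) ∧ elemGrad T v = agrad A ∧
      ∀ x ∈ interior (hull T), HasGradientAt v (agrad A) x := by
  obtain ⟨A, hA⟩ := hv.2 T hT
  have h1 : ∀ x ∈ interior (hull T), HasGradientAt v (agrad A) x := fun x hx => by
    refine (hasGradientAt_affine A x).congr_of_eventuallyEq ?_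
    filter_upwards [mem_interior_iff_mem_nhds.mp hx] with z hz
    exact hA hz
  exact ⟨A, hA, (h1 _ (M.tri hT).barycentre_mem).gradient, h1⟩

theorem IsP1.eq_sum {v : E → ℝ} (hv : M.IsP1 v) {T : Finset E} (hT : T ∈ M.elems) {x : E}
    (hx : x ∈ hull T) : v x = ∑ q ∈ T, bary T q x * v q := by
  obtain ⟨A, hA⟩ := hv.2 T hT
  rw [hA hx, (M.tri hT).map_eq_sum A x]
  refine Finset.sum_congr rfl fun q hq => ?_
  rw [smul_eq_mul, hA (subset_convexHull ℝ _ hq)]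

theorem isP1_of_eqOn {v : E → ℝ} (A : Finset E → E →ᵃ[ℝ] ℝ) (hA : ∀ T ∈ M.elems, Set.EqOn v (A T) (hull T)) :
    M.IsP1 v := by
  refine ⟨?_, fun T hT => ⟨A T, hA T hT⟩⟩
  rw [← M.cover]
  have he : ⋃ T ∈ M.elems, hull T = ⋃ T : M.elems, hull (T : Finset E) :=
    Set.biUnion_eq_iUnion (M.elems : Set (Finset E)) fun T _ => hull T
  rw [he]
  refine (locallyFinite_of_finite _).continuousOn_iUnion
    (fun T => (M.tri T.2).isCompact_hull.isClosed) fun T => ?_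
  exact ((contDiff_affine (n := 0) (A T)).continuous.continuousOn).congr (hA T T.2)

theorem isP1_hat (p : E) : M.IsP1 (M.hat p) :=
  isP1_of_eqOn (fun T => bary T p) fun _ hT _ hx => hat_eq hT hx p

theorem isP1_const (c : ℝ) : M.IsP1 (fun _ => c) :=
  isP1_of_eqOn (fun _ => AffineMap.const ℝ E c) fun _ _ _ _ => rfl

theorem IsP1.add_smul {v w : E → ℝ} (hv : M.IsP1 v) (hw : M.IsP1 w) (a b : ℝ) :
    M.IsP1 (fun x => a * v x + b * w x) := by
  refine ⟨(continuousOn_const.mul hv.1).add (continuousOn_const.mul hw.1), fun T hT => ?_⟩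
  obtain ⟨A, hA⟩ := hv.2 T hT
  obtain ⟨B, hB⟩ := hw.2 T hT
  refine ⟨a • A + b • B, fun x hx => ?_⟩
  simp [hA hx, hB hx]

theorem isP1_interp (v : E → ℝ) : M.IsP1 (M.interp v) := by
  classical
  have key : ∀ S : Finset E, M.IsP1 (fun x => ∑ p ∈ S, v p * M.hat p x) := by
    intro S
    induction S using Finset.induction_on with
    | empty => simpa using isP1_const (M := M) 0
    | insert p S hp ih =>
      have := (isP1_hat (M := M) p).add_smul ih (v p) 1
      simpa [Finset.sum_insert hp] using this
  exact key M.nodes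

end Triangulation

/-! ### Green's formula -/

theorem memLp_finset_sum_measure {α ι F : Type*} [MeasurableSpace α] [NormedAddCommGroup F]
    {S : Finset ι} {μ : ι → Measure α} {f : α → F} :
    MemLp f 2 (∑ i ∈ S, μ i) ↔ ∀ i ∈ S, MemLp f 2 (μ i) := by
  classical
  constructor
  · intro h i hi
    refine h.mono_measure ?_
    rw [← Finset.add_sum_erase _ _ hi]
    exact Measure.le_add_right le_rfl
  · intro h
    induction S using Finset.induction_on with
    | empty => simp
    | insert i S hi ih =>
      have h1 := h i (Finset.mem_insert_self _ _)
      have h2 := ih fun j hj => h j (Finset.mem_insert_of_mem hj)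
      rw [Finset.sum_insert hi]
      rw [← memLp_norm_iff (h1.1.add_measure h2.1), memLp_two_iff_integrable_sq (h1.1.add_measure h2.1).norm]
      exact h1.norm.integrable_sq.add_measure h2.norm.integrable_sq

theorem sum_powersetCard_two {T : Finset E} (h : IsTri T) (f : Finset E → ℝ) :
    ∑ s ∈ T.powersetCard 2, f s = ∑ P ∈ T, f (T.erase P) := by
  symm
  refine Finset.sum_nbij (fun P => T.erase P) ?_ ?_ ?_ fun _ _ => rfl
  · intro P hP
    rw [Finset.mem_powersetCard]
    exact ⟨(h.isOpp_erase hP).subset, (h.isOpp_erase hP).card⟩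
  · intro P hP Q hQ hPQ
    by_contra hne
    have hPQ' : T.erase P = T.erase Q := hPQ
    have : P ∈ T.erase Q := Finset.mem_erase.mpr ⟨hne, hP⟩
    rw [← hPQ'] at this
    simp at this
  · intro s hs
    rw [Finset.mem_coe, Finset.mem_powersetCard] at hs
    obtain ⟨P, hP⟩ := h.exists_opp hs.1 hs.2
    exact ⟨P, hP.mem, hP.eq_erase.symm⟩

/-- Green's formula on a triangle. -/
theorem IsTri.green {T : Finset E} (h : IsTri T) {v : E → ℝ} {H : E → E}
    (hH : MemLp H 2 (volume.restrict (hull T)))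
    {S : Finset E → ℝ} (hS : ∀ s P, IsOpp T s P → S s = len s / (2 * area T) *
      ((∫ x in hull T, 2 * v x) + ∫ x in hull T, (inner ℝ (x - P) (H x) : ℝ))) (e : E) :
    ∫ x in hull T, (inner ℝ e (H x) : ℝ) =
      ∑ s ∈ T.powersetCard 2, (inner ℝ e (outwardNormal T s) : ℝ) * S s := by
  have hK := h.isCompact_hull
  have ha : 0 < area T := h.area_pos
  rw [sum_powersetCard_two h]
  -- The factor `len s / (2 * area T)` turns the normal into minus the gradient of the opposite
  -- coordinate. In the sum over the vertices the gradients add up to zero, which removes the term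
  -- with `v`, while the weighted position vectors add up to `-e`.
  have hterm : ∀ P ∈ T, (inner ℝ e (outwardNormal T (T.erase P)) : ℝ) * S (T.erase P) =
      - (inner ℝ (agrad (bary T P)) e : ℝ) * (∫ x in hull T, 2 * v x) -
        ∫ x in hull T, (inner ℝ ((inner ℝ (agrad (bary T P)) e : ℝ) • (x - P)) (H x) : ℝ) := by
    intro P hP
    have ho := h.isOpp_erase hP
    have e1 := congrArg (fun n : E => (inner ℝ e n : ℝ)) ho.len_smul_normal
    simp only [inner_smul_right] at e1
    have e2 : ∫ x in hull T, (inner ℝ ((inner ℝ (agrad (bary T P)) e : ℝ) • (x - P)) (H x) : ℝ) =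
        (inner ℝ (agrad (bary T P)) e : ℝ) * ∫ x in hull T, (inner ℝ (x - P) (H x) : ℝ) := by
      rw [← integral_const_mul]
      simp_rw [inner_smul_left]
      rfl
    rw [hS _ _ ho, e2]
    rw [real_inner_comm (agrad (bary T P)) e] at e1
    have hl := len_pos ho.card
    field_simp
    rw [mul_comm, mul_comm (inner ℝ e _ : ℝ), e1]
    ring
  rw [Finset.sum_congr rfl hterm, Finset.sum_sub_distrib, ← Finset.sum_mul, Finset.sum_neg_distrib,
    ← sum_inner, h.sum_agrad_bary, inner_zero_left, neg_zero, zero_mul, zero_sub,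
    ← integral_finsetSum, ← integral_neg]
  · refine integral_congr_ae (Eventually.of_forall fun x => ?_)
    simp only
    rw [← sum_inner, h.sum_inner_agrad_smul_sub, inner_neg_left, neg_neg]
  · intro P _
    exact integrable_inner_of_memLp (memLp_of_continuous hK (by fun_prop)) hH

namespace Triangulation

variable {Ω : Set E} {M : Triangulation Ω}

theorem restrict_hull_le_patch {s T : Finset E} (hT : T ∈ M.elemsAt s) :
    (volume : Measure E).restrict (hull T) ≤ volume.restrict (M.patch s) := by
  rw [restrict_patch, ← Finset.add_sum_erase _ _ hT]
  exact Measure.le_add_right le_rfl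

theorem restrict_hull_le (hΩ : IsPolygonalDomain Ω) {T : Finset E} (hT : T ∈ M.elems) :
    (volume : Measure E).restrict (hull T) ≤ volume.restrict Ω := by
  rw [restrict_domain (M := M) hΩ, ← Finset.add_sum_erase _ _ hT]
  exact Measure.le_add_right le_rfl

theorem memLp_domain_iff (hΩ : IsPolygonalDomain Ω) {F : Type*} [NormedAddCommGroup F] {f : E → F} :
    MemLp f 2 (volume.restrict Ω) ↔ ∀ T ∈ M.elems, MemLp f 2 (volume.restrict (hull T)) := by
  rw [restrict_domain (M := M) hΩ, memLp_finset_sum_measure]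

theorem integral_domain (hΩ : IsPolygonalDomain Ω) {F : Type*} [NormedAddCommGroup F] [NormedSpace ℝ F]
    {f : E → F} (hf : Integrable f (volume.restrict Ω)) : ∫ x in Ω, f x = ∑ T ∈ M.elems, ∫ x in hull T, f x := by
  rw [restrict_domain (M := M) hΩ]
  refine integral_finsetSum_measure fun T hT => Integrable.mono_measure hf (restrict_hull_le hΩ hT)

/-- On each element, a piecewise affine function and its gradient are given by an affine function. -/
theorem IsP1.ae_eq {v : E → ℝ} (hv : M.IsP1 v) {T : Finset E} (hT : T ∈ M.elems) :
    ∃ A : E →ᵃ[ℝ] ℝ, Set.EqOn v A (hull T) ∧ elemGrad T v = agrad A ∧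
      v =ᵐ[volume.restrict (hull T)] A ∧ gradient v =ᵐ[volume.restrict (hull T)] fun _ => agrad A := by
  obtain ⟨A, h1, h2, h3⟩ := hv.exists_affine hT
  refine ⟨A, h1, h2, ?_, ?_⟩
  · exact (ae_restrict_iff' (M.tri hT).measurableSet_hull).mpr (Eventually.of_forall h1)
  · filter_upwards [(M.tri hT).ae_mem_interior] with x hx
    exact (h3 x hx).gradient

theorem IsP1.memLp (hΩ : IsPolygonalDomain Ω) {v : E → ℝ} (hv : M.IsP1 v) :
    MemLp v 2 (volume.restrict Ω) ∧ MemLp (gradient v) 2 (volume.restrict Ω) := by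
  rw [memLp_domain_iff (M := M) hΩ, memLp_domain_iff (M := M) hΩ]
  refine ⟨fun T hT => ?_, fun T hT => ?_⟩
  · obtain ⟨A, -, -, h, -⟩ := hv.ae_eq hT
    exact (memLp_of_continuous (M.tri hT).isCompact_hull (contDiff_affine (n := 0) A).continuous).ae_eq h.symm
  · obtain ⟨A, -, -, -, h⟩ := hv.ae_eq hT
    exact (memLp_of_continuous (M.tri hT).isCompact_hull (continuous_const (y := agrad A))).ae_eq h.symm

theorem IsP1.memLp_smul (hΩ : IsPolygonalDomain Ω) {v : E → ℝ} (hv : M.IsP1 v) {F : Type*}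
    [NormedAddCommGroup F] [NormedSpace ℝ F] {G : E → F} (hG : MemLp G 2 (volume.restrict Ω)) :
    MemLp (fun x => v x • G x) 2 (volume.restrict Ω) := by
  rw [memLp_domain_iff (M := M) hΩ] at hG ⊢
  intro T hT
  obtain ⟨A, -, -, h, -⟩ := hv.ae_eq hT
  refine (memLp_smul_continuous (M.tri hT).isCompact_hull (contDiff_affine (n := 0) A).continuous
    (hG T hT)).ae_eq ?_
  filter_upwards [h] with x hx
  rw [hx]

theorem IsP1.memLp_smul_gradient (hΩ : IsPolygonalDomain Ω) {v : E → ℝ} (hv : M.IsP1 v) {ψ : E → ℝ}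
    (hψ : MemLp ψ 2 (volume.restrict Ω)) :
    MemLp (fun x => ψ x • gradient v x) 2 (volume.restrict Ω) := by
  rw [memLp_domain_iff (M := M) hΩ] at hψ ⊢
  intro T hT
  obtain ⟨A, -, -, -, h⟩ := hv.ae_eq hT
  have hA : MemLp (fun x => ψ x • agrad A) 2 (volume.restrict (hull T)) := by
    refine (hψ T hT).of_le_mul (c := ‖agrad A‖) ((hψ T hT).1.smul_const _)
      (Eventually.of_forall fun x => ?_)
    rw [norm_smul, mul_comm]
  refine hA.ae_eq ?_
  filter_upwards [h] with x hx
  rw [hx]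

/-- `g s` is the trace on the side `s` of a function `ψ` with gradient `G`. -/
def HasSideTraces (M : Triangulation Ω) (ψ : E → ℝ) (G : E → E) (g : Finset E → E → ℝ) : Prop :=
  ∀ s ∈ M.sides, ∀ T ∈ M.elemsAt s, ∀ P, IsOpp T s P → SideMoments T s P ψ G (g s)

theorem hasSideTraces_const (c : ℝ) : M.HasSideTraces (fun _ => c) (fun _ => 0) (fun _ _ => c) := by
  intro s _ T _ P h
  have h0 : gradient (fun _ : E => c) = fun _ => 0 := by
    ext1 x
    simp [gradient]
  have := h.sideMoments_smooth (f := fun _ => c) contDiff_const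
  rwa [h0] at this

theorem sum_normals {s : Finset E} (hs : s ∈ M.sides) (h2 : (M.elemsAt s).card = 2) (e : E) :
    ∑ T ∈ M.elemsAt s, (inner ℝ e (outwardNormal T s) : ℝ) = 0 := by
  have hsc : s.card = 2 := (M.mem_sides.mp hs).choose_spec.2.2
  obtain ⟨T, T', hne, hTT'⟩ := Finset.card_eq_two.mp h2
  have hT : T ∈ M.elemsAt s := by rw [hTT']; simp
  have hT' : T' ∈ M.elemsAt s := by rw [hTT']; simp
  rw [mem_elemsAt] at hT hT'
  obtain ⟨P, h⟩ := (M.tri hT.1).exists_opp hT.2 hsc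
  obtain ⟨P', h'⟩ := (M.tri hT'.1).exists_opp hT'.2 hsc
  rw [hTT', Finset.sum_pair hne, normal_neg hT.1 hT'.1 hne h h', inner_neg_right]
  ring

theorem hat_eq_zero_of_notMem {p x : E} (hx : x ∉ closure Ω) : M.hat p x = 0 := by
  by_contra hcon
  obtain ⟨T, hT, hxT⟩ := exists_mem_of_hat_ne_zero hcon
  exact hx (hull_subset (elemsAt_subset _ hT) hxT)

section Green

variable {ψ : E → ℝ} {G : E → E} {g : Finset E → E → ℝ}
  (hψ : MemLp ψ 2 (volume.restrict Ω)) (hG : MemLp G 2 (volume.restrict Ω))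
  (hg : M.HasSideTraces ψ G g) (hΩ : IsPolygonalDomain Ω)
include hψ hG hg hΩ

/-- Green's formula, summed over all elements. -/
theorem HasSideTraces.green {w : Finset E → E → ℝ} (hw : ∀ T ∈ M.elems, ContDiff ℝ 1 (w T)) {θ : E → ℝ}
    (hθ : ∀ T ∈ M.elems, Set.EqOn (w T) θ (hull T)) (e : Finset E → E) :
    ∑ T ∈ M.elems, ∫ x in hull T, (inner ℝ (e T) (w T x • G x + ψ x • gradient (w T) x) : ℝ) =
      ∑ s ∈ M.sides, (∑ T ∈ M.elemsAt s, (inner ℝ (e T) (outwardNormal T s) : ℝ)) *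
        ∫ x, g s x * θ x ∂(sideMeasure s) := by
  have h1 : ∀ T ∈ M.elems, ∫ x in hull T, (inner ℝ (e T) (w T x • G x + ψ x • gradient (w T) x) : ℝ) =
      ∑ s ∈ T.powersetCard 2, (inner ℝ (e T) (outwardNormal T s) : ℝ) * ∫ x, g s x * θ x ∂(sideMeasure s) := by
    intro T hT
    have hK := (M.tri hT).isCompact_hull
    have hψT := (memLp_domain_iff (M := M) hΩ).mp hψ T hT
    have hGT := (memLp_domain_iff (M := M) hΩ).mp hG T hT
    have hwc := (hw T hT).continuous
    have hwg := continuous_gradient (hw T hT)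
    have m1 : MemLp (fun x => w T x * ψ x) 2 (volume.restrict (hull T)) :=
      memLp_smul_continuous hK hwc hψT
    have m2 : MemLp (fun x => w T x • G x) 2 (volume.restrict (hull T)) :=
      memLp_smul_continuous hK hwc hGT
    have m3 : MemLp (fun x => ψ x • gradient (w T) x) 2 (volume.restrict (hull T)) := by
      obtain ⟨C, hC⟩ := hK.exists_bound_of_continuousOn hwg.continuousOn
      refine hψT.of_le_mul (c := C) (hψT.1.smul hwg.aestronglyMeasurable) ?_
      rw [ae_restrict_iff' (M.tri hT).measurableSet_hull]
      refine Eventually.of_forall fun x hx => ?_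
      rw [norm_smul, mul_comm]
      gcongr
      exact hC x hx
    refine (M.tri hT).green (v := fun x => w T x * ψ x) (memLp_fun_add m2 m3) (fun s P ho => ?_) (e T)
    have hs : s ∈ M.sides := M.mem_sides.mpr ⟨T, hT, ho.subset, ho.card⟩
    have hside : ∫ x, g s x * θ x ∂(sideMeasure s) = ∫ x, g s x * w T x ∂(sideMeasure s) := by
      have hms : MeasurableSet (hull s) := (s.finite_toSet.isCompact_convexHull ℝ).isClosed.measurableSet
      refine integral_congr_ae ?_
      rw [sideMeasure]
      filter_upwards [ae_restrict_mem hms] with x hx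
      rw [hθ T hT ((ho.hull_side_iff.mp hx).1)]
    have lin1 : MemLp (fun x : E => (inner ℝ (gradient (w T) x) (x - P) : ℝ)) 2 (volume.restrict (hull T)) :=
      memLp_of_continuous hK (by fun_prop)
    have cont2 : MemLp (fun x : E => x - P) 2 (volume.restrict (hull T)) :=
      memLp_of_continuous hK (by fun_prop)
    have cont3 : MemLp (fun x : E => w T x • (x - P)) 2 (volume.restrict (hull T)) :=
      memLp_of_continuous hK (by fun_prop)
    rw [hside, hg s hs T (M.mem_elemsAt.mpr ⟨hT, ho.subset⟩) P ho (w T) (hw T hT)]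
    congr 1
    have i1 : Integrable (fun x => ψ x * (2 * w T x + (inner ℝ (gradient (w T) x) (x - P) : ℝ)))
        (volume.restrict (hull T)) :=
      integrable_mul_of_memLp hψT (memLp_of_continuous hK (by fun_prop))
    have i2 := integrable_inner_of_memLp cont3 hGT
    have i3 : Integrable (fun x => 2 * (w T x * ψ x)) (volume.restrict (hull T)) := by
      have := integrable_mul_of_memLp (memLp_of_continuous hK hwc) hψT
      exact this.const_mul 2
    have i4 := integrable_inner_of_memLp cont2 (memLp_fun_add m2 m3)
    rw [← integral_add i1 i2, ← integral_add i3 i4]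
    refine integral_congr_ae (Eventually.of_forall fun x => ?_)
    simp only [inner_add_right, inner_smul_right, inner_smul_left, conj_trivial]
    rw [real_inner_comm (x - P) (gradient (w T) x)]
    ring
  rw [Finset.sum_congr rfl h1]
  simp_rw [Finset.sum_mul]
  -- Passing from elements and their sides to sides and their elements collects the normals at each
  -- side.
  refine Finset.sum_comm' fun T s => ?_
  rw [Finset.mem_powersetCard, mem_elemsAt, mem_sides]
  exact ⟨fun ⟨a, b, c⟩ => ⟨⟨a, b⟩, T, a, b, c⟩, fun ⟨⟨a, b⟩, _, _, _, c⟩ => ⟨a, b, c⟩⟩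

/-- Integration by parts for the product of an `H¹` function and a piecewise affine function. -/
theorem HasSideTraces.integral_product {v : E → ℝ} (hv : M.IsP1 v) {η : E → ℝ} (hη : ContDiff ℝ ∞ η)
    (hηs : HasCompactSupport η)
    (hbd : ∀ s ∈ M.sides, (M.elemsAt s).card = 1 → ∀ x ∈ hull s, v x * η x = 0) :
    ∫ x in Ω, (ψ x * v x) • gradient η x = - ∫ x in Ω, η x • (v x • G x + ψ x • gradient v x) := by
  obtain ⟨g1, g2⟩ := memLp_gradient_test (U := Ω) hη hηs
  have hvG := hv.memLp_smul hΩ hG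
  have hψv := hv.memLp_smul hΩ hψ
  have hψg := hv.memLp_smul_gradient hΩ hψ
  have i1 : Integrable (fun x => (ψ x * v x) • gradient η x) (volume.restrict Ω) := by
    have hψv' : MemLp (fun x => ψ x * v x) 2 (volume.restrict Ω) := by
      simpa [mul_comm, smul_eq_mul] using hψv
    exact memLp_one_iff_integrable.mp (g1.smul hψv')
  have i2 : Integrable (fun x => η x • (v x • G x + ψ x • gradient v x)) (volume.restrict Ω) :=
    memLp_one_iff_integrable.mp ((memLp_fun_add hvG hψg).smul g2)
  rw [eq_neg_iff_add_eq_zero, ← integral_add i1 i2]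
  refine ext_inner_left ℝ fun e => ?_
  rw [inner_zero_right, ← integral_inner (i1.fun_add i2), integral_domain (M := M) hΩ
    ((i1.fun_add i2).const_inner e)]
  choose! A hA1 hA2 hA3 hA4 using fun T (hT : T ∈ M.elems) => hv.ae_eq hT
  have hgreen := hg.green hψ hG hΩ (w := fun T x => A T x * η x)
    (fun T _ => (contDiff_affine (A T)).mul (hη.of_le (by simp))) (θ := fun x => v x * η x)
    (fun T hT x hx => by simp only; rw [hA1 T hT hx]) (fun _ => e)
  -- On sides with two elements the opposite normals cancel, because both elements see the same
  -- trace. On sides with one element the boundary hypothesis makes the integrand vanish.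
  have hzero : ∀ s ∈ M.sides, (∑ T ∈ M.elemsAt s, (inner ℝ e (outwardNormal T s) : ℝ)) *
        ∫ x, g s x * (v x * η x) ∂(sideMeasure s) = 0 := by
    intro s hs
    rcases card_elemsAt hs with h1 | h2
    · have hms : MeasurableSet (hull s) := (s.finite_toSet.isCompact_convexHull ℝ).isClosed.measurableSet
      have : ∫ x, g s x * (v x * η x) ∂(sideMeasure s) = 0 := by
        refine integral_eq_zero_of_ae ?_
        rw [sideMeasure]
        filter_upwards [ae_restrict_mem hms] with x hx
        rw [hbd s hs h1 x hx, mul_zero]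
        rfl
      rw [this, mul_zero]
    · rw [sum_normals hs h2, zero_mul]
  rw [Finset.sum_eq_zero hzero] at hgreen
  rw [← hgreen]
  refine Finset.sum_congr rfl fun T hT => integral_congr_ae ?_
  filter_upwards [hA3 T hT, hA4 T hT] with x hx1 hx2
  rw [hx1, hx2, gradient_mul ((contDiff_affine (n := 1) (A T)).differentiable one_ne_zero x)
    (hη.differentiable (by simp) x), (hasGradientAt_affine (A T) x).gradient]
  congr 1
  module

/-- A test function with support in `Ω` vanishes on boundary sides, so no boundary condition on the
product is needed. -/
theorem HasSideTraces.hasL2WeakGrad_mul {v : E → ℝ} (hv : M.IsP1 v) :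
    HasL2WeakGrad Ω (fun x => ψ x * v x) (fun x => v x • G x + ψ x • gradient v x) := by
  refine ⟨memLp_fun_add (hv.memLp_smul hΩ hG) (hv.memLp_smul_gradient hΩ hψ), fun η hη hηs hηU => ?_⟩
  refine hg.integral_product hψ hG hΩ hv hη hηs fun s hs h1 x hx => ?_
  rw [image_eq_zero_of_notMem_tsupport fun hxs => hull_side_disjoint hΩ hs h1 x hx (hηU hxs), mul_zero]

/-- Products with the nodal basis functions of interior nodes can be extended by zero. -/
theorem HasSideTraces.hasL2WeakGrad_mul_hat {p : E} (hp : p ∈ Ω) :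
    HasL2WeakGrad Set.univ (fun x => ψ x * M.hat p x)
      (fun x => M.hat p x • G x + ψ x • gradient (M.hat p) x) := by
  have hv := isP1_hat (M := M) p
  have hae : ∀ᵐ x ∂(volume : Measure E), x ∈ closure Ω → x ∈ Ω := by
    have h1 := biUnion_ae_eq (M := M) subset_rfl (fun T hT => interior_hull_subset hΩ hT)
      (by rw [M.cover]; exact subset_closure)
    rw [M.cover] at h1
    filter_upwards [h1] with x hx
    exact fun h => (Eq.mpr hx h : Ω x)
  have hz : ∀ x, x ∉ closure Ω → M.hat p x = 0 ∧ gradient (M.hat p) x = 0 := by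
    intro x hx
    refine ⟨hat_eq_zero_of_notMem hx, ?_⟩
    have : M.hat p =ᶠ[𝓝 x] fun _ => 0 := by
      filter_upwards [isClosed_closure.isOpen_compl.mem_nhds hx] with z hz
      exact hat_eq_zero_of_notMem hz
    rw [gradient, this.fderiv_eq]
    simp
  have hL : MemLp (fun x => M.hat p x • G x + ψ x • gradient (M.hat p) x) 2 (volume.restrict Ω) :=
    memLp_fun_add (hv.memLp_smul hΩ hG) (hv.memLp_smul_gradient hΩ hψ)
  have hind : ∀ {F : Type} [NormedAddCommGroup F] (f : E → F), (∀ x, x ∉ closure Ω → f x = 0) →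
      Ω.indicator f =ᵐ[volume] f := by
    intro F _ f hf
    filter_upwards [hae] with x hx
    by_cases hxΩ : x ∈ Ω
    · rw [Set.indicator_of_mem hxΩ]
    · rw [Set.indicator_of_notMem hxΩ, hf x fun h => hxΩ (hx h)]
  refine ⟨?_, fun η hη hηs _ => ?_⟩
  · rw [Measure.restrict_univ]
    refine ((memLp_indicator_iff_restrict hΩ.isOpen.measurableSet).mpr hL).ae_eq (hind _ fun x hx => ?_)
    rw [(hz x hx).1, (hz x hx).2, zero_smul, smul_zero, zero_add]
  · have key := hg.integral_product hψ hG hΩ hv hη hηs fun s hs h1 x hx => ?_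
    · rw [← integral_indicator hΩ.isOpen.measurableSet, ← integral_indicator hΩ.isOpen.measurableSet,
        integral_congr_ae (hind _ fun x hx => by rw [(hz x hx).1, mul_zero, zero_smul]),
        integral_congr_ae (hind _ fun x hx => by
          rw [(hz x hx).1, (hz x hx).2, zero_smul, smul_zero, zero_add, smul_zero])] at key
      simpa using key
    · have hsc : ∃ T ∈ M.elems, s ⊆ T ∧ s.card = 2 := M.mem_sides.mp hs
      obtain ⟨T, hT, hsT, hc⟩ := hsc
      -- Test functions on the whole plane need not vanish on the boundary. Instead `φ_p` does,
      -- since an interior node lies on no boundary side.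
      have hps : p ∉ s := fun hps => by
        have := card_elemsAt_of_interior_node hΩ hp hs hps
        omega
      have hx' := ((M.tri hT).mem_hull_subset_iff hsT).mp hx
      rw [hat_eq hT hx'.1]
      by_cases hpT : p ∈ T
      · rw [hx'.2 p hpT hps, zero_mul]
      · rw [bary, dif_neg (by tauto)]; simp

/-- The diffusion term tested with the product of a function and a nodal basis function. -/
theorem HasSideTraces.integral_inner_hat {φ : E → ℝ} (hφ : M.IsP1 φ) (p : E) :
    ∫ x in Ω, (inner ℝ (gradient φ x) (M.hat p x • G x + ψ x • gradient (M.hat p) x) : ℝ) =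
      ∑ s ∈ M.sides, normalJump M φ s * ∫ x, g s x * M.hat p x ∂(sideMeasure s) := by
  have hv := isP1_hat (M := M) p
  have hL : MemLp (fun x => M.hat p x • G x + ψ x • gradient (M.hat p) x) 2 (volume.restrict Ω) :=
    memLp_fun_add (hv.memLp_smul hΩ hG) (hv.memLp_smul_gradient hΩ hψ)
  rw [integral_domain (M := M) hΩ (integrable_inner_of_memLp (hφ.memLp hΩ).2 hL)]
  have hgreen := hg.green hψ hG hΩ (w := fun T => bary T p) (fun T _ => contDiff_affine _)
    (θ := M.hat p) (fun T hT x hx => (hat_eq hT hx p).symm) (fun T => elemGrad T φ)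
  refine Eq.trans (Finset.sum_congr rfl fun T hT => integral_congr_ae ?_) hgreen
  obtain ⟨A, -, hA2, -, hA4⟩ := hφ.ae_eq hT
  have hgh : gradient (M.hat p) =ᵐ[volume.restrict (hull T)] fun _ => agrad (bary T p) := by
    filter_upwards [(M.tri hT).ae_mem_interior] with x hx
    refine HasGradientAt.gradient ((hasGradientAt_affine (bary T p) x).congr_of_eventuallyEq ?_)
    filter_upwards [mem_interior_iff_mem_nhds.mp hx] with z hz
    exact hat_eq hT hz p
  filter_upwards [hA4, hgh, ae_restrict_mem (M.tri hT).measurableSet_hull] with x h1 h2 h3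
  rw [h1, h2, hat_eq hT h3, hA2, (hasGradientAt_affine (bary T p) x).gradient]

end Green

/-! ### Traces of `H¹` functions on the sides -/

theorem weakGrad_patch_ae_eq (hΩ : IsPolygonalDomain Ω) {ψ : E → ℝ} (hψ : MemH1 Ω ψ) (s : Finset E) :
    weakGrad (M.patch s) ψ =ᵐ[volume.restrict (M.patch s)] weakGrad Ω ψ :=
  (hψ.hasL2WeakGrad.mono hΩ.isOpen.measurableSet (patch_subset hΩ s)).weakGrad_ae_eq (isOpen_patch s)

/-- The patch of a side contracts into itself, which gives smooth approximations on all its elements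
at once. Convergence on a single one of these elements already yields the limit on the side. -/
theorem isTrace_trace (hΩ : IsPolygonalDomain Ω) {ψ : E → ℝ} (hψ : MemH1 Ω ψ) {s : Finset E}
    (hs : s ∈ M.sides) : IsTrace (M.patch s) s ψ (trace (M.patch s) s ψ) := by
  have hex : ∃ g, IsTrace (M.patch s) s ψ g := by
    have hw : HasL2WeakGrad (M.patch s) ψ (weakGrad (M.patch s) ψ) :=
      (hψ.hasL2WeakGrad.mono hΩ.isOpen.measurableSet (patch_subset hΩ s)).congr (EventuallyEq.refl _ _)
        (weakGrad_patch_ae_eq hΩ hψ s).symm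
    have hψp : MemLp ψ 2 (volume.restrict (M.patch s)) :=
      hψ.1.mono_measure (Measure.restrict_mono (patch_subset hΩ s) le_rfl)
    obtain ⟨c, hc⟩ := exists_center hs
    obtain ⟨f, hf, h1, h2⟩ := exists_smooth_approx (isOpen_patch s) (isBounded_patch s) hc hψp hw
    obtain ⟨T, hT, hsT, hsc⟩ := M.mem_sides.mp hs
    obtain ⟨P, h⟩ := (M.tri hT).exists_opp hsT hsc
    have hle := restrict_hull_le_patch (M := M) (M.mem_elemsAt.mpr ⟨hT, hsT⟩)
    obtain ⟨g, hg, h3⟩ := h.exists_trace_limit hf (hψp.mono_measure hle) (hw.1.mono_measure hle)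
      (h1.mono hle) (h2.mono hle)
    exact ⟨g, hg, f, hf, h1, h2, h3⟩
  rw [trace, dif_pos hex]
  exact hex.choose_spec

/-- The approximating sequence of a trace, restricted to an element. -/
theorem exists_approx (hΩ : IsPolygonalDomain Ω) {ψ : E → ℝ} (hψ : MemH1 Ω ψ) {s T : Finset E}
    (hs : s ∈ M.sides) (hT : T ∈ M.elemsAt s) : ∃ f : ℕ → E → ℝ, (∀ k, ContDiff ℝ ∞ (f k)) ∧
      L2Lim (volume.restrict (hull T)) f ψ ∧
      L2Lim (volume.restrict (hull T)) (fun k => gradient (f k)) (weakGrad Ω ψ) ∧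
      L2Lim (sideMeasure s) f (trace (M.patch s) s ψ) := by
  obtain ⟨-, f, hf, h1, h2, h3⟩ := isTrace_trace hΩ hψ hs
  have hle := restrict_hull_le_patch (M := M) hT
  exact ⟨f, hf, L2Lim.mono h1 hle, (L2Lim.congr h2 (weakGrad_patch_ae_eq hΩ hψ s)).mono hle, h3⟩

/-- The trace is defined by approximation on the whole patch of the side. The same function
therefore satisfies the moment identities of each adjacent element; this is the absence of jumps for
`H¹` functions. -/
theorem hasSideTraces (hΩ : IsPolygonalDomain Ω) {ψ : E → ℝ} (hψ : MemH1 Ω ψ) :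
    M.HasSideTraces ψ (weakGrad Ω ψ) (fun s => trace (M.patch s) s ψ) := by
  intro s hs T hT P h
  obtain ⟨f, hf, h1, h2, h3⟩ := exists_approx hΩ hψ hs hT
  have hle := restrict_hull_le (M := M) hΩ (elemsAt_subset s hT)
  exact h.sideMoments_of_tendsto hf (hψ.1.mono_measure hle) (hψ.hasL2WeakGrad.1.mono_measure hle) h1 h2
    (isTrace_trace hΩ hψ hs).1 h3

theorem IsP1.hasL2WeakGrad (hΩ : IsPolygonalDomain Ω) {v : E → ℝ} (hv : M.IsP1 v) :
    HasL2WeakGrad Ω v (gradient v) := by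
  have : IsFiniteMeasure (volume.restrict Ω) := by
    refine ⟨?_⟩
    rw [Measure.restrict_apply_univ]
    refine (measure_mono subset_closure).trans_lt ?_
    rw [← M.cover]
    exact (isCompact_biUnion (M := M) subset_rfl).measure_lt_top
  have := (hasSideTraces_const (M := M) 1).hasL2WeakGrad_mul (memLp_const 1) MemLp.zero hΩ hv
  simpa using this

theorem IsP1.memH1 (hΩ : IsPolygonalDomain Ω) {v : E → ℝ} (hv : M.IsP1 v) : MemH1 Ω v :=
  ⟨(hv.memLp hΩ).1, _, hv.hasL2WeakGrad hΩ⟩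

end Triangulation

/-! ### Chains of elements -/

section Chains

variable {V : Type*} {G : SimpleGraph V}

theorem le_pow_mul_of_walk {f : V → ℝ} {κ : ℝ} (hκ : 1 ≤ κ)
    (h : ∀ u v, G.Adj u v → f u ≤ κ * f v) {u v : V} (w : G.Walk u v) : f u ≤ κ ^ w.length * f v := by
  induction w with
  | nil => simp
  | cons hadj w ih =>
    rw [SimpleGraph.Walk.length_cons, pow_succ', mul_assoc]
    exact (h _ _ hadj).trans (mul_le_mul_of_nonneg_left ih (by linarith))

theorem abs_sub_le_of_walk {f : V → ℝ} {K : ℝ} (h : ∀ u v, G.Adj u v → |f u - f v| ≤ K) {u v : V}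
    (w : G.Walk u v) : |f u - f v| ≤ w.length * K := by
  induction w with
  | nil => simp
  | @cons a b c hadj w ih =>
    rw [SimpleGraph.Walk.length_cons, Nat.cast_succ, add_mul, one_mul]
    have := abs_sub_le (f a) (f b) (f c)
    have := h _ _ hadj
    linarith

theorem exists_short_walk [Fintype V] (hG : G.Preconnected) (u v : V) :
    ∃ w : G.Walk u v, w.length ≤ Fintype.card V := by
  classical
  obtain ⟨w, hw⟩ := (hG u v).exists_isPath
  exact ⟨w, hw.length_lt.le⟩

end Chains

/-- In polar coordinates the punctured disc is a continuous image of the circle times an interval.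
-/
theorem isPreconnected_punctured_ball (p : E) (r : ℝ) :
    IsPreconnected (Metric.ball p r \ {p}) := by
  have hrank : 1 < Module.rank ℝ E := by
    rw [← Module.finrank_eq_rank, finrank_euclideanSpace_fin]
    norm_num
  have hs : IsPreconnected (Metric.sphere (0 : E) 1) :=
    (isPathConnected_sphere hrank 0 zero_le_one).isConnected.isPreconnected
  have himg : Metric.ball p r \ {p} =
      (fun z : E × ℝ => p + z.2 • z.1) '' (Metric.sphere (0 : E) 1 ×ˢ Set.Ioo 0 r) := by
    ext x
    simp only [Set.mem_sdiff, Metric.mem_ball, Set.mem_singleton_iff, Set.mem_image, Set.mem_prod,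
      mem_sphere_zero_iff_norm, Set.mem_Ioo, Prod.exists]
    constructor
    · rintro ⟨h1, h2⟩
      have hpos : 0 < ‖x - p‖ := norm_pos_iff.mpr (sub_ne_zero.mpr h2)
      refine ⟨‖x - p‖⁻¹ • (x - p), ‖x - p‖, ⟨?_, hpos, by rwa [← dist_eq_norm]⟩, ?_⟩
      · rw [norm_smul, norm_inv, norm_norm, inv_mul_cancel₀ hpos.ne']
      · rw [smul_smul, mul_inv_cancel₀ hpos.ne', one_smul, add_sub_cancel]
    · rintro ⟨a, t, ⟨h1, h2, h3⟩, rfl⟩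
      have ha : a ≠ 0 := by rintro rfl; simp at h1
      refine ⟨?_, by simp [h2.ne', ha]⟩
      rw [dist_eq_norm, add_sub_cancel_left, norm_smul, h1, Real.norm_of_nonneg h2.le]
      linarith
  rw [himg]
  exact (hs.prod isPreconnected_Ioo).image _ (by fun_prop)

/-! ### Connectivity of the elements around a node. -/

namespace Triangulation

variable {Ω : Set E} {M : Triangulation Ω}

/-- Elements at the node `p`, joined if they share a side at `p`. -/
def nodeGraph (M : Triangulation Ω) (p : E) : SimpleGraph {T // T ∈ M.elemsAt {p}} where
  Adj T T' := T ≠ T' ∧ ∃ s : Finset E, p ∈ s ∧ s.card = 2 ∧ s ⊆ T.1 ∧ s ⊆ T'.1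
  symm := ⟨fun _ _ ⟨h, s, a, b, c, d⟩ => ⟨h.symm, s, a, b, d, c⟩⟩
  loopless := ⟨fun _ h => h.1 rfl⟩

theorem mem_elemsAt_singleton {p : E} {T : Finset E} : T ∈ M.elemsAt {p} ↔ T ∈ M.elems ∧ p ∈ T := by
  rw [mem_elemsAt, Finset.singleton_subset_iff]

theorem mem_of_node_mem_hull {p : E} (hp : p ∈ M.nodes) {T : Finset E} (hT : T ∈ M.elems)
    (h : p ∈ hull T) : p ∈ T := by
  obtain ⟨S, hS, hpS⟩ := M.mem_nodes.mp hp
  refine mem_of_bary_pos hS hT (subset_convexHull ℝ _ hpS) h ?_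
  rw [(M.tri hS).bary_self hpS]
  exact one_pos

/-- At an interior node a small punctured disc is connected. At a boundary node this is the local
connectedness of the domain, and removing `p` changes nothing because `p ∉ Ω`. The radius also
excludes all elements that do not have `p` as a vertex. -/
theorem exists_local_connected (hΩ : IsPolygonalDomain Ω) {p : E} (hp : p ∈ M.nodes) : ∃ r > 0,
    IsPreconnected ((Ω ∩ Metric.ball p r) \ {p}) ∧
      ∀ z ∈ Metric.ball p r, ∀ T ∈ M.elems, z ∈ hull T → p ∈ T := by
  obtain ⟨r, hr, h⟩ := Metric.eventually_nhds_iff_ball.mp (eventually_mem_imp (M := M) p)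
  by_cases hpΩ : p ∈ Ω
  · obtain ⟨r', hr', h'⟩ := Metric.isOpen_iff.mp hΩ.isOpen p hpΩ
    have hs1 : Metric.ball p (min r r') ⊆ Metric.ball p r := Metric.ball_subset_ball (min_le_left _ _)
    have hs2 : Metric.ball p (min r r') ⊆ Ω := (Metric.ball_subset_ball (min_le_right _ _)).trans h'
    refine ⟨min r r', lt_min hr hr', ?_, fun z hz T hT hzT =>
      mem_of_node_mem_hull hp hT (h z (hs1 hz) T hT hzT)⟩
    rw [Set.inter_eq_self_of_subset_right hs2]
    exact isPreconnected_punctured_ball _ _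
  · have hfr : p ∈ frontier Ω := by
      rw [hΩ.isOpen.frontier_eq]
      exact ⟨mem_closure_of_node hp, hpΩ⟩
    obtain ⟨r', hc, hr'⟩ := ((hΩ.locally_connected p hfr).and (Ioo_mem_nhdsGT hr)).exists
    refine ⟨r', hr'.1, ?_, fun z hz T hT hzT =>
      mem_of_node_mem_hull hp hT (h z (Metric.ball_subset_ball hr'.2.le hz) T hT hzT)⟩
    rw [Set.sdiff_singleton_eq_self fun hmem => hpΩ hmem.1]
    exact hc.isPreconnected

/-- Suppose `T1` is not reachable from `T0`. The reachable elements and the remaining elements at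
`p` give two closed sets that cover the connected punctured neighbourhood and both meet it, so they
share a point other than `p`. By conformity two elements from different classes then have a second
common vertex, hence a common side at `p`. -/
theorem nodeGraph_preconnected (hΩ : IsPolygonalDomain Ω) {p : E} (hp : p ∈ M.nodes) :
    (M.nodeGraph p).Preconnected := by
  classical
  intro T0 T1
  by_contra hcon
  obtain ⟨r, hr, hW, hball⟩ := exists_local_connected hΩ hp
  set S := (M.elemsAt {p}).filter fun T => ∃ h : T ∈ M.elemsAt {p}, (M.nodeGraph p).Reachable T0 ⟨T, h⟩
  have hfin : ∀ A : Finset (Finset E), A ⊆ M.elems → IsClosed (⋃ T ∈ A, hull T) :=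
    fun A hA => (isCompact_biUnion hA).isClosed
  have hsub1 : S ⊆ M.elems := (Finset.filter_subset _ _).trans (elemsAt_subset _)
  have hsub2 : M.elemsAt {p} \ S ⊆ M.elems := Finset.sdiff_subset.trans (elemsAt_subset _)
  have hne : ∀ T ∈ M.elemsAt {p}, ∀ U : Set E, hull T ⊆ U →
      (((Ω ∩ Metric.ball p r) \ {p}) ∩ U).Nonempty := by
    intro T hT U hU
    obtain ⟨hTe, hpT⟩ := mem_elemsAt_singleton.mp hT
    have h := M.tri hTe
    have hpc : p ∈ closure (interior (hull T)) := by
      rw [h.closure_interior]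
      exact subset_convexHull ℝ _ hpT
    obtain ⟨z, hz1, hz2⟩ := mem_closure_iff_nhds.mp hpc _ (Metric.ball_mem_nhds p hr)
    refine ⟨z, ⟨⟨interior_hull_subset hΩ hTe hz2, hz1⟩, fun hzp => ?_⟩, hU (interior_subset hz2)⟩
    obtain ⟨q, hq, hqp⟩ := Finset.exists_mem_ne (by rw [h.1]; norm_num : 1 < T.card) p
    have := h.mem_interior_iff.mp hz2 q hq
    rw [Set.mem_singleton_iff.mp hzp, h.bary_of_ne hpT hqp] at this
    exact this.false
  have hT0 : T0.1 ∈ S := Finset.mem_filter.mpr ⟨T0.2, T0.2, SimpleGraph.Reachable.refl _⟩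
  have hT1 : T1.1 ∈ M.elemsAt {p} \ S := by
    refine Finset.mem_sdiff.mpr ⟨T1.2, fun h => hcon ?_⟩
    exact (Finset.mem_filter.mp h).2.choose_spec
  obtain ⟨x, hxW, hx1, hx2⟩ := isPreconnected_closed_iff.mp hW _ _ (hfin S hsub1) (hfin _ hsub2)
    (fun z hz => by
      obtain ⟨T, hT, hzT⟩ := exists_hull (M := M) (subset_closure hz.1.1)
      have hT' : T ∈ M.elemsAt {p} := mem_elemsAt_singleton.mpr ⟨hT, hball z hz.1.2 T hT hzT⟩
      by_cases hS : T ∈ S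
      · exact Or.inl (Set.mem_biUnion hS hzT)
      · exact Or.inr (Set.mem_biUnion (Finset.mem_sdiff.mpr ⟨hT', hS⟩) hzT))
    (hne _ T0.2 _ (Set.subset_biUnion_of_mem (u := fun T => hull T) hT0))
    (hne _ T1.2 _ (Set.subset_biUnion_of_mem (u := fun T => hull T) hT1))
  obtain ⟨T, hT, hxT⟩ := Set.mem_iUnion₂.mp hx1
  obtain ⟨T', hT', hxT'⟩ := Set.mem_iUnion₂.mp hx2
  obtain ⟨hTp, hTp', hreach⟩ := Finset.mem_filter.mp hT
  obtain ⟨hTp2, hTS⟩ := Finset.mem_sdiff.mp hT'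
  obtain ⟨hTe, hpT⟩ := mem_elemsAt_singleton.mp hTp
  obtain ⟨hTe', hpT'⟩ := mem_elemsAt_singleton.mp hTp2
  have hx : x ∈ convexHull ℝ ((T : Set E) ∩ T') := by
    rw [← M.conforming T hTe T' hTe']
    exact ⟨hxT, hxT'⟩
  rw [← Finset.coe_inter] at hx
  by_cases hcard : (T ∩ T').card ≤ 1
  · have heq : T ∩ T' = {p} := by
      refine Finset.eq_singleton_iff_unique_mem.mpr ⟨Finset.mem_inter.mpr ⟨hpT, hpT'⟩, fun q hq => ?_⟩
      exact Finset.card_le_one.mp hcard q hq p (Finset.mem_inter.mpr ⟨hpT, hpT'⟩)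
    rw [heq, Finset.coe_singleton, convexHull_singleton] at hx
    exact hxW.2 hx
  · obtain ⟨q, hq, hqp⟩ := Finset.exists_mem_ne (not_le.mp hcard) p
    rw [Finset.mem_inter] at hq
    refine hTS (Finset.mem_filter.mpr ⟨hTp2, hTp2, hreach.trans (SimpleGraph.Adj.reachable ?_)⟩)
    refine ⟨fun h => hTS ?_, {p, q}, by simp, Finset.card_pair hqp.symm, ?_, ?_⟩
    · obtain rfl : T = T' := congrArg Subtype.val h
      exact hT
    · simp [Finset.insert_subset_iff, hpT, hq.1]
    · simp [Finset.insert_subset_iff, hpT', hq.2]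

/-! ### Shape regularity -/

/-- The area of the unit disc. -/
def discArea : ℝ := (volume : Measure E).real (Metric.ball (0 : E) 1)

theorem discArea_pos : 0 < discArea :=
  ENNReal.toReal_pos (Metric.measure_ball_pos _ _ one_pos).ne' measure_ball_lt_top.ne

theorem measureReal_closedBall (x : E) {r : ℝ} (hr : 0 ≤ r) :
    (volume : Measure E).real (Metric.closedBall x r) = r ^ 2 * discArea := by
  rw [Measure.real, Measure.addHaar_closedBall _ _ hr, ENNReal.toReal_mul,
    finrank_euclideanSpace_fin, ENNReal.toReal_ofReal (by positivity)]
  rfl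

/-- The diameter of an element. -/
def size (T : Finset E) : ℝ := Metric.diam (hull T)

theorem dist_le_size {T : Finset E} {x y : E} (hx : x ∈ hull T) (hy : y ∈ hull T) : dist x y ≤ size T :=
  Metric.dist_le_diam_of_mem (T.finite_toSet.isCompact_convexHull ℝ).isBounded hx hy

theorem len_le_size {T s : Finset E} {P : E} (h : IsOpp T s P) : len s ≤ size T := by
  obtain ⟨Q, R, -, -, -, hT, rfl⟩ := h.vertices
  rw [len_pair]
  refine dist_le_size (subset_convexHull ℝ _ ?_) (subset_convexHull ℝ _ ?_) <;>
  · rw [hT]; simp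

theorem size_pos {T : Finset E} (h : IsTri T) : 0 < size T := by
  obtain ⟨s, hs, hc⟩ := Finset.exists_subset_card_eq (by rw [h.1]; norm_num : 2 ≤ T.card)
  obtain ⟨P, ho⟩ := h.exists_opp hs hc
  exact (len_pos hc).trans_le (len_le_size ho)

/-- The opposite coordinate drops by one along a segment no longer than the diameter, so its
gradient has norm at least the reciprocal of the diameter. -/
theorem two_area_le {T s : Finset E} {P : E} (h : IsOpp T s P) : 2 * area T ≤ len s * size T := by
  obtain ⟨Q, R, hPQ, -, -, hT, hs⟩ := h.vertices
  have hQ : Q ∈ T := by rw [hT]; simp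
  have h1 : (1 : ℝ) ≤ ‖agrad (bary T P)‖ * size T := by
    have := affine_sub_eq_inner (bary T P) P Q
    rw [h.tri.bary_self h.mem, h.tri.bary_of_ne hQ hPQ, sub_zero] at this
    rw [this]
    refine (real_inner_le_norm _ _).trans ?_
    gcongr
    rw [← dist_eq_norm]
    exact dist_le_size (subset_convexHull ℝ _ h.mem) (subset_convexHull ℝ _ hQ)
  have ha : 0 < area T := h.tri.area_pos
  calc 2 * area T = 2 * area T * 1 := by ring
    _ ≤ 2 * area T * (‖agrad (bary T P)‖ * size T) := by gcongr
    _ = len s * size T := by rw [← h.two_area_mul_norm]; ring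

theorem ShapeRegular.pos {ρ : ℝ} (hρ : M.ShapeRegular ρ) {T : Finset E} (hT : T ∈ M.elems) : 0 < ρ := by
  obtain ⟨c, r, hr, -, h⟩ := hρ T hT
  exact pos_of_mul_pos_left ((size_pos (M.tri hT)).trans_le h) hr.le

theorem ShapeRegular.area_ge {ρ : ℝ} (hρ : M.ShapeRegular ρ) {T : Finset E} (hT : T ∈ M.elems) :
    discArea * size T ^ 2 ≤ ρ ^ 2 * area T := by
  obtain ⟨c, r, hr, hb, h⟩ := hρ T hT
  have h1 : r ^ 2 * discArea ≤ area T := by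
    rw [← measureReal_closedBall c hr.le]
    exact measureReal_mono hb (M.tri hT).isCompact_hull.measure_lt_top.ne
  have h2 : size T ^ 2 ≤ (ρ * r) ^ 2 := pow_le_pow_left₀ (size_pos (M.tri hT)).le h 2
  have := discArea_pos
  calc discArea * size T ^ 2 ≤ discArea * (ρ * r) ^ 2 := by gcongr
    _ = ρ ^ 2 * (r ^ 2 * discArea) := by ring
    _ ≤ _ := by gcongr

theorem ShapeRegular.len_ge {ρ : ℝ} (hρ : M.ShapeRegular ρ) {T s : Finset E} {P : E} (hT : T ∈ M.elems)
    (h : IsOpp T s P) : 2 * discArea * size T ≤ ρ ^ 2 * len s := by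
  have h1 := hρ.area_ge hT
  have h2 := two_area_le h
  have h3 := size_pos (M.tri hT)
  have h4 : ρ ^ 2 * (2 * area T) ≤ ρ ^ 2 * (len s * size T) := by gcongr
  refine le_of_mul_le_mul_right ?_ h3
  nlinarith

/-- The ratio of the diameters of neighbouring elements is at most `sizeRatio ρ`. -/
def sizeRatio (ρ : ℝ) : ℝ := max 1 (ρ ^ 2 / (2 * discArea))

/-- Both diameters are compared with the common side: shape regularity bounds that side from below,
and it is no longer than the neighbour's diameter. -/
theorem ShapeRegular.size_le {ρ : ℝ} (hρ : M.ShapeRegular ρ) {T T' s : Finset E} (hT : T ∈ M.elems)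
    (hT' : T' ∈ M.elems) (hs : s.card = 2) (h : s ⊆ T) (h' : s ⊆ T') :
    size T ≤ sizeRatio ρ * size T' := by
  obtain ⟨P, ho⟩ := (M.tri hT).exists_opp h hs
  obtain ⟨P', ho'⟩ := (M.tri hT').exists_opp h' hs
  have h1 := hρ.len_ge hT ho
  have h2 := len_le_size ho'
  have hd := discArea_pos
  have h3 := size_pos (M.tri hT')
  have h4 : size T ≤ ρ ^ 2 / (2 * discArea) * size T' := by
    rw [div_mul_eq_mul_div, le_div_iff₀ (by positivity)]
    nlinarith [sq_nonneg ρ, mul_le_mul_of_nonneg_left h2 (sq_nonneg ρ)]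
  exact h4.trans (by gcongr; exact le_max_right _ _)

/-- The number of elements at a node is bounded. -/
theorem ShapeRegular.card_elemsAt_le {ρ : ℝ} (hρ : M.ShapeRegular ρ) {p : E} (hp : p ∈ M.nodes) :
    ((M.elemsAt {p}).card : ℝ) ≤ ρ ^ 2 := by
  obtain ⟨T0, hT0, hpT0⟩ := M.mem_nodes.mp hp
  have hρ0 := hρ.pos hT0
  obtain ⟨T1, hT1, hmin⟩ := Finset.exists_min_image (M.elemsAt {p}) size
    ⟨T0, mem_elemsAt_singleton.mpr ⟨hT0, hpT0⟩⟩
  set r0 := size T1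
  have hr0 : 0 < r0 := size_pos (M.tri (elemsAt_subset _ hT1))
  -- Let `r0` be the smallest diameter at `p`. Shrinking each element towards `p` by the ratio of
  -- `r0` to its diameter carries its inscribed disc to one of radius at least `r0 / ρ` within
  -- distance `r0` of `p`. Comparing areas, at most `ρ ^ 2` of these almost disjoint pieces fit into
  -- that ball.
  have key : ∀ T ∈ M.elemsAt {p}, ENNReal.ofReal ((r0 / ρ) ^ 2 * discArea) ≤
      (volume : Measure E).restrict (hull T) (Metric.closedBall p r0) := by
    intro T hT
    obtain ⟨hTe, hpT⟩ := mem_elemsAt_singleton.mp hT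
    obtain ⟨c, r, hr, hb, h⟩ := hρ T hTe
    have hs := size_pos (M.tri hTe)
    set t := r0 / size T with ht
    have ht0 : 0 < t := div_pos hr0 hs
    have ht1 : t ≤ 1 := (div_le_one hs).mpr (hmin T hT)
    have hsub : Metric.closedBall (p + t • (c - p)) (t * r) ⊆ Metric.closedBall p r0 ∩ hull T := by
      intro y hy
      have hz : p + t⁻¹ • (y - p) ∈ hull T := by
        refine hb ?_
        rw [Metric.mem_closedBall, dist_eq_norm] at hy ⊢
        have : p + t⁻¹ • (y - p) - c = t⁻¹ • (y - (p + t • (c - p))) := by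
          rw [← sub_sub, smul_sub t⁻¹ (y - p), smul_smul, inv_mul_cancel₀ ht0.ne', one_smul]
          abel
        rw [this, norm_smul, norm_inv, Real.norm_of_nonneg ht0.le, inv_mul_le_iff₀ ht0]
        exact hy
      have hph : p ∈ hull T := subset_convexHull ℝ _ hpT
      have hyz : y = p + t • ((p + t⁻¹ • (y - p)) - p) := by
        rw [add_sub_cancel_left, smul_smul, mul_inv_cancel₀ ht0.ne', one_smul, add_sub_cancel]
      refine ⟨?_, ?_⟩
      · rw [hyz, Metric.mem_closedBall, dist_eq_norm, add_sub_cancel_left, norm_smul,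
          Real.norm_of_nonneg ht0.le, ← dist_eq_norm]
        calc t * dist _ p ≤ t * size T := by gcongr; exact dist_le_size hz hph
          _ = r0 := by rw [ht]; field_simp
      · rw [hyz]
        exact (convex_convexHull ℝ _).add_smul_sub_mem hph hz ⟨ht0.le, ht1⟩
    rw [Measure.restrict_apply Metric.isClosed_closedBall.measurableSet]
    refine le_trans ?_ (measure_mono hsub)
    rw [← ENNReal.ofReal_toReal (measure_closedBall_lt_top (μ := (volume : Measure E))).ne]
    refine ENNReal.ofReal_le_ofReal ?_
    have := measureReal_closedBall (p + t • (c - p)) (mul_pos ht0 hr).le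
    rw [Measure.real] at this
    rw [this]
    refine mul_le_mul_of_nonneg_right (pow_le_pow_left₀ (by positivity) ?_ 2) discArea_pos.le
    rw [ht, div_mul_eq_mul_div, div_le_div_iff₀ hρ0 hs]
    have h' : size T ≤ ρ * r := h
    nlinarith
  have hsum := Finset.sum_le_sum key
  have hle : ∑ T ∈ M.elemsAt {p}, (volume : Measure E).restrict (hull T) (Metric.closedBall p r0) ≤
      volume (Metric.closedBall p r0) := by
    rw [← Measure.finsetSum_apply, ← restrict_biUnion (elemsAt_subset _)]
    exact Measure.restrict_apply_le _ _
  have h := hsum.trans hle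
  rw [Finset.sum_const, nsmul_eq_mul, ← ENNReal.ofReal_toReal (measure_closedBall_lt_top
    (μ := (volume : Measure E)) (x := p) (r := r0)).ne, ← ENNReal.ofReal_natCast,
    ← ENNReal.ofReal_mul (by positivity), ENNReal.ofReal_le_ofReal_iff ENNReal.toReal_nonneg] at h
  have h2 := measureReal_closedBall p hr0.le
  rw [Measure.real] at h2
  rw [h2, div_pow] at h
  have hd := discArea_pos
  have hx : 0 < r0 ^ 2 * discArea := by positivity
  refine le_of_mul_le_mul_right ?_ hx
  calc _ = ((M.elemsAt {p}).card : ℝ) * (r0 ^ 2 / ρ ^ 2 * discArea) * ρ ^ 2 := by field_simp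
    _ ≤ r0 ^ 2 * discArea * ρ ^ 2 := by gcongr
    _ = _ := by ring

/-- A bound for the number of elements at a node. -/
def maxElems (ρ : ℝ) : ℕ := ⌊ρ ^ 2⌋₊

theorem ShapeRegular.card_le {ρ : ℝ} (hρ : M.ShapeRegular ρ) {p : E} (hp : p ∈ M.nodes) :
    (M.elemsAt {p}).card ≤ maxElems ρ := Nat.le_floor (hρ.card_elemsAt_le hp)

theorem ShapeRegular.exists_walk {ρ : ℝ} (hρ : M.ShapeRegular ρ) (hΩ : IsPolygonalDomain Ω) {p : E}
    (hp : p ∈ M.nodes) (T T' : {T // T ∈ M.elemsAt {p}}) :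
    ∃ w : (M.nodeGraph p).Walk T T', w.length ≤ maxElems ρ := by
  obtain ⟨w, hw⟩ := exists_short_walk (nodeGraph_preconnected hΩ hp) T T'
  refine ⟨w, hw.trans ?_⟩
  rw [Fintype.card_coe]
  exact hρ.card_le hp

theorem size_le_diamPatch {p : E} {T : Finset E} (hT : T ∈ M.elemsAt {p}) : size T ≤ M.diamPatch p := by
  rw [diamPatch, ← Metric.diam_closure]
  refine Metric.diam_mono (hull_subset_closure_patch hT) ?_
  exact (isBounded_patch _).closure

/-- Along a walk between elements the diameter changes by at most the factor `sizeRatio ρ` per step,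
and there are at most `maxElems ρ` steps. The 2 converts the radius of a ball around `p` into a
diameter. -/
theorem ShapeRegular.diamPatch_le {ρ : ℝ} (hρ : M.ShapeRegular ρ) (hΩ : IsPolygonalDomain Ω) {p : E}
    (hp : p ∈ M.nodes) {T : Finset E} (hT : T ∈ M.elemsAt {p}) :
    M.diamPatch p ≤ 2 * sizeRatio ρ ^ maxElems ρ * size T := by
  have h1 : 1 ≤ sizeRatio ρ := le_max_left _ _
  have hall : ∀ T' ∈ M.elemsAt {p}, size T' ≤ sizeRatio ρ ^ maxElems ρ * size T := by
    intro T' hT'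
    obtain ⟨w, hw⟩ := hρ.exists_walk hΩ hp ⟨T', hT'⟩ ⟨T, hT⟩
    have := le_pow_mul_of_walk (f := fun T : {T // T ∈ M.elemsAt {p}} => size T.1) h1 (fun u v huv => by
        obtain ⟨_, s, _, b, c, d⟩ := huv
        exact hρ.size_le (elemsAt_subset _ u.2) (elemsAt_subset _ v.2) b c d) w
    refine this.trans ?_
    have := (size_pos (M.tri (elemsAt_subset _ hT))).le
    gcongr
  have hsz := (size_pos (M.tri (elemsAt_subset _ hT))).le
  have hball : M.patch {p} ⊆ Metric.closedBall p (sizeRatio ρ ^ maxElems ρ * size T) := by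
    intro x hx
    obtain ⟨T', hT', hxT'⟩ := Set.mem_iUnion₂.mp (patch_subset_biUnion _ hx)
    exact (dist_le_size hxT' (subset_convexHull ℝ _ (mem_elemsAt_singleton.mp hT').2)).trans (hall T' hT')
  rw [diamPatch, mul_assoc]
  exact (Metric.diam_mono hball Metric.isBounded_closedBall).trans (Metric.diam_closedBall (by positivity))

/-- The area of an element at `p` is at least `areaRatio ρ * h_p ^ 2`. -/
def areaRatio (ρ : ℝ) : ℝ := discArea / (ρ * (2 * sizeRatio ρ ^ maxElems ρ)) ^ 2

theorem areaRatio_pos {ρ : ℝ} (hρ : 0 < ρ) : 0 < areaRatio ρ := by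
  have := discArea_pos
  have h1 : 0 < sizeRatio ρ := one_pos.trans_le (le_max_left _ _)
  unfold areaRatio
  positivity

theorem ShapeRegular.areaRatio_mul_le {ρ : ℝ} (hρ : M.ShapeRegular ρ) (hΩ : IsPolygonalDomain Ω) {p : E}
    (hp : p ∈ M.nodes) {T : Finset E} (hT : T ∈ M.elemsAt {p}) :
    areaRatio ρ * M.diamPatch p ^ 2 ≤ area T := by
  have hTe := elemsAt_subset _ hT
  have hρ0 := hρ.pos hTe
  have h1 : 0 < sizeRatio ρ := one_pos.trans_le (le_max_left _ _)
  have hd := discArea_pos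
  have h2 := hρ.diamPatch_le hΩ hp hT
  have h0 : 0 ≤ M.diamPatch p := Metric.diam_nonneg
  rw [areaRatio, div_mul_eq_mul_div, div_le_iff₀ (by positivity)]
  calc discArea * M.diamPatch p ^ 2 ≤ discArea * (2 * sizeRatio ρ ^ maxElems ρ * size T) ^ 2 := by gcongr
    _ = discArea * size T ^ 2 * (2 * sizeRatio ρ ^ maxElems ρ) ^ 2 := by ring
    _ ≤ ρ ^ 2 * area T * (2 * sizeRatio ρ ^ maxElems ρ) ^ 2 :=
      mul_le_mul_of_nonneg_right (hρ.area_ge hTe) (sq_nonneg _)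
    _ = _ := by ring

theorem diamPatch_pos {p : E} (hp : p ∈ M.nodes) : 0 < M.diamPatch p := by
  obtain ⟨T, hT, hpT⟩ := M.mem_nodes.mp hp
  exact (size_pos (M.tri hT)).trans_le (size_le_diamPatch (mem_elemsAt_singleton.mpr ⟨hT, hpT⟩))

end Triangulation

/-! ### Weighted means on patches -/

/-- The square of a sum of nonnegative numbers dominates the sum of their squares. -/
theorem l2n_finset_sum_le {α ι F : Type*} [MeasurableSpace α] [NormedAddCommGroup F]
    [InnerProductSpace ℝ F] {S : Finset ι} {μ : ι → Measure α} {f : α → F}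
    (hf : ∀ i ∈ S, MemLp f 2 (μ i)) : l2n (∑ i ∈ S, μ i) f ≤ ∑ i ∈ S, l2n (μ i) f := by
  refine abs_le_of_sq_le_sq' ?_ (Finset.sum_nonneg fun i _ => l2n_nonneg _) |>.2
  rw [l2n_sq (memLp_finset_sum_measure.mpr hf),
    integral_finsetSum_measure fun i hi => (hf i hi).norm.integrable_sq]
  refine le_trans (Finset.sum_le_sum fun i hi => (l2n_sq (hf i hi)).ge) ?_
  rw [sq, Finset.sum_mul]
  refine Finset.sum_le_sum fun i hi => ?_
  rw [sq]
  exact mul_le_mul_of_nonneg_left (Finset.single_le_sum (f := fun i => l2n (μ i) f)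
    (fun i _ => l2n_nonneg _) hi) (l2n_nonneg _)

namespace Triangulation

variable {Ω : Set E} {M : Triangulation Ω}

theorem isOpen_smallPatch (p : E) : IsOpen (M.smallPatch p) :=
  AffineMap.homothety_isOpenMap p (1 / 4 : ℝ) (by norm_num) _ (isOpen_patch _)

/-- The homothety with ratio `1 / 4` sends a coordinate `λ` at `p` to `1 + (λ - 1) / 4`, which is at
least `3 / 4`. -/
theorem exists_of_mem_smallPatch {p x : E} (hx : x ∈ M.smallPatch p) :
    ∃ T ∈ M.elemsAt {p}, x ∈ hull T ∧ 3 / 4 ≤ bary T p x := by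
  obtain ⟨y, hy, rfl⟩ := hx
  obtain ⟨T, hT, hyT⟩ := Set.mem_iUnion₂.mp (patch_subset_biUnion _ hy)
  obtain ⟨hTe, hpT⟩ := mem_elemsAt_singleton.mp hT
  have heq : AffineMap.homothety p (1 / 4 : ℝ) y = p + (1 / 4 : ℝ) • (y - p) := by
    rw [AffineMap.homothety_apply, vsub_eq_sub, vadd_eq_add, add_comm]
  refine ⟨T, hT, ?_, ?_⟩
  · rw [heq]
    exact (convex_convexHull ℝ _).add_smul_sub_mem (subset_convexHull ℝ _ hpT) hyT ⟨by norm_num, by norm_num⟩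
  · rw [heq, affine_add_smul_sub, (M.tri hTe).bary_self hpT]
    have := bary_nonneg hTe hyT p
    linarith

theorem smallPatch_subset (p : E) : M.smallPatch p ⊆ M.patch {p} := by
  refine interior_maximal (fun x hx => ?_) (isOpen_smallPatch p)
  obtain ⟨T, hT, hxT, -⟩ := exists_of_mem_smallPatch hx
  exact Set.mem_biUnion hT hxT

theorem hat_ge_of_mem_smallPatch {p x : E} (hx : x ∈ M.smallPatch p) : 3 / 4 ≤ M.hat p x := by
  obtain ⟨T, hT, hxT, h⟩ := exists_of_mem_smallPatch hx
  rwa [hat_eq (elemsAt_subset _ hT) hxT]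

theorem measureReal_smallPatch (p : E) :
    (volume : Measure E).real (M.smallPatch p) = volume.real (M.patch {p}) / 16 := by
  rw [smallPatch, Measure.real, Measure.addHaar_image_homothety, finrank_euclideanSpace_fin,
    ENNReal.toReal_mul, ENNReal.toReal_ofReal (abs_nonneg _), Measure.real]
  norm_num
  ring

instance isFiniteMeasure_patch (s : Finset E) : IsFiniteMeasure (volume.restrict (M.patch s)) :=
  ⟨by rw [Measure.restrict_apply_univ]; exact (isBounded_patch s).measure_lt_top⟩

instance isFiniteMeasure_smallPatch (p : E) : IsFiniteMeasure (volume.restrict (M.smallPatch p)) :=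
  ⟨by
    rw [Measure.restrict_apply_univ]
    exact ((isBounded_patch _).subset (smallPatch_subset p)).measure_lt_top⟩

theorem measureReal_patch_pos {p : E} (hp : p ∈ M.nodes) : 0 < (volume : Measure E).real (M.patch {p}) := by
  obtain ⟨T, hT, hpT⟩ := M.mem_nodes.mp hp
  refine ENNReal.toReal_pos ?_ (isBounded_patch _).measure_lt_top.ne
  exact (isOpen_patch _).measure_ne_zero _ ((M.tri hT).interior_nonempty.mono
    (interior_hull_subset_patch (mem_elemsAt_singleton.mpr ⟨hT, hpT⟩)))

theorem memLp_hat_patch (s : Finset E) (p : E) : MemLp (M.hat p) 2 (volume.restrict (M.patch s)) := by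
  rw [restrict_patch, memLp_finset_sum_measure]
  intro T hT
  obtain ⟨A, -, -, h, -⟩ := (isP1_hat (M := M) p).ae_eq (elemsAt_subset _ hT)
  exact (memLp_of_continuous (M.tri (elemsAt_subset _ hT)).isCompact_hull
    (contDiff_affine (n := 0) A).continuous).ae_eq h.symm

theorem restrict_smallPatch_le (p : E) :
    (volume : Measure E).restrict (M.smallPatch p) ≤ volume.restrict (M.patch {p}) :=
  Measure.restrict_mono (smallPatch_subset p) le_rfl

theorem memLp_hat_smallPatch (p : E) : MemLp (M.hat p) 2 (volume.restrict (M.smallPatch p)) :=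
  (memLp_hat_patch _ p).mono_measure (restrict_smallPatch_le p)

/-- The constant is `3 / 4`, the lower bound for `φ_p`, times `1 / 16`, the area ratio of the two
patches. -/
theorem integral_hat_smallPatch_ge (p : E) :
    3 / 64 * volume.real (M.patch {p}) ≤ ∫ x in M.smallPatch p, M.hat p x := by
  have h : ∫ x in M.smallPatch p, (3 / 4 : ℝ) ≤ ∫ x in M.smallPatch p, M.hat p x := by
    refine setIntegral_mono_on (integrable_const _) ((memLp_hat_smallPatch p).integrable (by norm_num))
      (isOpen_smallPatch p).measurableSet fun x hx => hat_ge_of_mem_smallPatch hx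
  rw [setIntegral_const, measureReal_smallPatch, smul_eq_mul] at h
  linarith

theorem integral_hat_patch_le (p : E) :
    ∫ x in M.patch {p}, M.hat p x ≤ volume.real (M.patch {p}) := by
  have h : ∫ x in M.patch {p}, M.hat p x ≤ ∫ x in M.patch {p}, (1 : ℝ) :=
    integral_mono ((memLp_hat_patch _ p).integrable (by norm_num)) (integrable_const _) fun x => hat_le_one p x
  simpa using h

theorem integral_hat_patch_pos {p : E} (hp : p ∈ M.nodes) : 0 < ∫ x in M.patch {p}, M.hat p x := by
  refine lt_of_lt_of_le (b := ∫ x in M.smallPatch p, M.hat p x) ?_ ?_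
  · have := integral_hat_smallPatch_ge (M := M) p
    have := measureReal_patch_pos hp
    linarith
  · exact setIntegral_mono_set ((memLp_hat_patch _ p).integrable (by norm_num))
      (Eventually.of_forall fun x => hat_nonneg p x) (smallPatch_subset p).eventuallyLE

/-- The mean of `ψ` on `ω̃_p`, weighted with `φ_p`. -/
def weightedMean (M : Triangulation Ω) (p : E) (ψ : E → ℝ) : ℝ :=
  (∫ x in M.smallPatch p, ψ x * M.hat p x) / ∫ x in M.smallPatch p, M.hat p x

/-- The weighted mean is a quasi-optimal constant approximation. -/
theorem l2n_sub_weightedMean_le {p : E} (hp : p ∈ M.nodes) {ψ : E → ℝ}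
    (hψ : MemLp ψ 2 (volume.restrict (M.patch {p}))) (a : ℝ) :
    l2n (volume.restrict (M.patch {p})) (fun x => ψ x - M.weightedMean p ψ) ≤
      19 / 3 * l2n (volume.restrict (M.patch {p})) (fun x => ψ x - a) := by
  set μ := (volume : Measure E).restrict (M.patch {p})
  set ν := (volume : Measure E).restrict (M.smallPatch p)
  set V := (volume : Measure E).real (M.patch {p}) with hV
  set I := ∫ x in M.smallPatch p, M.hat p x with hI
  set c := M.weightedMean p ψ with hc
  have hV0 : 0 < V := measureReal_patch_pos hp
  have hI0 : 3 / 64 * V ≤ I := integral_hat_smallPatch_ge p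
  have hIpos : 0 < I := by linarith
  have hψa : MemLp (fun x => ψ x - a) 2 μ := memLp_fun_sub hψ (memLp_const a)
  have hψa' := hψa.mono_measure (restrict_smallPatch_le p)
  have hX0 := l2n_nonneg (μ := μ) (fun x => ψ x - a)
  have hhat : l2n ν (M.hat p) ≤ √V / 4 := by
    have h1 : l2n ν (M.hat p) ≤ 1 * l2n ν (fun _ : E => (1 : ℝ)) :=
      l2n_mono (memLp_const 1) zero_le_one (Eventually.of_forall fun x => by
        rw [Real.norm_of_nonneg (hat_nonneg p x)]
        simpa using hat_le_one p x)
    rw [l2n_const, abs_one, one_mul, one_mul] at h1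
    have h2 : ν.real Set.univ = V / 16 := by
      rw [Measure.real, Measure.restrict_apply_univ]
      exact measureReal_smallPatch p
    rw [h2, show V / 16 = V / 4 ^ 2 by norm_num, Real.sqrt_div hV0.le, Real.sqrt_sq (by norm_num)] at h1
    exact h1
  have hdiff : a - c = -((∫ x, (ψ x - a) * M.hat p x ∂ν) / I) := by
    have i1 : Integrable (fun x => ψ x * M.hat p x) ν :=
      integrable_mul_of_memLp (hψ.mono_measure (restrict_smallPatch_le p)) (memLp_hat_smallPatch p)
    have i2 : Integrable (fun x => a * M.hat p x) ν :=
      ((memLp_hat_smallPatch p).integrable (by norm_num)).const_mul a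
    have : ∫ x, (ψ x - a) * M.hat p x ∂ν = (∫ x, ψ x * M.hat p x ∂ν) - a * I := by
      simp_rw [sub_mul]
      rw [integral_sub i1 i2, integral_const_mul]
    have hcI : c * I = ∫ x, ψ x * M.hat p x ∂ν := div_mul_cancel₀ _ hIpos.ne'
    rw [this, ← hcI]
    field_simp
    ring
  -- Here `16 / 3 = (1 / 4) / (3 / 64)`: the norm of `φ_p` on the small patch is at most `√V / 4`,
  -- and its integral is at least `3 / 64 * V`. Adding the direct distance to `a` gives the constant
  -- `19 / 3`.
  have habs : |a - c| * √V ≤ 16 / 3 * l2n μ (fun x => ψ x - a) := by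
    have h1 := abs_integral_mul_le hψa' (memLp_hat_smallPatch (M := M) p)
    have h2 := l2n_mono_measure (restrict_smallPatch_le (M := M) p) hψa
    have h3 : |∫ x, (ψ x - a) * M.hat p x ∂ν| ≤ l2n μ (fun x => ψ x - a) * (√V / 4) :=
      h1.trans (mul_le_mul h2 hhat (l2n_nonneg _) hX0)
    rw [hdiff, abs_neg, abs_div, abs_of_pos hIpos, div_mul_eq_mul_div, div_le_iff₀ hIpos]
    have hsq : √V * √V = V := Real.mul_self_sqrt hV0.le
    have hs0 := Real.sqrt_nonneg V
    calc _ ≤ l2n μ (fun x => ψ x - a) * (√V / 4) * √V := by gcongr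
      _ = l2n μ (fun x => ψ x - a) / 4 * (√V * √V) := by ring
      _ = l2n μ (fun x => ψ x - a) / 4 * V := by rw [hsq]
      _ ≤ 16 / 3 * l2n μ (fun x => ψ x - a) * I := by nlinarith
  have heq : (fun x => ψ x - c) = fun x => (ψ x - a) + (a - c) := by ext x; ring
  rw [heq]
  refine (l2n_add_le hψa (memLp_const (a - c))).trans ?_
  have : l2n μ (fun _ : E => a - c) = |a - c| * √V := by
    rw [l2n_const, Measure.real, Measure.restrict_apply_univ]
    rfl
  linarith

/-! ### The Poincaré inequality on patches -/

/-- The moment identity with constant weight writes the difference of the two means as the integral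
of `(x - P) · G` over `2 * area T`; Cauchy–Schwarz and the area bound finish. The side mean is the
same for both neighbours, so it links their element means. -/
theorem abs_avg_sub_le {T s : Finset E} {P : E} (h : IsOpp T s P) {ψ g : E → ℝ} {G : E → E}
    (hG : MemLp G 2 (volume.restrict (hull T))) (hg : SideMoments T s P ψ G g) {d : ℝ}
    (hd : size T ≤ d) {a : ℝ} (ha0 : 0 < a) (ha : a * d ^ 2 ≤ area T) :
    |avg (hull T) ψ - (∫ x, g x ∂(sideMeasure s)) / len s| ≤
      (2 * √a)⁻¹ * l2n (volume.restrict (hull T)) G := by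
  have hA : 0 < area T := h.tri.area_pos
  have hl := len_pos h.card
  have hd0 : 0 < d := (size_pos h.tri).trans_le hd
  have hfin : IsFiniteMeasure (volume.restrict (hull T)) :=
    ⟨by rw [Measure.restrict_apply_univ]; exact h.tri.isCompact_hull.measure_lt_top⟩
  have h1 := hg (fun _ => 1) contDiff_const
  have h0 : gradient (fun _ : E => (1 : ℝ)) = fun _ => 0 := by
    ext1 x
    simp [gradient]
  simp only [h0, mul_one, inner_zero_left, add_zero, one_smul] at h1
  rw [integral_mul_const] at h1
  have heq : avg (hull T) ψ - (∫ x, g x ∂(sideMeasure s)) / len s =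
      -((∫ x in hull T, (inner ℝ (x - P) (G x) : ℝ)) / (2 * area T)) := by
    have hA' : area T = volume.real (hull T) := rfl
    rw [h1, avg, ← hA']
    field_simp
    ring
  have hlin : MemLp (fun x : E => x - P) 2 (volume.restrict (hull T)) :=
    memLp_of_continuous h.tri.isCompact_hull (by fun_prop)
  have h2 := abs_integral_inner_le hlin hG
  have h3 : l2n (volume.restrict (hull T)) (fun x : E => x - P) ≤ d * √(area T) := by
    have h4 : l2n (volume.restrict (hull T)) (fun x : E => x - P) ≤
        d * l2n (volume.restrict (hull T)) (fun _ : E => (1 : ℝ)) := by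
      refine l2n_mono (memLp_const 1) hd0.le ?_
      filter_upwards [ae_restrict_mem h.tri.measurableSet_hull] with x hx
      rw [norm_one, mul_one, ← dist_eq_norm]
      exact (dist_le_size hx (subset_convexHull ℝ _ h.mem)).trans hd
    rw [l2n_const, abs_one, one_mul, Measure.real, Measure.restrict_apply_univ] at h4
    exact h4
  have hsA : √a * d ≤ √(area T) := by
    rw [← Real.sqrt_sq hd0.le, ← Real.sqrt_mul ha0.le]
    exact Real.sqrt_le_sqrt ha
  have hsa : 0 < √a := Real.sqrt_pos.mpr ha0
  have hX := l2n_nonneg (μ := volume.restrict (hull T)) G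
  rw [heq, abs_neg, abs_div, abs_of_pos (by positivity : 0 < 2 * area T), div_le_iff₀ (by positivity)]
  have hA2 : √(area T) * √(area T) = area T := Real.mul_self_sqrt hA.le
  have hsA0 := Real.sqrt_nonneg (area T)
  calc _ ≤ d * √(area T) * l2n (volume.restrict (hull T)) G :=
        h2.trans (mul_le_mul_of_nonneg_right h3 hX)
    _ = (√a)⁻¹ * l2n (volume.restrict (hull T)) G * √(area T) * (√a * d) := by field_simp
    _ ≤ (√a)⁻¹ * l2n (volume.restrict (hull T)) G * √(area T) * √(area T) := by gcongr
    _ = _ := by rw [mul_assoc _ (√(area T)), hA2]; field_simp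

/-- The constant in the Poincaré inequality on patches. -/
def poincareConst (ρ : ℝ) : ℝ := 19 / 3 * (maxElems ρ * (2 + maxElems ρ * (√(areaRatio ρ))⁻¹))

theorem poincareConst_nonneg (ρ : ℝ) : 0 ≤ poincareConst ρ := by
  unfold poincareConst
  positivity

theorem restrict_patch_le (hΩ : IsPolygonalDomain Ω) (s : Finset E) :
    (volume : Measure E).restrict (M.patch s) ≤ volume.restrict Ω :=
  Measure.restrict_mono (patch_subset hΩ _) le_rfl

variable {ρ : ℝ} (hρ : M.ShapeRegular ρ) (hΩ : IsPolygonalDomain Ω) {p : E} (hp : p ∈ M.nodes)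
  {ψ : E → ℝ} (hψ : MemH1 Ω ψ)
include hρ hΩ hp hψ

/-- Adjacent elements are compared through the mean over their common side, at half the constant
each; a walk of at most `maxElems ρ` steps connects the rest. -/
theorem abs_avg_sub_avg_le {T T' : Finset E} (hT : T ∈ M.elemsAt {p}) (hT' : T' ∈ M.elemsAt {p}) :
    |avg (hull T) ψ - avg (hull T') ψ| ≤
      maxElems ρ * ((√(areaRatio ρ))⁻¹ * l2n (volume.restrict (M.patch {p})) (weakGrad Ω ψ)) := by
  have hGΩ := hψ.hasL2WeakGrad.1
  have hG := hGΩ.mono_measure (restrict_patch_le (M := M) hΩ {p})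
  have ha := areaRatio_pos (hρ.pos (elemsAt_subset _ hT))
  have hone : ∀ s : Finset E, ∀ T ∈ M.elemsAt {p}, s ⊆ T → s.card = 2 →
      |avg (hull T) ψ - (∫ x, trace (M.patch s) s ψ x ∂(sideMeasure s)) / len s| ≤
        (2 * √(areaRatio ρ))⁻¹ * l2n (volume.restrict (M.patch {p})) (weakGrad Ω ψ) := by
    intro s T hT hsT hs
    have hTe := elemsAt_subset _ hT
    obtain ⟨P, ho⟩ := (M.tri hTe).exists_opp hsT hs
    have hle := restrict_hull_le_patch hT
    refine (abs_avg_sub_le ho (hG.mono_measure hle) (hasSideTraces hΩ hψ s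
      (M.mem_sides.mpr ⟨T, hTe, hsT, hs⟩) T (M.mem_elemsAt.mpr ⟨hTe, hsT⟩) P ho)
      (size_le_diamPatch hT) ha (hρ.areaRatio_mul_le hΩ hp hT)).trans ?_
    gcongr
    exact l2n_mono_measure hle hG
  obtain ⟨w, hw⟩ := hρ.exists_walk hΩ hp ⟨T, hT⟩ ⟨T', hT'⟩
  refine (abs_sub_le_of_walk (f := fun T : {T // T ∈ M.elemsAt {p}} => avg (hull T.1) ψ)
    (K := (√(areaRatio ρ))⁻¹ * l2n (volume.restrict (M.patch {p})) (weakGrad Ω ψ)) (fun u v huv => ?_)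
    w).trans ?_
  · obtain ⟨_, s, -, hs, hsu, hsv⟩ := huv
    have h1 := hone s u.1 u.2 hsu hs
    have h2 := hone s v.1 v.2 hsv hs
    rw [abs_sub_comm] at h2
    refine (abs_sub_le _ ((∫ x, trace (M.patch s) s ψ x ∂(sideMeasure s)) / len s) _).trans ?_
    have : (√(areaRatio ρ))⁻¹ = (2 * √(areaRatio ρ))⁻¹ + (2 * √(areaRatio ρ))⁻¹ := by
      rw [mul_inv]; ring
    rw [this, add_mul]
    exact add_le_add h1 h2
  · have := l2n_nonneg (μ := volume.restrict (M.patch {p})) (weakGrad Ω ψ)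
    gcongr

/-- By quasi-optimality the weighted mean may be replaced by the mean over one fixed element. On
every other element the convex Poincaré inequality handles the deviation from its own mean, and the
chain of side means handles the difference of the two means. Summing costs the number of elements.
-/
theorem poincare_patch : l2n (volume.restrict (M.patch {p})) (fun x => ψ x - M.weightedMean p ψ) ≤
    poincareConst ρ * M.diamPatch p * l2n (volume.restrict (M.patch {p})) (weakGrad Ω ψ) := by
  obtain ⟨T0, hT0e, hpT0⟩ := M.mem_nodes.mp hp
  have hT0 : T0 ∈ M.elemsAt {p} := mem_elemsAt_singleton.mpr ⟨hT0e, hpT0⟩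
  set μ := (volume : Measure E).restrict (M.patch {p}) with hμ
  set X := l2n μ (weakGrad Ω ψ) with hX
  set d := M.diamPatch p
  have hX0 : 0 ≤ X := l2n_nonneg _
  have hd0 : 0 < d := diamPatch_pos hp
  have hψp := hψ.1.mono_measure (restrict_patch_le (M := M) hΩ {p})
  have hGp := hψ.hasL2WeakGrad.1.mono_measure (restrict_patch_le (M := M) hΩ {p})
  refine (l2n_sub_weightedMean_le hp hψp (avg (hull T0) ψ)).trans ?_
  have hmem : MemLp (fun x => ψ x - avg (hull T0) ψ) 2 μ := memLp_fun_sub hψp (memLp_const _)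
  have hT : ∀ T ∈ M.elemsAt {p}, l2n (volume.restrict (hull T)) (fun x => ψ x - avg (hull T0) ψ) ≤
      (2 + maxElems ρ * (√(areaRatio ρ))⁻¹) * d * X := by
    intro T hT
    have hTe := elemsAt_subset _ hT
    have hle := restrict_hull_le_patch hT
    have hfin : IsFiniteMeasure (volume.restrict (hull T)) :=
      ⟨by rw [Measure.restrict_apply_univ]; exact (M.tri hTe).isCompact_hull.measure_lt_top⟩
    obtain ⟨s, hs, hc⟩ := Finset.exists_subset_card_eq (by rw [(M.tri hTe).1]; norm_num : 2 ≤ T.card)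
    obtain ⟨P, ho⟩ := (M.tri hTe).exists_opp hs hc
    obtain ⟨f, hf, h1, h2, -⟩ := exists_approx hΩ hψ (M.mem_sides.mpr ⟨T, hTe, hs, hc⟩)
      (M.mem_elemsAt.mpr ⟨hTe, hs⟩)
    have hP := ho.poincare_of_tendsto hf (hψp.mono_measure hle) (hGp.mono_measure hle) h1 h2
      (d := size T) fun x hx y hy => by rw [← dist_eq_norm]; exact dist_le_size hy hx
    have hsz := size_le_diamPatch hT
    have hGle := l2n_mono_measure hle hGp
    -- Twice the area is at most side times diameter, hence at most `2 * d ^ 2`.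
    have hA : √(area T) ≤ d := by
      rw [Real.sqrt_le_left hd0.le]
      have := two_area_le ho
      have := len_le_size ho
      have := (size_pos (M.tri hTe)).le
      have : 0 < area T := (M.tri hTe).area_pos
      nlinarith
    have heq : (fun x => ψ x - avg (hull T0) ψ) =
        fun x => (ψ x - avg (hull T) ψ) + (avg (hull T) ψ - avg (hull T0) ψ) := by ext x; ring
    rw [heq]
    refine (l2n_add_le (memLp_fun_sub (hψp.mono_measure hle) (memLp_const _)) (memLp_const _)).trans ?_
    have hconst : l2n (volume.restrict (hull T)) (fun _ : E => avg (hull T) ψ - avg (hull T0) ψ) =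
        |avg (hull T) ψ - avg (hull T0) ψ| * √(area T) := by
      rw [l2n_const, Measure.real, Measure.restrict_apply_univ]
      rfl
    rw [hconst]
    have hP' : 2 * size T * l2n (volume.restrict (hull T)) (weakGrad Ω ψ) ≤ 2 * d * X := by
      have := l2n_nonneg (μ := volume.restrict (hull T)) (weakGrad Ω ψ)
      gcongr
    have hc' : |avg (hull T) ψ - avg (hull T0) ψ| * √(area T) ≤
        maxElems ρ * ((√(areaRatio ρ))⁻¹ * X) * d :=
      mul_le_mul (abs_avg_sub_avg_le hρ hΩ hp hψ hT hT0) hA (Real.sqrt_nonneg _) (by positivity)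
    calc _ ≤ 2 * d * X + maxElems ρ * ((√(areaRatio ρ))⁻¹ * X) * d := add_le_add (hP.trans hP') hc'
      _ = _ := by ring
  have hsum : l2n μ (fun x => ψ x - avg (hull T0) ψ) ≤
      maxElems ρ * ((2 + maxElems ρ * (√(areaRatio ρ))⁻¹) * d * X) := by
    rw [hμ, restrict_patch]
    rw [hμ, restrict_patch] at hmem
    refine (l2n_finset_sum_le (memLp_finset_sum_measure.mp hmem)).trans ?_
    refine (Finset.sum_le_card_nsmul _ _ _ hT).trans ?_
    rw [nsmul_eq_mul]
    have := hρ.card_le hp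
    gcongr
  calc _ ≤ 19 / 3 * (maxElems ρ * ((2 + maxElems ρ * (√(areaRatio ρ))⁻¹) * d * X)) := by gcongr
    _ = _ := by rw [poincareConst]; ring

/-- In the trace inequality `x ^ 2 + d x y`, one factor `x` of the square is replaced by its
Poincaré bound. The result is purely multiplicative and free of the mesh size, which later yields
the square root of the weight on sides. -/
theorem trace_patch {s : Finset E} (hs : s ∈ M.sides) (hps : p ∈ s) :
    l2n (sideMeasure s) (fun x => trace (M.patch s) s ψ x - M.weightedMean p ψ) ^ 2 ≤
      (poincareConst ρ + 1) / areaRatio ρ *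
        (l2n (volume.restrict (M.patch {p})) (fun x => ψ x - M.weightedMean p ψ) *
          l2n (volume.restrict (M.patch {p})) (weakGrad Ω ψ)) := by
  obtain ⟨T, hTe, hsT, hc⟩ := M.mem_sides.mp hs
  obtain ⟨P, ho⟩ := (M.tri hTe).exists_opp hsT hc
  have hT : T ∈ M.elemsAt {p} := mem_elemsAt_singleton.mpr ⟨hTe, hsT hps⟩
  have hTs : T ∈ M.elemsAt s := M.mem_elemsAt.mpr ⟨hTe, hsT⟩
  obtain ⟨f, hf, h1, h2, h3⟩ := exists_approx hΩ hψ hs hTs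
  have hle := restrict_hull_le_patch hT
  have hψp := hψ.1.mono_measure (restrict_patch_le (M := M) hΩ {p})
  have hGp := hψ.hasL2WeakGrad.1.mono_measure (restrict_patch_le (M := M) hΩ {p})
  set d := M.diamPatch p
  have hd0 : 0 < d := diamPatch_pos hp
  have ha := areaRatio_pos (hρ.pos hTe)
  have hA := hρ.areaRatio_mul_le hΩ hp hT
  set c := M.weightedMean p ψ
  have key := ho.trace_ineq_of_tendsto hf (hψp.mono_measure hle) (hGp.mono_measure hle) h1 h2
    (isTrace_trace hΩ hψ hs).1 h3 (d := d) (fun x hx => by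
      rw [← dist_eq_norm]
      exact (dist_le_size hx (subset_convexHull ℝ _ ho.mem)).trans (size_le_diamPatch hT)) c
  refine key.trans ?_
  set x := l2n (volume.restrict (M.patch {p})) (fun x => ψ x - c) with hx
  set y := l2n (volume.restrict (M.patch {p})) (weakGrad Ω ψ) with hy
  have hx1 : l2n (volume.restrict (hull T)) (fun x => ψ x - c) ≤ x :=
    l2n_mono_measure hle (memLp_fun_sub hψp (memLp_const _))
  have hy1 : l2n (volume.restrict (hull T)) (weakGrad Ω ψ) ≤ y := l2n_mono_measure hle hGp
  have hx2 := l2n_nonneg (μ := volume.restrict (hull T)) (fun x => ψ x - c)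
  have hy2 := l2n_nonneg (μ := volume.restrict (hull T)) (weakGrad Ω ψ)
  have hx0 : 0 ≤ x := hx2.trans hx1
  have hy0 : 0 ≤ y := hy2.trans hy1
  have hP : x ≤ poincareConst ρ * d * y := poincare_patch hρ hΩ hp hψ
  have hratio : len s / area T ≤ 1 / (areaRatio ρ * d) := by
    have hAp : 0 < area T := (M.tri hTe).area_pos
    rw [div_le_div_iff₀ hAp (by positivity), one_mul]
    have hl : len s ≤ d := (len_le_size ho).trans (size_le_diamPatch hT)
    calc len s * (areaRatio ρ * d) ≤ d * (areaRatio ρ * d) := by gcongr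
      _ = areaRatio ρ * d ^ 2 := by ring
      _ ≤ _ := hA
  calc _ ≤ 1 / (areaRatio ρ * d) * (x ^ 2 + d * x * y) := by gcongr
    _ ≤ 1 / (areaRatio ρ * d) * (x * (poincareConst ρ * d * y) + d * x * y) := by
        rw [sq x]
        gcongr
    _ = _ := by field_simp

end Triangulation

/-! ### The reaction coefficient -/

theorem frob_eq_trace (A B : Matrix (Fin 2) (Fin 2) ℝ) : frob A B = (A * B.transpose).trace := by
  simp [frob, Matrix.trace, Matrix.mul_apply]

/-- Both matrices are diagonal in the same orthonormal basis, so the product is the sum of `max λ 0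
* λ` over the eigenvalues. -/
theorem frob_strainPos_nonneg (u : E → E) (x : E) : 0 ≤ frob (strainPos u x) (strain u x) := by
  have hA := strain_isHermitian u x
  set Q : Matrix (Fin 2) (Fin 2) ℝ := (hA.eigenvectorUnitary : Matrix (Fin 2) (Fin 2) ℝ) with hQ
  have hQQ : Q.transpose * Q = 1 := by
    have := (Matrix.mem_unitaryGroup_iff'.mp hA.eigenvectorUnitary.2)
    rwa [Matrix.star_eq_conjTranspose, Matrix.conjTranspose_eq_transpose_of_trivial] at this
  have hS : strain u x = Q * Matrix.diagonal hA.eigenvalues * Q.transpose := by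
    conv_lhs => rw [hA.spectral_theorem, Unitary.conjStarAlgAut_apply,
      Matrix.star_eq_conjTranspose, Matrix.conjTranspose_eq_transpose_of_trivial]
    rfl
  have hP : strainPos u x = Q * Matrix.diagonal (fun i => max (hA.eigenvalues i) 0) * Q.transpose := rfl
  have hsym : (strain u x).transpose = strain u x := by
    rw [← Matrix.conjTranspose_eq_transpose_of_trivial]
    exact hA
  rw [frob_eq_trace, hsym, hP, (congrArg (fun B => (Q * Matrix.diagonal
    (fun i => max (hA.eigenvalues i) 0) * Q.transpose * B).trace) hS :)]
  rw [show Q * Matrix.diagonal (fun i => max (hA.eigenvalues i) 0) * Q.transpose *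
      (Q * Matrix.diagonal hA.eigenvalues * Q.transpose) =
      Q * (Matrix.diagonal (fun i => max (hA.eigenvalues i) 0) * (Q.transpose * Q) *
        Matrix.diagonal hA.eigenvalues * Q.transpose) by simp only [Matrix.mul_assoc],
    hQQ, Matrix.mul_one, Matrix.trace_mul_comm, Matrix.mul_assoc, hQQ, Matrix.mul_one,
    Matrix.diagonal_mul_diagonal, Matrix.trace_diagonal]
  refine Finset.sum_nonneg fun i _ => ?_
  rcases le_total (hA.eigenvalues i) 0 with h | h
  · rw [max_eq_right h, zero_mul]
  · rw [max_eq_left h]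
    exact mul_self_nonneg _

/-- The eigenbasis is chosen as a function of the matrix and a proof of symmetry. The matrices are
generalized first, so that their equality can be substituted into this dependent expression. -/
theorem strainPos_congr {u : E → E} {x y : E} (h : strain u x = strain u y) :
    strainPos u x = strainPos u y := by
  have key : ∀ (A B : Matrix (Fin 2) (Fin 2) ℝ) (hA : A.IsHermitian) (hB : B.IsHermitian), A = B →
      (hA.eigenvectorUnitary : Matrix (Fin 2) (Fin 2) ℝ) *
        Matrix.diagonal (fun i => max (hA.eigenvalues i) 0) *
        (hA.eigenvectorUnitary : Matrix (Fin 2) (Fin 2) ℝ).transpose =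
      (hB.eigenvectorUnitary : Matrix (Fin 2) (Fin 2) ℝ) *
        Matrix.diagonal (fun i => max (hB.eigenvalues i) 0) *
        (hB.eigenvectorUnitary : Matrix (Fin 2) (Fin 2) ℝ).transpose := by
    rintro A _ hA hB rfl
    rfl
  exact key _ _ _ _ h

theorem hasFDerivAt_affine {V : Type*} [NormedAddCommGroup V] [NormedSpace ℝ V] (A : E →ᵃ[ℝ] V) (x : E) :
    HasFDerivAt A (LinearMap.toContinuousLinearMap A.linear) x := by
  have heq : (A : E → V) = fun y => LinearMap.toContinuousLinearMap A.linear y + A 0 := by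
    ext1 y
    exact congrFun A.decomp y
  conv => enter [1]; rw [heq]
  exact (ContinuousLinearMap.hasFDerivAt _).add_const _

namespace Step

variable {Ω : Set E} {D : Step Ω}

/-- The standing assumptions on the data. -/
structure IsAdmissible (D : Step Ω) : Prop where
  domain : IsPolygonalDomain Ω
  Gc_pos : 0 < D.Gc
  eps_pos : 0 < D.eps
  kappa_lt : D.kappa < 1
  mu_pos : 0 < D.mu
  lam_pos : 0 < D.lam
  isP1_uh : D.mesh.IsP1 D.uh
  isP1_phih : D.mesh.IsP1 D.phih

namespace IsAdmissible

variable (h : D.IsAdmissible)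
include h

theorem tensile_nonneg (x : E) : 0 ≤ D.tensile x := by
  have heq : D.tensile x = 2 * D.mu * frob (strainPos D.uh x) (strain D.uh x) +
      D.lam * (max 0 (strain D.uh x).trace * (strain D.uh x).trace) := by
    simp [tensile, stressPos, frob, Matrix.trace, Fin.sum_univ_two]
    ring
  have h1 := frob_strainPos_nonneg D.uh x
  have h2 : 0 ≤ max 0 (strain D.uh x).trace * (strain D.uh x).trace := by
    rcases le_total (strain D.uh x).trace 0 with hx | hx
    · rw [max_eq_left hx, zero_mul]
    · rw [max_eq_right hx]
      exact mul_self_nonneg _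
  have := h.mu_pos
  have := h.lam_pos
  rw [heq]
  positivity

theorem ratio_pos : 0 < D.Gc / D.eps := div_pos h.Gc_pos h.eps_pos

theorem diffusion_pos : 0 < D.Gc * D.eps := mul_pos h.Gc_pos h.eps_pos

theorem ratio_le_coeff (x : E) : D.Gc / D.eps ≤ D.coeff x :=
  le_add_of_nonneg_right (mul_nonneg (sub_nonneg.mpr h.kappa_lt.le) (h.tensile_nonneg x))

theorem coeff_pos (x : E) : 0 < D.coeff x := h.ratio_pos.trans_le (h.ratio_le_coeff x)

/-- The displacement is affine on the element, so its strain, and everything computed from it, is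
constant inside. -/
theorem coeff_eq {T : Finset E} (hT : T ∈ D.mesh.elems) {x : E} (hx : x ∈ interior (hull T)) :
    D.coeff x = D.coeff (barycentre T) := by
  obtain ⟨A, hA⟩ := h.isP1_uh.2 T hT
  have hd : ∀ y ∈ interior (hull T), fderiv ℝ D.uh y = LinearMap.toContinuousLinearMap A.linear := by
    intro y hy
    have hev : D.uh =ᶠ[𝓝 y] A := by
      filter_upwards [mem_interior_iff_mem_nhds.mp hy] with z hz
      exact hA hz
    rw [hev.fderiv_eq]
    exact (hasFDerivAt_affine A _).fderiv
  have hs : strain D.uh x = strain D.uh (barycentre T) := by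
    simp only [strain, hd x hx, hd _ (Triangulation.tri D.mesh hT).barycentre_mem]
  simp only [coeff, tensile, stressPos, strainPos_congr hs, hs]

theorem coeff_ae_eq {T : Finset E} (hT : T ∈ D.mesh.elems) :
    D.coeff =ᵐ[volume.restrict (hull T)] fun _ => D.coeff (barycentre T) := by
  filter_upwards [(Triangulation.tri D.mesh hT).ae_mem_interior] with x hx
  exact h.coeff_eq hT hx

theorem memLp_coeff_mul (f : ℝ → ℝ) {ψ : E → ℝ} (hψ : MemLp ψ 2 (volume.restrict Ω)) :
    MemLp (fun x => f (D.coeff x) * ψ x) 2 (volume.restrict Ω) := by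
  rw [Triangulation.memLp_domain_iff (M := D.mesh) h.domain] at hψ ⊢
  intro T hT
  refine ((hψ T hT).const_mul (f (D.coeff (barycentre T)))).ae_eq ?_
  filter_upwards [h.coeff_ae_eq hT] with x hx
  rw [hx]

/-- The Laplacian of an affine function is zero, so the diffusion term disappears from the element
residual. -/
theorem residual_ae_eq {T : Finset E} (hT : T ∈ D.mesh.elems) :
    D.residual =ᵐ[volume.restrict (hull T)] fun x => D.Gc / D.eps - D.coeff x * D.phih x := by
  filter_upwards [(Triangulation.tri D.mesh hT).ae_mem_interior] with x hx
  obtain ⟨A, hA⟩ := h.isP1_phih.2 T hT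
  have hev : D.phih =ᶠ[𝓝 x] A := by
    filter_upwards [mem_interior_iff_mem_nhds.mp hx] with z hz
    exact hA hz
  have hfd : fderiv ℝ (A : E → ℝ) = fun _ => LinearMap.toContinuousLinearMap A.linear := by
    ext1 y
    exact (hasFDerivAt_affine A _).fderiv
  have hlap : Laplacian.laplacian D.phih x = 0 := by
    rw [(InnerProductSpace.laplacian_congr_nhds hev).eq_of_nhds,
      InnerProductSpace.laplacian_eq_iteratedFDeriv_stdOrthonormalBasis]
    simp only [iteratedFDeriv_two_apply, hfd]
    simp
  rw [residual, hlap, coeff]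
  ring

/-! ### The forms -/

/-- Weak gradients are almost everywhere unique, so the form can be evaluated with any
representative, such as the product rule formula. -/
theorem bilin_eq {ζ ψ : E → ℝ} {Z G : E → E} (hZ : HasL2WeakGrad Ω ζ Z) (hG : HasL2WeakGrad Ω ψ G) :
    D.bilin ζ ψ = (∫ x in Ω, D.coeff x * ζ x * ψ x) +
      D.Gc * D.eps * ∫ x in Ω, (inner ℝ (Z x) (G x) : ℝ) := by
  rw [bilin]
  congr 2
  refine integral_congr_ae ?_
  filter_upwards [hZ.weakGrad_ae_eq h.domain.isOpen, hG.weakGrad_ae_eq h.domain.isOpen] with x h1 h2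
  rw [h1, h2]

theorem bilin_comm (ζ ψ : E → ℝ) : D.bilin ζ ψ = D.bilin ψ ζ := by
  simp only [bilin]
  congr 2
  · ext x; ring
  · simp_rw [real_inner_comm]

theorem integrable_coeff_mul {ζ ψ : E → ℝ} (hζ : MemLp ζ 2 (volume.restrict Ω))
    (hψ : MemLp ψ 2 (volume.restrict Ω)) :
    Integrable (fun x => D.coeff x * ζ x * ψ x) (volume.restrict Ω) :=
  integrable_mul_of_memLp (h.memLp_coeff_mul id hζ) hψ

theorem isFiniteMeasure_domain : IsFiniteMeasure (volume.restrict Ω) := by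
  refine ⟨?_⟩
  rw [Measure.restrict_apply_univ]
  refine (measure_mono subset_closure).trans_lt ?_
  rw [← D.mesh.cover]
  exact (Triangulation.isCompact_biUnion (M := D.mesh) subset_rfl).measure_lt_top

omit h in
theorem _root_.PhaseField.MemH1.linear_comb {U : Set E} {ζ ψ : E → ℝ} (hζ : MemH1 U ζ) (hψ : MemH1 U ψ)
    (a b : ℝ) : MemH1 U (fun x => a * ζ x + b * ψ x) :=
  ⟨memLp_fun_add (hζ.1.const_mul a) (hψ.1.const_mul b), _,
    HasL2WeakGrad.linear_comb hζ.1 hψ.1 hζ.hasL2WeakGrad hψ.hasL2WeakGrad a b⟩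

theorem bilin_linear_comb {ζ ψ ξ : E → ℝ} (hζ : MemH1 Ω ζ) (hψ : MemH1 Ω ψ) (hξ : MemH1 Ω ξ) (a b : ℝ) :
    D.bilin ζ (fun x => a * ψ x + b * ξ x) = a * D.bilin ζ ψ + b * D.bilin ζ ξ := by
  have hlc := HasL2WeakGrad.linear_comb hψ.1 hξ.1 hψ.hasL2WeakGrad hξ.hasL2WeakGrad a b
  rw [h.bilin_eq hζ.hasL2WeakGrad hlc, bilin, bilin]
  have e1 : ∫ x in Ω, D.coeff x * ζ x * (a * ψ x + b * ξ x) =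
      a * (∫ x in Ω, D.coeff x * ζ x * ψ x) + b * ∫ x in Ω, D.coeff x * ζ x * ξ x := by
    rw [← integral_const_mul, ← integral_const_mul, ← integral_add
      ((h.integrable_coeff_mul hζ.1 hψ.1).const_mul a) ((h.integrable_coeff_mul hζ.1 hξ.1).const_mul b)]
    congr 1
    ext x
    ring
  have e2 : ∫ x in Ω, (inner ℝ (weakGrad Ω ζ x) (a • weakGrad Ω ψ x + b • weakGrad Ω ξ x) : ℝ) =
      a * (∫ x in Ω, (inner ℝ (weakGrad Ω ζ x) (weakGrad Ω ψ x) : ℝ)) +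
        b * ∫ x in Ω, (inner ℝ (weakGrad Ω ζ x) (weakGrad Ω ξ x) : ℝ) := by
    rw [← integral_const_mul, ← integral_const_mul, ← integral_add
      ((integrable_inner_of_memLp hζ.hasL2WeakGrad.1 hψ.hasL2WeakGrad.1).const_mul a)
      ((integrable_inner_of_memLp hζ.hasL2WeakGrad.1 hξ.hasL2WeakGrad.1).const_mul b)]
    congr 1
    ext x
    rw [inner_add_right, inner_smul_right, inner_smul_right]
  rw [e1, e2]
  ring

theorem load_linear_comb {ψ ξ : E → ℝ} (hψ : MemH1 Ω ψ) (hξ : MemH1 Ω ξ) (a b : ℝ) :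
    D.load (fun x => a * ψ x + b * ξ x) = a * D.load ψ + b * D.load ξ := by
  have hfin := h.isFiniteMeasure_domain
  simp only [load]
  rw [← integral_const_mul, ← integral_const_mul, ← integral_add
    (((hψ.1.integrable (by norm_num)).const_mul _).const_mul a)
    (((hξ.1.integrable (by norm_num)).const_mul _).const_mul b)]
  congr 1
  ext x
  ring

theorem force_linear_comb {ζ ψ ξ : E → ℝ} (hζ : MemH1 Ω ζ) (hψ : MemH1 Ω ψ) (hξ : MemH1 Ω ξ) (a b : ℝ) :
    D.force ζ (fun x => a * ψ x + b * ξ x) = a * D.force ζ ψ + b * D.force ζ ξ := by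
  rw [force, force, force, h.bilin_linear_comb hζ hψ hξ, h.load_linear_comb hψ hξ]
  ring

theorem force_sub {ζ ψ ξ : E → ℝ} (hζ : MemH1 Ω ζ) (hψ : MemH1 Ω ψ) (hξ : MemH1 Ω ξ) :
    D.force ζ (fun x => ψ x - ξ x) = D.force ζ ψ - D.force ζ ξ := by
  have := h.force_linear_comb hζ hψ hξ 1 (-1)
  simpa [sub_eq_add_neg] using this

omit h in
theorem _root_.PhaseField.MemH1.sub {U : Set E} {ζ ψ : E → ℝ} (hζ : MemH1 U ζ) (hψ : MemH1 U ψ) :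
    MemH1 U (fun x => ζ x - ψ x) := by
  have := hζ.linear_comb hψ 1 (-1)
  simpa [sub_eq_add_neg] using this

theorem force_congr (ζ : E → ℝ) {ψ ψ' : E → ℝ} (hψ : MemH1 Ω ψ) (hae : ψ =ᵐ[volume.restrict Ω] ψ') :
    D.force ζ ψ = D.force ζ ψ' := by
  have hG := hψ.hasL2WeakGrad.congr hae (EventuallyEq.refl _ _)
  rw [force, force, load, load, bilin, bilin]
  congr 1
  · refine integral_congr_ae ?_
    filter_upwards [hae] with x hx
    rw [hx]
  · congr 1
    · refine integral_congr_ae ?_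
      filter_upwards [hae] with x hx
      rw [hx]
    · congr 1
      refine integral_congr_ae ?_
      filter_upwards [hG.weakGrad_ae_eq h.domain.isOpen] with x hx
      rw [hx]

theorem force_sum {ζ : E → ℝ} (hζ : MemH1 Ω ζ) {S : Finset E} {f : E → E → ℝ}
    (hf : ∀ p ∈ S, MemH1 Ω (f p)) : MemH1 Ω (fun x => ∑ p ∈ S, f p x) ∧
      D.force ζ (fun x => ∑ p ∈ S, f p x) = ∑ p ∈ S, D.force ζ (f p) := by
  classical
  induction S using Finset.induction_on with
  | empty =>
    have h0 : MemH1 Ω (fun _ => 0) := by simpa using hζ.linear_comb hζ 0 0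
    refine ⟨by simpa using h0, ?_⟩
    have := h.force_linear_comb hζ hζ hζ 0 0
    simpa using this
  | insert p S hp ih =>
    obtain ⟨i1, i2⟩ := ih fun q hq => hf q (Finset.mem_insert_of_mem hq)
    have h1 := hf p (Finset.mem_insert_self _ _)
    have e1 := h1.linear_comb i1 1 1
    have e2 := h.force_linear_comb hζ h1 i1 1 1
    simp only [one_mul] at e1 e2
    simp only [Finset.sum_insert hp]
    exact ⟨e1, by rw [e2, i2]⟩

/-! ### The energy norm -/

/-- The energy norm on a part of `Ω`. -/
def _root_.PhaseField.Step.localNorm (D : Step Ω) (μ : Measure E) (ψ : E → ℝ) : ℝ :=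
  √(D.Gc * D.eps * l2n μ (weakGrad Ω ψ) ^ 2 + l2n μ (fun x => √(D.coeff x) * ψ x) ^ 2)

theorem energyNorm_eq {ψ : E → ℝ} (hψ : MemH1 Ω ψ) :
    D.energyNorm ψ = D.localNorm (volume.restrict Ω) ψ := by
  rw [energyNorm, localNorm, l2n_sq hψ.hasL2WeakGrad.1, l2n_sq (h.memLp_coeff_mul Real.sqrt hψ.1)]
  simp_rw [Real.norm_eq_abs, sq_abs]

theorem localNorm_sq (μ : Measure E) (ψ : E → ℝ) : D.localNorm μ ψ ^ 2 =
    D.Gc * D.eps * l2n μ (weakGrad Ω ψ) ^ 2 + l2n μ (fun x => √(D.coeff x) * ψ x) ^ 2 := by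
  have := h.diffusion_pos
  rw [localNorm, Real.sq_sqrt (by positivity)]

theorem energyNorm_sq {ψ : E → ℝ} (hψ : MemH1 Ω ψ) : D.energyNorm ψ ^ 2 = D.bilin ψ ψ := by
  rw [h.energyNorm_eq hψ, h.localNorm_sq, l2n_sq hψ.hasL2WeakGrad.1,
    l2n_sq (h.memLp_coeff_mul Real.sqrt hψ.1), bilin, add_comm]
  congr 1
  · congr 1
    ext x
    rw [Real.norm_eq_abs, sq_abs, mul_pow, Real.sq_sqrt (h.coeff_pos x).le]
    ring
  · simp_rw [real_inner_self_eq_norm_sq]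

theorem abs_bilin_le {ζ ψ : E → ℝ} (hζ : MemH1 Ω ζ) (hψ : MemH1 Ω ψ) :
    |D.bilin ζ ψ| ≤ D.energyNorm ζ * D.energyNorm ψ := by
  have hg := h.diffusion_pos
  have h1 := abs_integral_mul_le (h.memLp_coeff_mul Real.sqrt hζ.1) (h.memLp_coeff_mul Real.sqrt hψ.1)
  have h2 := abs_integral_inner_le hζ.hasL2WeakGrad.1 hψ.hasL2WeakGrad.1
  have heq : ∫ x in Ω, D.coeff x * ζ x * ψ x =
      ∫ x in Ω, √(D.coeff x) * ζ x * (√(D.coeff x) * ψ x) := by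
    congr 1
    ext x
    have := Real.mul_self_sqrt (h.coeff_pos x).le
    linear_combination (-(ζ x * ψ x)) * this
  rw [← heq] at h1
  have n1 := h.localNorm_sq (volume.restrict Ω) ζ
  have n2 := h.localNorm_sq (volume.restrict Ω) ψ
  rw [← h.energyNorm_eq hζ] at n1
  rw [← h.energyNorm_eq hψ] at n2
  set a := l2n (volume.restrict Ω) (fun x => √(D.coeff x) * ζ x)
  set b := l2n (volume.restrict Ω) (fun x => √(D.coeff x) * ψ x)
  set c := l2n (volume.restrict Ω) (weakGrad Ω ζ)
  set d := l2n (volume.restrict Ω) (weakGrad Ω ψ)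
  have hN : 0 ≤ D.energyNorm ζ * D.energyNorm ψ := mul_nonneg (Real.sqrt_nonneg _) (Real.sqrt_nonneg _)
  have h3 : |D.bilin ζ ψ| ≤ a * b + D.Gc * D.eps * (c * d) := by
    rw [bilin]
    refine (abs_add_le _ _).trans (add_le_add h1 ?_)
    rw [abs_mul, abs_of_pos hg]
    exact mul_le_mul_of_nonneg_left h2 hg.le
  refine h3.trans (abs_le_of_sq_le_sq' ?_ hN).2
  rw [mul_pow, n1, n2]
  -- The difference between the two sides is exactly `Gc * eps * (a * d - b * c) ^ 2`.
  nlinarith [mul_nonneg hg.le (sq_nonneg (a * d - b * c))]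

end IsAdmissible

end Step

/-! ### The residual tested with local functions -/

namespace Triangulation

variable {Ω : Set E} {M : Triangulation Ω}

theorem hat_side_eq_zero {s : Finset E} (hs : s ∈ M.sides) {p x : E} (hp : p ∉ s) (hx : x ∈ hull s) :
    M.hat p x = 0 := by
  obtain ⟨T, hT, hsT, -⟩ := M.mem_sides.mp hs
  have hx' := ((M.tri hT).mem_hull_subset_iff hsT).mp hx
  rw [hat_eq hT hx'.1]
  by_cases hpT : p ∈ T
  · exact hx'.2 p hpT hp
  · rw [bary, dif_neg (by tauto)]; rfl

theorem integral_side_hat_eq_zero {s : Finset E} (hs : s ∈ M.sides) {p : E} (hp : p ∉ s) (f : E → ℝ) :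
    ∫ x, f x * M.hat p x ∂(sideMeasure s) = 0 := by
  have hms : MeasurableSet (hull s) := (s.finite_toSet.isCompact_convexHull ℝ).isClosed.measurableSet
  refine integral_eq_zero_of_ae ?_
  rw [sideMeasure]
  filter_upwards [ae_restrict_mem hms] with x hx
  rw [hat_side_eq_zero hs hp hx, mul_zero]
  rfl

theorem hat_zero_of_notMem_elemsAt {T : Finset E} (hT : T ∈ M.elems) {p : E} (h : T ∉ M.elemsAt {p})
    {x : E} (hx : x ∈ hull T) : M.hat p x = 0 := by
  have hpT : p ∉ T := fun hp => h (mem_elemsAt_singleton.mpr ⟨hT, hp⟩)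
  rw [hat_eq hT hx, bary, dif_neg (by tauto)]
  rfl

theorem integral_mul_hat (hΩ : IsPolygonalDomain Ω) {p : E} {f : E → ℝ}
    (hf : Integrable (fun x => f x * M.hat p x) (volume.restrict Ω)) :
    ∫ x in Ω, f x * M.hat p x = ∫ x in M.patch {p}, f x * M.hat p x := by
  rw [integral_domain (M := M) hΩ hf, restrict_patch, integral_finsetSum_measure fun T hT =>
    Integrable.mono_measure hf (restrict_hull_le hΩ (elemsAt_subset _ hT))]
  symm
  refine Finset.sum_subset (elemsAt_subset _) fun T hT hTn => ?_
  refine setIntegral_eq_zero_of_forall_eq_zero fun x hx => ?_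
  rw [hat_zero_of_notMem_elemsAt hT hTn hx, mul_zero]

/-- Only sides through `p` contribute. The boundary skeleton may also contain sides of the patch
that do not contain `p`; `φ_p` vanishes on those, so including them is harmless. -/
theorem sum_sides_hat (J : Finset E → ℝ) (g : Finset E → E → ℝ) (p : E) :
    ∑ s ∈ M.sides, J s * ∫ x, g s x * M.hat p x ∂(sideMeasure s) =
      (∑ s ∈ M.skeleton p, J s * ∫ x, g s x * M.hat p x ∂(sideMeasure s)) +
        ∑ s ∈ M.boundarySkeleton p, J s * ∫ x, g s x * M.hat p x ∂(sideMeasure s) := by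
  classical
  have hdisj : Disjoint (M.skeleton p) (M.boundarySkeleton p) := by
    rw [Finset.disjoint_left]
    intro s h1 h2
    rw [skeleton, Finset.mem_filter] at h1
    rw [boundarySkeleton, Finset.mem_filter] at h2
    omega
  rw [← Finset.sum_union hdisj]
  symm
  refine Finset.sum_subset (Finset.union_subset ?_ ?_) fun s hs hsn => ?_
  · rw [skeleton]; exact Finset.filter_subset _ _
  · rw [boundarySkeleton]; exact Finset.filter_subset _ _
  · rw [integral_side_hat_eq_zero hs _ (g s), mul_zero]
    intro hps
    refine hsn (Finset.mem_union.mpr ?_)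
    rcases card_elemsAt hs with h1 | h2
    · right
      obtain ⟨T, hT, hsT, -⟩ := M.mem_sides.mp hs
      rw [boundarySkeleton, Finset.mem_filter]
      exact ⟨hs, h1, T, mem_elemsAt_singleton.mpr ⟨hT, hsT hps⟩, hsT⟩
    · left
      rw [skeleton, Finset.mem_filter]
      exact ⟨hs, hps, h2⟩

theorem memH1_mul_hat (hΩ : IsPolygonalDomain Ω) {ψ : E → ℝ} (hψ : MemH1 Ω ψ) (p : E) :
    MemH1 Ω (fun x => ψ x * M.hat p x) := by
  refine ⟨?_, _, (hasSideTraces (M := M) hΩ hψ).hasL2WeakGrad_mul hψ.1 hψ.hasL2WeakGrad.1 hΩ (isP1_hat p)⟩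
  have := (isP1_hat (M := M) p).memLp_smul hΩ hψ.1
  simpa [mul_comm, smul_eq_mul] using this

theorem memH1_const (M : Triangulation Ω) (hΩ : IsPolygonalDomain Ω) (c : ℝ) : MemH1 Ω (fun _ => c) :=
  (isP1_const (M := M) c).memH1 hΩ

theorem ae_sum_hat (M : Triangulation Ω) : ∀ᵐ x ∂(volume.restrict Ω), ∑ p ∈ M.nodes, M.hat p x = 1 := by
  refine ae_restrict_of_ae_restrict_of_subset (subset_closure (s := Ω)) ?_
  rw [ae_restrict_iff' isClosed_closure.measurableSet]
  refine Eventually.of_forall fun x hx => ?_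
  obtain ⟨T, hT, hxT⟩ := exists_hull (M := M) hx
  exact sum_hat hT hxT

theorem hat_self {p : E} (hp : p ∈ M.nodes) : M.hat p p = 1 := by
  obtain ⟨T, hT, hpT⟩ := M.mem_nodes.mp hp
  rw [hat_eq hT (subset_convexHull ℝ _ hpT), (M.tri hT).bary_self hpT]

theorem hat_of_ne {p q : E} (hq : q ∈ M.nodes) (h : q ≠ p) : M.hat p q = 0 := by
  obtain ⟨T, hT, hqT⟩ := M.mem_nodes.mp hq
  rw [hat_eq hT (subset_convexHull ℝ _ hqT), (M.tri hT).bary_of_ne hqT h.symm]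

theorem skeleton_subset (p : E) : M.skeleton p ⊆ M.sides := by
  rw [skeleton]; exact Finset.filter_subset _ _

theorem boundarySkeleton_subset (p : E) : M.boundarySkeleton p ⊆ M.sides := by
  rw [boundarySkeleton]; exact Finset.filter_subset _ _

theorem notMem_of_boundarySkeleton (hΩ : IsPolygonalDomain Ω) {p : E} (hp : p ∈ Ω) {s : Finset E}
    (hs : s ∈ M.boundarySkeleton p) : p ∉ s := by
  intro hps
  have h2 := card_elemsAt_of_interior_node hΩ hp (boundarySkeleton_subset p hs) hps
  rw [boundarySkeleton, Finset.mem_filter] at hs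
  omega

/-- The trace of `ψ - c`. -/
theorem hasSideTraces_sub_const (hΩ : IsPolygonalDomain Ω) {ψ : E → ℝ} (hψ : MemH1 Ω ψ) (c : ℝ) :
    M.HasSideTraces (fun x => ψ x - c) (weakGrad Ω ψ) (fun s x => trace (M.patch s) s ψ x - c) := by
  intro s hs T hT P h w hw
  have hTe := elemsAt_subset _ hT
  have hle := restrict_hull_le hΩ hTe
  have hK := (M.tri hTe).isCompact_hull
  have e1 := hasSideTraces hΩ hψ s hs T hT P h w hw
  have e2 := hasSideTraces_const (M := M) c s hs T hT P h w hw
  have hfin := isFiniteMeasure_side h.card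
  have hfin' : IsFiniteMeasure (volume.restrict (hull T)) :=
    ⟨by rw [Measure.restrict_apply_univ]; exact hK.measure_lt_top⟩
  have i1 : Integrable (fun x => trace (M.patch s) s ψ x * w x) (sideMeasure s) :=
    integrable_mul_of_memLp (isTrace_trace hΩ hψ hs).1 (memLp_side_of_continuous h.card hw.continuous)
  have i2 : Integrable (fun x => c * w x) (sideMeasure s) :=
    integrable_mul_of_memLp (memLp_const c) (memLp_side_of_continuous h.card hw.continuous)
  have hwg := continuous_gradient hw
  have hwc := hw.continuous
  have m : MemLp (fun x => 2 * w x + (inner ℝ (gradient w x) (x - P) : ℝ)) 2 (volume.restrict (hull T)) :=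
    memLp_of_continuous hK (by fun_prop)
  have i3 := integrable_mul_of_memLp (hψ.1.mono_measure hle) m
  have i4 := integrable_mul_of_memLp (memLp_const (μ := volume.restrict (hull T)) c) m
  simp_rw [sub_mul]
  rw [integral_sub i1 i2, integral_sub i3 i4, e1, e2]
  simp only [inner_zero_right, integral_zero]
  ring

end Triangulation

/-! ### Localization of the residual and the consequences of the discrete inequality at single
nodes. -/

namespace Step.IsAdmissible

variable {Ω : Set E} {D : Step Ω} (h : D.IsAdmissible)
include h

open Triangulation

theorem memH1_phih : MemH1 Ω D.phih := h.isP1_phih.memH1 h.domain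

theorem residual_ae_eq_domain :
    D.residual =ᵐ[volume.restrict Ω] fun x => D.Gc / D.eps - D.coeff x * D.phih x := by
  rw [Filter.EventuallyEq, restrict_domain (M := D.mesh) h.domain, ae_finsetSum_measure_iff]
  exact fun T hT => h.residual_ae_eq hT

theorem memLp_residual : MemLp D.residual 2 (volume.restrict Ω) := by
  have hfin := h.isFiniteMeasure_domain
  exact (memLp_fun_sub (memLp_const _) (h.memLp_coeff_mul id h.memH1_phih.1)).ae_eq
    h.residual_ae_eq_domain.symm

/-- The residual, tested with the product of a function and a nodal basis function. -/
theorem force_mul_hat {ψ : E → ℝ} {G : E → E} {g : Finset E → E → ℝ} (hψ : MemLp ψ 2 (volume.restrict Ω))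
    (hG : MemLp G 2 (volume.restrict Ω)) (hg : D.mesh.HasSideTraces ψ G g) (p : E) :
    D.force D.phih (fun x => ψ x * D.mesh.hat p x) =
      (∫ x in D.mesh.patch {p}, D.residual x * ψ x * D.mesh.hat p x) -
        (∑ s ∈ D.mesh.skeleton p, D.Gc * D.eps * normalJump D.mesh D.phih s *
          ∫ x, g s x * D.mesh.hat p x ∂(sideMeasure s)) -
        ∑ s ∈ D.mesh.boundarySkeleton p, D.Gc * D.eps * normalJump D.mesh D.phih s *
          ∫ x, g s x * D.mesh.hat p x ∂(sideMeasure s) := by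
  have hfin := h.isFiniteMeasure_domain
  have hprod := hg.hasL2WeakGrad_mul hψ hG h.domain (isP1_hat p)
  have hψp : MemLp (fun x => ψ x * D.mesh.hat p x) 2 (volume.restrict Ω) := by
    have := (isP1_hat (M := D.mesh) p).memLp_smul h.domain hψ
    simpa [mul_comm, smul_eq_mul] using this
  have hsides := sum_sides_hat (M := D.mesh) (normalJump D.mesh D.phih) g p
  rw [← hg.integral_inner_hat hψ hG h.domain h.isP1_phih] at hsides
  have hvol : ∫ x in D.mesh.patch {p}, D.residual x * ψ x * D.mesh.hat p x =
      D.load (fun x => ψ x * D.mesh.hat p x) -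
        ∫ x in Ω, D.coeff x * D.phih x * (ψ x * D.mesh.hat p x) := by
    have hint : Integrable (fun x => D.residual x * ψ x * D.mesh.hat p x) (volume.restrict Ω) := by
      have := integrable_mul_of_memLp h.memLp_residual hψp
      simpa only [mul_assoc] using this
    rw [← integral_mul_hat h.domain hint, load, ← integral_sub
      ((hψp.integrable (by norm_num)).const_mul _) (h.integrable_coeff_mul h.memH1_phih.1 hψp)]
    refine integral_congr_ae ?_
    filter_upwards [h.residual_ae_eq_domain] with x hx
    rw [hx]
    ring
  rw [force, h.bilin_eq (h.isP1_phih.hasL2WeakGrad h.domain) hprod, hvol, hsides]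
  simp_rw [mul_assoc (D.Gc * D.eps), ← Finset.mul_sum]
  ring

/-- Undoing the elementwise integration by parts turns element and jump residuals back into the
linear residual tested with `ψ φ_p`, to which the sign condition of the contact nodes applies. -/
theorem fullForce_eq {ψ : E → ℝ} (hψ : MemH1 Ω ψ) (p : E) :
    D.fullForce p ψ = D.force D.phih (fun x => ψ x * D.mesh.hat p x) := by
  rw [h.force_mul_hat hψ.1 hψ.hasL2WeakGrad.1 (hasSideTraces h.domain hψ) p, fullForce]
  simp_rw [mul_assoc (D.Gc * D.eps * _), integral_const_mul]

theorem semiForce_eq (p : E) (ψ : E → ℝ) :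
    D.semiForce p ψ = D.force D.phih (fun x => D.mesh.weightedMean p ψ * D.mesh.hat p x) := by
  have hfin := h.isFiniteMeasure_domain
  rw [h.force_mul_hat (memLp_const _) MemLp.zero (hasSideTraces_const _) p, semiForce]
  simp_rw [mul_assoc (D.Gc * D.eps * _), integral_const_mul]
  rfl

theorem memH1_hat (p : E) : MemH1 Ω (D.mesh.hat p) := (isP1_hat (M := D.mesh) p).memH1 h.domain

theorem force_const_mul {ζ ψ : E → ℝ} (hζ : MemH1 Ω ζ) (hψ : MemH1 Ω ψ) (c : ℝ) :
    D.force ζ (fun x => c * ψ x) = c * D.force ζ ψ := by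
  have := h.force_linear_comb hζ hψ hψ c 0
  simpa using this

/-- The perturbation `φ_h + τ φ_p` is used as a competitor in the discrete inequality. -/
theorem force_hat_test (hsol : D.IsDiscreteSolution) {p : E} {τ : ℝ}
    (hf : ∀ q ∈ D.mesh.nodes, D.phih q + τ * D.mesh.hat p q ≤ D.obstacle q) :
    τ * D.force D.phih (D.mesh.hat p) ≤ 0 := by
  have hP : D.mesh.IsP1 (fun x => D.phih x + τ * D.mesh.hat p x) := by
    have := h.isP1_phih.add_smul (isP1_hat p) 1 τ
    simpa using this
  have := hsol.2 _ ⟨hP, hf⟩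
  simp only [add_sub_cancel_left] at this
  rw [← h.force_const_mul h.memH1_phih (h.memH1_hat p), force]
  linarith

theorem force_hat_nonneg (hsol : D.IsDiscreteSolution) (p : E) : 0 ≤ D.force D.phih (D.mesh.hat p) := by
  have := h.force_hat_test hsol (p := p) (τ := -1) fun q hq => by
    have := hsol.1.2 q hq
    have := hat_nonneg (M := D.mesh) p q
    linarith
  linarith

/-- Complementarity: where the obstacle is not attained, raising the nodal value up to the obstacle
is admissible, so the nodal residual is also nonpositive. -/
theorem force_hat_eq_zero (hsol : D.IsDiscreteSolution) {p : E} (hp : p ∈ D.mesh.nodes)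
    (hne : D.phih p ≠ D.obstacle p) : D.force D.phih (D.mesh.hat p) = 0 := by
  have hlt := lt_of_le_of_ne (hsol.1.2 p hp) hne
  have := h.force_hat_test hsol (p := p) (τ := D.obstacle p - D.phih p) fun q hq => by
    by_cases hqp : q = p
    · rw [hqp, hat_self hp]
      linarith
    · rw [hat_of_ne hq hqp, mul_zero, add_zero]
      exact hsol.1.2 q hq
  have h1 := h.force_hat_nonneg hsol p
  have h2 : 0 < D.obstacle p - D.phih p := sub_pos.mpr hlt
  nlinarith

/-- The part of the residual that is not represented by the quasi-discrete constraining force. -/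
theorem force_sub_quasiForce (hsol : D.IsDiscreteSolution) {ψ : E → ℝ} (hψ : MemH1 Ω ψ) :
    open Classical in
    D.force D.phih ψ - D.quasiForce ψ = ∑ p ∈ D.mesh.nodes.filter (¬ D.IsFullContact ·),
      D.force D.phih (fun x => (ψ x - D.mesh.weightedMean p ψ) * D.mesh.hat p x) := by
  classical
  have hsum := h.force_sum h.memH1_phih (S := D.mesh.nodes) (f := fun p x => ψ x * D.mesh.hat p x)
    fun p _ => memH1_mul_hat h.domain hψ p
  have h1 : D.force D.phih ψ = ∑ p ∈ D.mesh.nodes, D.force D.phih (fun x => ψ x * D.mesh.hat p x) := by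
    rw [← hsum.2]
    refine (h.force_congr _ hsum.1 ?_).symm
    filter_upwards [ae_sum_hat D.mesh] with x hx
    rw [← Finset.mul_sum, hx, mul_one]
  have h2 : ∀ p, D.force D.phih (fun x => (ψ x - D.mesh.weightedMean p ψ) * D.mesh.hat p x) =
      D.force D.phih (fun x => ψ x * D.mesh.hat p x) -
        D.mesh.weightedMean p ψ * D.force D.phih (D.mesh.hat p) := by
    intro p
    rw [← h.force_const_mul h.memH1_phih (h.memH1_hat p), ← h.force_sub h.memH1_phih
      (memH1_mul_hat h.domain hψ p) (by
        have := memH1_mul_hat (M := D.mesh) h.domain (memH1_const D.mesh h.domain (D.mesh.weightedMean p ψ)) p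
        exact this)]
    congr 1
    ext x
    ring
  have h3 : ∀ p, D.semiForce p ψ = D.mesh.weightedMean p ψ * D.force D.phih (D.mesh.hat p) := by
    intro p
    rw [h.semiForce_eq, h.force_const_mul h.memH1_phih (h.memH1_hat p)]
  rw [h1, quasiForce, ← Finset.sum_filter_add_sum_filter_not D.mesh.nodes (D.IsFullContact ·)]
  simp_rw [h2, h.fullForce_eq hψ, h3, Finset.sum_sub_distrib]
  -- A node that is in neither kind of contact does not touch the obstacle, so its nodal residual is
  -- zero and its mean value can be subtracted without changing the sum.
  have h4 : ∑ p ∈ D.mesh.nodes.filter (¬ D.IsFullContact ·),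
      D.mesh.weightedMean p ψ * D.force D.phih (D.mesh.hat p) =
      ∑ p ∈ D.mesh.nodes.filter (D.IsSemiContact ·),
        D.mesh.weightedMean p ψ * D.force D.phih (D.mesh.hat p) := by
    symm
    refine Finset.sum_subset (fun p hp => ?_) fun p hp hpn => ?_
    · rw [Finset.mem_filter] at hp ⊢
      exact ⟨hp.1, hp.2.2.2⟩
    · rw [Finset.mem_filter] at hp hpn
      rw [h.force_hat_eq_zero hsol hp.1 fun heq => hpn ⟨hp.1, hp.1, heq, hp.2⟩, mul_zero]
  rw [h4]
  ring

end Step.IsAdmissible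

/-! ### Estimates on patches -/

namespace Step.IsAdmissible

variable {Ω : Set E} {D : Step Ω} (h : D.IsAdmissible)
include h

open Triangulation

theorem alpha_spec {p : E} (hp : p ∈ D.mesh.nodes) :
    0 < D.alpha p ∧ ∀ T ∈ D.mesh.elemsAt {p}, D.alpha p ≤ D.coeff (barycentre T) := by
  obtain ⟨T, hT, hpT⟩ := D.mesh.mem_nodes.mp hp
  refine ⟨h.ratio_pos.trans_le (le_csInf ?_ ?_), fun T hT => csInf_le ?_ (Set.mem_image_of_mem _ hT)⟩
  · exact ⟨_, Set.mem_image_of_mem _ (mem_elemsAt_singleton.mpr ⟨hT, hpT⟩)⟩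
  · rintro _ ⟨T, -, rfl⟩
    exact h.ratio_le_coeff _
  · refine ⟨D.Gc / D.eps, ?_⟩
    rintro _ ⟨T, -, rfl⟩
    exact h.ratio_le_coeff _

theorem alpha_le_coeff {p : E} (hp : p ∈ D.mesh.nodes) :
    ∀ᵐ x ∂(volume.restrict (D.mesh.patch {p})), D.alpha p ≤ D.coeff x := by
  rw [restrict_patch, ae_finsetSum_measure_iff]
  intro T hT
  filter_upwards [h.coeff_ae_eq (elemsAt_subset _ hT)] with x hx
  rw [hx]
  exact (h.alpha_spec hp).2 T hT

theorem weight_pos {p : E} (hp : p ∈ D.mesh.nodes) : 0 < D.weight p :=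
  lt_min (div_pos (diamPatch_pos hp) (Real.sqrt_pos.mpr h.diffusion_pos))
    (Real.rpow_pos_of_pos (h.alpha_spec hp).1 _)

theorem localNorm_nonneg (μ : Measure E) (ψ : E → ℝ) : 0 ≤ D.localNorm μ ψ := Real.sqrt_nonneg _

theorem sqrt_mul_grad_le (μ : Measure E) (ψ : E → ℝ) :
    √(D.Gc * D.eps) * l2n μ (weakGrad Ω ψ) ≤ D.localNorm μ ψ := by
  refine (abs_le_of_sq_le_sq' ?_ (h.localNorm_nonneg μ ψ)).2
  rw [h.localNorm_sq, mul_pow, Real.sq_sqrt h.diffusion_pos.le]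
  exact le_add_of_nonneg_right (sq_nonneg _)

theorem sqrt_alpha_mul_le {p : E} (hp : p ∈ D.mesh.nodes) {ψ : E → ℝ} (hψ : MemH1 Ω ψ) :
    √(D.alpha p) * l2n (volume.restrict (D.mesh.patch {p})) ψ ≤
      D.localNorm (volume.restrict (D.mesh.patch {p})) ψ := by
  have ha := (h.alpha_spec hp).1
  have hs := Real.sqrt_pos.mpr ha
  have hm := (h.memLp_coeff_mul Real.sqrt hψ.1).mono_measure (restrict_patch_le (M := D.mesh) h.domain {p})
  have h1 : l2n (volume.restrict (D.mesh.patch {p})) ψ ≤ (√(D.alpha p))⁻¹ *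
      l2n (volume.restrict (D.mesh.patch {p})) (fun x => √(D.coeff x) * ψ x) := by
    refine l2n_mono hm (inv_nonneg.mpr hs.le) ?_
    filter_upwards [h.alpha_le_coeff hp] with x hx
    rw [norm_mul, Real.norm_of_nonneg (Real.sqrt_nonneg _), le_inv_mul_iff₀ hs]
    exact mul_le_mul_of_nonneg_right (Real.sqrt_le_sqrt hx) (norm_nonneg _)
  rw [le_inv_mul_iff₀ hs] at h1
  refine h1.trans ((abs_le_of_sq_le_sq' ?_ (h.localNorm_nonneg _ ψ)).2)
  rw [h.localNorm_sq]
  have := h.diffusion_pos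
  exact le_add_of_nonneg_left (by positivity)

/-- A bound for `poincareConst ρ` and the constant in `l2n_sub_weightedMean_le`. -/
def _root_.PhaseField.patchConst (ρ : ℝ) : ℝ := poincareConst ρ + 19 / 3

omit h in
theorem _root_.PhaseField.patchConst_pos (ρ : ℝ) : 0 < patchConst ρ := by
  have := poincareConst_nonneg ρ
  unfold patchConst
  linarith

/-- The two entries of the minimum correspond to two proofs: the Poincaré inequality with the
diffusion part of the norm, and stability of the weighted mean with the reaction part bounded below
by `α_p`. Taking the better one makes the constant independent of `ε` and of the mesh size. -/
theorem l2n_sub_mean_le {ρ : ℝ} (hρ : D.mesh.ShapeRegular ρ) {p : E} (hp : p ∈ D.mesh.nodes) {ψ : E → ℝ}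
    (hψ : MemH1 Ω ψ) :
    l2n (volume.restrict (D.mesh.patch {p})) (fun x => ψ x - D.mesh.weightedMean p ψ) ≤
      patchConst ρ * D.weight p * D.localNorm (volume.restrict (D.mesh.patch {p})) ψ := by
  set μ := (volume : Measure E).restrict (D.mesh.patch {p})
  set e := D.localNorm μ ψ
  have he : 0 ≤ e := h.localNorm_nonneg _ _
  have ha := (h.alpha_spec hp).1
  have hsa := Real.sqrt_pos.mpr ha
  have hsg := Real.sqrt_pos.mpr h.diffusion_pos
  have hd := diamPatch_pos hp
  have hK := poincareConst_nonneg ρ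
  have h1 := poincare_patch hρ h.domain hp hψ
  have h2 := l2n_sub_weightedMean_le hp (hψ.1.mono_measure (restrict_patch_le (M := D.mesh) h.domain {p})) 0
  simp only [sub_zero] at h2
  have h3 := h.sqrt_mul_grad_le μ ψ
  have h4 := h.sqrt_alpha_mul_le hp hψ
  have hrp : D.alpha p ^ (-(1 / 2) : ℝ) = (√(D.alpha p))⁻¹ := by
    rw [Real.rpow_neg ha.le, ← Real.sqrt_eq_rpow]
  rcases min_choice (D.mesh.diamPatch p / √(D.Gc * D.eps)) (D.alpha p ^ (-(1 / 2) : ℝ)) with hw | hw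
  · rw [weight, hw]
    refine h1.trans ?_
    have h5 : l2n μ (weakGrad Ω ψ) ≤ e / √(D.Gc * D.eps) := (le_div_iff₀' hsg).mpr h3
    calc _ ≤ poincareConst ρ * D.mesh.diamPatch p * (e / √(D.Gc * D.eps)) := by gcongr
      _ = poincareConst ρ * (D.mesh.diamPatch p / √(D.Gc * D.eps)) * e := by ring
      _ ≤ _ := by
        gcongr
        exact le_add_of_nonneg_right (by norm_num)
  · rw [weight, hw, hrp]
    refine h2.trans ?_
    have h5 : l2n μ ψ ≤ (√(D.alpha p))⁻¹ * e := (le_inv_mul_iff₀ hsa).mpr h4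
    calc _ ≤ 19 / 3 * ((√(D.alpha p))⁻¹ * e) := by gcongr
      _ = 19 / 3 * (√(D.alpha p))⁻¹ * e := by ring
      _ ≤ _ := by
        gcongr
        exact le_add_of_nonneg_left hK

/-- The constant in the estimate of traces. -/
def _root_.PhaseField.traceConst (ρ : ℝ) : ℝ := √((poincareConst ρ + 1) / areaRatio ρ * patchConst ρ)

/-- In the multiplicative trace inequality one factor is at most a constant times the weight times
the local norm, the other at most `(Gc * eps) ^ (-1/2)` times it. The square root gives precisely
the scaling of the jump indicators. -/
theorem l2n_trace_sub_mean_le {ρ : ℝ} (hρ : D.mesh.ShapeRegular ρ) {p : E} (hp : p ∈ D.mesh.nodes)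
    {ψ : E → ℝ} (hψ : MemH1 Ω ψ) {s : Finset E} (hs : s ∈ D.mesh.sides) (hps : p ∈ s) :
    l2n (sideMeasure s) (fun x => trace (D.mesh.patch s) s ψ x - D.mesh.weightedMean p ψ) ≤
      traceConst ρ * (D.weight p ^ (1 / 2 : ℝ) * (D.Gc * D.eps) ^ (-(1 / 4) : ℝ)) *
        D.localNorm (volume.restrict (D.mesh.patch {p})) ψ := by
  set μ := (volume : Measure E).restrict (D.mesh.patch {p})
  set e := D.localNorm μ ψ
  have he : 0 ≤ e := h.localNorm_nonneg _ _
  have hg := h.diffusion_pos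
  have hsg := Real.sqrt_pos.mpr hg
  have hw := h.weight_pos hp
  have hK := poincareConst_nonneg ρ
  have hKp := patchConst_pos ρ
  obtain ⟨T, hT, -⟩ := D.mesh.mem_nodes.mp hp
  have ha := areaRatio_pos (hρ.pos hT)
  have h1 := trace_patch hρ h.domain hp hψ hs hps
  have h2 := h.l2n_sub_mean_le hρ hp hψ
  have h3 : l2n μ (weakGrad Ω ψ) ≤ e / √(D.Gc * D.eps) := (le_div_iff₀' hsg).mpr (h.sqrt_mul_grad_le μ ψ)
  have hr : 0 ≤ D.weight p ^ (1 / 2 : ℝ) * (D.Gc * D.eps) ^ (-(1 / 4) : ℝ) := by positivity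
  have hsq1 : (D.weight p ^ (1 / 2 : ℝ)) ^ 2 = D.weight p := by
    rw [← Real.sqrt_eq_rpow, Real.sq_sqrt hw.le]
  have hsq2 : ((D.Gc * D.eps) ^ (-(1 / 4) : ℝ)) ^ 2 = (√(D.Gc * D.eps))⁻¹ := by
    rw [← Real.rpow_natCast, ← Real.rpow_mul hg.le, Real.sqrt_eq_rpow, ← Real.rpow_neg hg.le]
    norm_num
  refine (abs_le_of_sq_le_sq' ?_ (by unfold traceConst; positivity)).2
  refine h1.trans ?_
  rw [mul_pow, mul_pow, mul_pow, traceConst, Real.sq_sqrt (by positivity), hsq1, hsq2]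
  have hm := l2n_nonneg (μ := μ) (weakGrad Ω ψ)
  calc _ ≤ (poincareConst ρ + 1) / areaRatio ρ *
        ((patchConst ρ * D.weight p * e) * (e / √(D.Gc * D.eps))) := by
        gcongr
    _ = _ := by rw [div_eq_mul_inv e]; ring

/-- The contribution of a family of sides. -/
theorem abs_sum_sides_le {S : Finset (Finset E)} (hS : S ⊆ D.mesh.sides) {p : E} {N : ℕ}
    (hN : (S.filter (p ∈ ·)).card ≤ N) {g : Finset E → E → ℝ} (hg : ∀ s ∈ S, MemLp (g s) 2 (sideMeasure s))
    {B : ℝ} (hB0 : 0 ≤ B) (hB : ∀ s ∈ S, p ∈ s → l2n (sideMeasure s) (g s) ≤ B) (J : Finset E → ℝ) :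
    |∑ s ∈ S, J s * ∫ x, g s x * D.mesh.hat p x ∂(sideMeasure s)| ≤
      N * (B * √(∑ s ∈ S, ∫ _, J s ^ 2 ∂(sideMeasure s))) := by
  classical
  set R := √(∑ s ∈ S, ∫ _, J s ^ 2 ∂(sideMeasure s))
  have hcard : ∀ s ∈ S, s.card = 2 := fun s hs => (D.mesh.mem_sides.mp (hS hs)).choose_spec.2.2
  have hterm : ∀ s ∈ S, p ∈ s → |J s * ∫ x, g s x * D.mesh.hat p x ∂(sideMeasure s)| ≤ B * R := by
    intro s hs hps
    have hfin := isFiniteMeasure_side (hcard s hs)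
    obtain ⟨T, hT, hsT, -⟩ := D.mesh.mem_sides.mp (hS hs)
    have hms : MeasurableSet (hull s) := (s.finite_toSet.isCompact_convexHull ℝ).isClosed.measurableSet
    have hbary : MemLp (fun x => J s * bary T p x) 2 (sideMeasure s) :=
      memLp_side_of_continuous (hcard s hs) ((contDiff_affine (n := 0) _).continuous.const_smul (J s))
    have hae : ∀ᵐ x ∂(sideMeasure s), J s * D.mesh.hat p x = J s * bary T p x := by
      rw [sideMeasure]
      filter_upwards [ae_restrict_mem hms] with x hx
      rw [hat_eq hT (convexHull_mono (Finset.coe_subset.mpr hsT) hx)]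
    have hJ : MemLp (fun x => J s * D.mesh.hat p x) 2 (sideMeasure s) :=
      hbary.ae_eq (EventuallyEq.symm hae)
    have h1 := abs_integral_mul_le (hg s hs) hJ
    have h2 : l2n (sideMeasure s) (fun x => J s * D.mesh.hat p x) ≤
        1 * l2n (sideMeasure s) (fun _ : E => J s) := by
      refine l2n_mono (memLp_const _) zero_le_one (Eventually.of_forall fun x => ?_)
      rw [norm_mul, Real.norm_of_nonneg (hat_nonneg p x), one_mul]
      exact mul_le_of_le_one_right (norm_nonneg _) (hat_le_one p x)
    have h3 : l2n (sideMeasure s) (fun _ : E => J s) ≤ R := by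
      rw [l2n_eq_sqrt (memLp_const _)]
      refine Real.sqrt_le_sqrt ?_
      simp_rw [Real.norm_eq_abs, sq_abs]
      exact Finset.single_le_sum (f := fun s => ∫ _, J s ^ 2 ∂(sideMeasure s))
        (fun s _ => integral_nonneg fun _ => sq_nonneg _) hs
    rw [← integral_const_mul]
    have heq : ∫ x, J s * (g s x * D.mesh.hat p x) ∂(sideMeasure s) =
        ∫ x, g s x * (J s * D.mesh.hat p x) ∂(sideMeasure s) := by
      congr 1
      ext x
      ring
    rw [heq]
    refine h1.trans (mul_le_mul (hB s hs hps) ?_ (l2n_nonneg _) hB0)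
    linarith
  have hR : 0 ≤ B * R := mul_nonneg hB0 (Real.sqrt_nonneg _)
  refine (Finset.abs_sum_le_sum_abs _ _).trans ?_
  rw [← Finset.sum_filter_add_sum_filter_not S (p ∈ ·)]
  have hz : ∑ s ∈ S.filter (¬ p ∈ ·), |J s * ∫ x, g s x * D.mesh.hat p x ∂(sideMeasure s)| = 0 := by
    refine Finset.sum_eq_zero fun s hs => ?_
    rw [Finset.mem_filter] at hs
    rw [integral_side_hat_eq_zero (hS hs.1) hs.2, mul_zero, abs_zero]
  rw [hz, add_zero]
  refine (Finset.sum_le_card_nsmul _ _ (B * R) fun s hs => ?_).trans ?_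
  · rw [Finset.mem_filter] at hs
    exact hterm s hs.1 hs.2
  · rw [nsmul_eq_mul]
    gcongr

omit h in
-- Each side at `p` is one of the three sides of an element at `p`.
theorem card_sides_le {ρ : ℝ} (hρ : D.mesh.ShapeRegular ρ) {p : E} (hp : p ∈ D.mesh.nodes)
    {S : Finset (Finset E)} (hS : S ⊆ D.mesh.sides) :
    (S.filter (p ∈ ·)).card ≤ maxElems ρ * 3 := by
  classical
  have hsub : S.filter (p ∈ ·) ⊆ (D.mesh.elemsAt {p}).biUnion (Finset.powersetCard 2) := by
    intro s hs
    rw [Finset.mem_filter] at hs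
    obtain ⟨T, hT, hsT, hc⟩ := D.mesh.mem_sides.mp (hS hs.1)
    rw [Finset.mem_biUnion]
    exact ⟨T, mem_elemsAt_singleton.mpr ⟨hT, hsT hs.2⟩, Finset.mem_powersetCard.mpr ⟨hsT, hc⟩⟩
  refine (Finset.card_le_card hsub).trans (Finset.card_biUnion_le_card_mul _ _ 3 fun T hT => ?_) |>.trans ?_
  · rw [Finset.card_powersetCard, D.mesh.card_eq T (elemsAt_subset _ hT)]
    decide
  · gcongr
    exact hρ.card_le hp

/-- The constant in the local estimate. -/
def _root_.PhaseField.localConst (ρ : ℝ) : ℝ := patchConst ρ + (maxElems ρ * 3 : ℕ) * traceConst ρ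

omit h in
theorem _root_.PhaseField.localConst_nonneg (ρ : ℝ) : 0 ≤ localConst ρ := by
  have := (patchConst_pos ρ).le
  unfold localConst traceConst
  positivity

open Classical in
-- After integration by parts, Cauchy–Schwarz is applied on the patch and on each side. The bound `0
-- ≤ φ_p ≤ 1` discards the basis function, and the approximation estimates for `ψ - c_p(ψ)` supply
-- the weights.
theorem abs_force_sub_mean_le {ρ : ℝ} (hρ : D.mesh.ShapeRegular ρ) {p : E} (hp : p ∈ D.mesh.nodes)
    {ψ : E → ℝ} (hψ : MemH1 Ω ψ) :
    |D.force D.phih (fun x => (ψ x - D.mesh.weightedMean p ψ) * D.mesh.hat p x)| ≤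
      localConst ρ * (D.eta1Loc p + D.eta2Loc p + if p ∈ frontier Ω then D.eta3Loc p else 0) *
        D.localNorm (volume.restrict (D.mesh.patch {p})) ψ := by
  have hfin := h.isFiniteMeasure_domain
  set c := D.mesh.weightedMean p ψ with hc
  set μ := (volume : Measure E).restrict (D.mesh.patch {p}) with hμ
  set e := D.localNorm μ ψ with he
  have he0 : 0 ≤ e := h.localNorm_nonneg _ _
  have hw := h.weight_pos hp
  have hg := h.diffusion_pos
  set B := traceConst ρ * (D.weight p ^ (1 / 2 : ℝ) * (D.Gc * D.eps) ^ (-(1 / 4) : ℝ)) * e with hB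
  have hB0 : 0 ≤ B := by
    rw [hB]
    unfold traceConst
    positivity
  have hψc : MemLp (fun x => ψ x - c) 2 (volume.restrict Ω) := memLp_fun_sub hψ.1 (memLp_const c)
  rw [h.force_mul_hat hψc hψ.hasL2WeakGrad.1 (hasSideTraces_sub_const h.domain hψ c) p]
  have hmem : ∀ s ∈ D.mesh.sides, MemLp (fun x => trace (D.mesh.patch s) s ψ x - c) 2 (sideMeasure s) := by
    intro s hs
    have := isFiniteMeasure_side (D.mesh.mem_sides.mp hs).choose_spec.2.2
    exact memLp_fun_sub (isTrace_trace h.domain hψ hs).1 (memLp_const c)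
  have hvol : |∫ x in D.mesh.patch {p}, D.residual x * (ψ x - c) * D.mesh.hat p x| ≤
      patchConst ρ * D.eta1Loc p * e := by
    have m1 := h.memLp_residual.mono_measure (restrict_patch_le (M := D.mesh) h.domain {p})
    have m2 := hψc.mono_measure (restrict_patch_le (M := D.mesh) h.domain {p})
    have m3 : MemLp (fun x => (ψ x - c) * D.mesh.hat p x) 2 μ := by
      have := ((isP1_hat (M := D.mesh) p).memLp_smul h.domain hψc).mono_measure (restrict_patch_le (M := D.mesh) h.domain {p})
      simpa [mul_comm, smul_eq_mul] using this
    simp_rw [mul_assoc]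
    refine (abs_integral_mul_le m1 m3).trans ?_
    have h1 : l2n μ (fun x => (ψ x - c) * D.mesh.hat p x) ≤ 1 * l2n μ (fun x => ψ x - c) := by
      refine l2n_mono m2 zero_le_one (Eventually.of_forall fun x => ?_)
      rw [norm_mul, Real.norm_of_nonneg (hat_nonneg p x), one_mul]
      exact mul_le_of_le_one_right (norm_nonneg _) (hat_le_one p x)
    have h2 := h.l2n_sub_mean_le hρ hp hψ
    have h3 : l2n μ D.residual = √(∫ x in D.mesh.patch {p}, D.residual x ^ 2) := by
      rw [l2n_eq_sqrt m1]
      simp_rw [Real.norm_eq_abs, sq_abs]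
    rw [h3, eta1Loc]
    rw [one_mul] at h1
    calc _ ≤ √(∫ x in D.mesh.patch {p}, D.residual x ^ 2) * (patchConst ρ * D.weight p * e) := by
          gcongr
          exact h1.trans h2
      _ = _ := by ring
  have htr : ∀ s ∈ D.mesh.sides, p ∈ s →
      l2n (sideMeasure s) (fun x => trace (D.mesh.patch s) s ψ x - c) ≤ B :=
    fun s hs hps => h.l2n_trace_sub_mean_le hρ hp hψ hs hps
  have hsk := h.abs_sum_sides_le (skeleton_subset p) (card_sides_le hρ hp (skeleton_subset p))
    (fun s hs => hmem s (skeleton_subset p hs)) hB0 (fun s hs => htr s (skeleton_subset p hs))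
    (fun s => D.Gc * D.eps * normalJump D.mesh D.phih s)
  have hbd : |∑ s ∈ D.mesh.boundarySkeleton p, D.Gc * D.eps * normalJump D.mesh D.phih s *
      ∫ x, (trace (D.mesh.patch s) s ψ x - c) * D.mesh.hat p x ∂(sideMeasure s)| ≤
      (maxElems ρ * 3 : ℕ) * traceConst ρ * (if p ∈ frontier Ω then D.eta3Loc p else 0) * e := by
    by_cases hpf : p ∈ frontier Ω
    · rw [if_pos hpf]
      refine (h.abs_sum_sides_le (boundarySkeleton_subset p)
        (card_sides_le hρ hp (boundarySkeleton_subset p))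
        (fun s hs => hmem s (boundarySkeleton_subset p hs)) hB0
        (fun s hs => htr s (boundarySkeleton_subset p hs))
        (fun s => D.Gc * D.eps * normalJump D.mesh D.phih s)).trans (le_of_eq ?_)
      rw [hB, eta3Loc]
      ring
    -- At an interior node no boundary side contains `p`, so `φ_p` vanishes on the whole boundary
    -- skeleton and the third indicator is not needed.
    · have hpΩ : p ∈ Ω := by
        by_contra hn
        refine hpf ?_
        rw [h.domain.isOpen.frontier_eq]
        exact ⟨mem_closure_of_node hp, hn⟩
      rw [if_neg hpf, Finset.sum_eq_zero, abs_zero, mul_zero, zero_mul]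
      intro s hs
      rw [integral_side_hat_eq_zero (boundarySkeleton_subset p hs)
        (notMem_of_boundarySkeleton h.domain hpΩ hs), mul_zero]
  have hsk' : |∑ s ∈ D.mesh.skeleton p, D.Gc * D.eps * normalJump D.mesh D.phih s *
      ∫ x, (trace (D.mesh.patch s) s ψ x - c) * D.mesh.hat p x ∂(sideMeasure s)| ≤
      (maxElems ρ * 3 : ℕ) * traceConst ρ * D.eta2Loc p * e := by
    refine hsk.trans (le_of_eq ?_)
    rw [hB, eta2Loc]
    ring
  have e1 : 0 ≤ D.eta1Loc p := mul_nonneg hw.le (Real.sqrt_nonneg _)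
  have e2 : 0 ≤ D.eta2Loc p := by unfold eta2Loc; positivity
  have e3 : 0 ≤ if p ∈ frontier Ω then D.eta3Loc p else 0 := by
    split_ifs
    · unfold eta3Loc; positivity
    · exact le_rfl
  set e3' := if p ∈ frontier Ω then D.eta3Loc p else 0
  have hP := (patchConst_pos ρ).le
  have hT : 0 ≤ (maxElems ρ * 3 : ℕ) * traceConst ρ := by unfold traceConst; positivity
  refine (abs_sub _ _).trans (add_le_add ((abs_sub _ _).trans (add_le_add hvol hsk')) hbd) |>.trans ?_
  rw [localConst]
  nlinarith [mul_nonneg (mul_nonneg hP e2) he0, mul_nonneg (mul_nonneg hP e3) he0,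
    mul_nonneg (mul_nonneg hT e1) he0]

/-- Every element belongs to the patches of exactly its three vertices. -/
theorem sum_localNorm_sq_le {ψ : E → ℝ} (hψ : MemH1 Ω ψ) {S : Finset E} (hS : S ⊆ D.mesh.nodes) :
    ∑ p ∈ S, D.localNorm (volume.restrict (D.mesh.patch {p})) ψ ^ 2 ≤ 3 * D.energyNorm ψ ^ 2 := by
  have hG := hψ.hasL2WeakGrad.1
  have hq := h.memLp_coeff_mul Real.sqrt hψ.1
  refine (Finset.sum_le_sum_of_subset_of_nonneg hS fun _ _ _ => sq_nonneg _).trans (le_of_eq ?_)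
  have key : ∀ {F : Type} [NormedAddCommGroup F] [InnerProductSpace ℝ F] {f : E → F},
      MemLp f 2 (volume.restrict Ω) →
      ∑ p ∈ D.mesh.nodes, l2n (volume.restrict (D.mesh.patch {p})) f ^ 2 =
        3 * l2n (volume.restrict Ω) f ^ 2 := by
    intro F _ _ f hf
    have hi := hf.norm.integrable_sq
    rw [l2n_sq hf, integral_domain (M := D.mesh) h.domain hi, Finset.mul_sum]
    have h1 : ∀ p ∈ D.mesh.nodes, l2n (volume.restrict (D.mesh.patch {p})) f ^ 2 =
        ∑ T ∈ D.mesh.elemsAt {p}, ∫ x in hull T, ‖f x‖ ^ 2 := by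
      intro p _
      rw [l2n_sq (hf.mono_measure (restrict_patch_le (M := D.mesh) h.domain {p})), restrict_patch,
        integral_finsetSum_measure fun T hT =>
          Integrable.mono_measure hi (restrict_hull_le h.domain (elemsAt_subset _ hT))]
    rw [Finset.sum_congr rfl h1, Finset.sum_comm' (s' := fun T => T) (t' := D.mesh.elems)]
    · refine Finset.sum_congr rfl fun T hT => ?_
      rw [Finset.sum_const, D.mesh.card_eq T hT, nsmul_eq_mul]
      norm_num
    · intro p T
      rw [mem_elemsAt_singleton, mem_nodes]
      exact ⟨fun ⟨_, a, b⟩ => ⟨b, a⟩, fun ⟨a, b⟩ => ⟨⟨T, b, a⟩, b, a⟩⟩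
  simp_rw [h.localNorm_sq, Finset.sum_add_distrib, ← Finset.mul_sum]
  rw [key hG, key hq, h.energyNorm_eq hψ, h.localNorm_sq]
  ring

open Classical in
/-- The residual part of the estimator bounds the part of the residual that is not represented by the
quasi-discrete constraining force. -/
theorem abs_force_sub_quasiForce_le {ρ : ℝ} (hρ : D.mesh.ShapeRegular ρ) (hsol : D.IsDiscreteSolution)
    {ψ : E → ℝ} (hψ : MemH1 Ω ψ) : |D.force D.phih ψ - D.quasiForce ψ| ≤
      2 * localConst ρ * (D.eta1 + D.eta2 + D.eta3) * D.energyNorm ψ := by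
  set S := D.mesh.nodes.filter (¬ D.IsFullContact ·) with hS
  have hSn : S ⊆ D.mesh.nodes := Finset.filter_subset _ _
  set e : E → ℝ := fun p => D.localNorm (volume.restrict (D.mesh.patch {p})) ψ with he
  -- The overlap constant `√3` is rounded up to 2.
  have hE : √(∑ p ∈ S, e p ^ 2) ≤ 2 * D.energyNorm ψ := by
    refine Real.sqrt_le_iff.mpr ⟨mul_nonneg zero_le_two (Real.sqrt_nonneg _), ?_⟩
    refine (h.sum_localNorm_sq_le hψ hSn).trans ?_
    nlinarith [sq_nonneg (D.energyNorm ψ)]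
  have hL := localConst_nonneg ρ
  have cs : ∀ a : E → ℝ, ∑ p ∈ S, a p * e p ≤ √(∑ p ∈ S, a p ^ 2) * (2 * D.energyNorm ψ) := fun a =>
    (Real.sum_mul_le_sqrt_mul_sqrt _ _ _).trans (mul_le_mul_of_nonneg_left hE (Real.sqrt_nonneg _))
  have h3 : ∑ p ∈ S, (if p ∈ frontier Ω then D.eta3Loc p else 0) ^ 2 =
      ∑ p ∈ D.mesh.boundaryNodes.filter (¬ D.IsFullContact ·), D.eta3Loc p ^ 2 := by
    simp_rw [ite_pow]
    rw [zero_pow two_ne_zero, ← Finset.sum_filter]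
    refine Finset.sum_congr ?_ fun _ _ => rfl
    ext p
    simp only [hS, boundaryNodes, Finset.mem_filter]
    tauto
  rw [h.force_sub_quasiForce hsol hψ]
  refine (Finset.abs_sum_le_sum_abs _ _).trans ?_
  refine (Finset.sum_le_sum fun p hp => h.abs_force_sub_mean_le hρ (hSn hp) hψ).trans ?_
  have c1 := cs D.eta1Loc
  have c2 := cs D.eta2Loc
  have c3 := cs fun p => if p ∈ frontier Ω then D.eta3Loc p else 0
  rw [h3] at c3
  calc ∑ p ∈ S, localConst ρ * (D.eta1Loc p + D.eta2Loc p + if p ∈ frontier Ω then D.eta3Loc p else 0) * e p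
      = localConst ρ * ((∑ p ∈ S, D.eta1Loc p * e p) + (∑ p ∈ S, D.eta2Loc p * e p) +
          ∑ p ∈ S, (if p ∈ frontier Ω then D.eta3Loc p else 0) * e p) := by
        rw [← Finset.sum_add_distrib, ← Finset.sum_add_distrib, Finset.mul_sum]
        refine Finset.sum_congr rfl fun p _ => ?_
        ring
    _ ≤ localConst ρ * (D.eta1 * (2 * D.energyNorm ψ) + D.eta2 * (2 * D.energyNorm ψ) +
          D.eta3 * (2 * D.energyNorm ψ)) :=
        mul_le_mul_of_nonneg_left (add_le_add (add_le_add c1 c2) c3) hL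
    _ = _ := by ring

end Step.IsAdmissible

/-! ### Contact nodes -/

theorem MemH1.congr {U : Set E} {ψ ψ' : E → ℝ} (hψ : MemH1 U ψ) (h : ψ =ᵐ[volume.restrict U] ψ') :
    MemH1 U ψ' :=
  ⟨hψ.1.ae_eq h, _, hψ.hasL2WeakGrad.congr h (EventuallyEq.refl _ _)⟩

namespace Triangulation

variable {Ω : Set E} {M : Triangulation Ω}

theorem ae_mem_patch_of_hat_ne_zero (M : Triangulation Ω) (p : E) :
    ∀ᵐ x ∂(volume : Measure E), M.hat p x ≠ 0 → x ∈ M.patch {p} := by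
  have h1 := biUnion_ae_eq (M := M) (elemsAt_subset {p}) (fun T hT => interior_hull_subset_patch hT)
    (patch_subset_biUnion {p})
  filter_upwards [h1] with x hx hne
  obtain ⟨T, hT, hxT⟩ := exists_mem_of_hat_ne_zero hne
  exact (Eq.mpr hx (Set.mem_biUnion hT hxT) : M.patch {p} x)

/-- Products with nodal basis functions, extended by zero. -/
theorem memH1_ambient_mul_hat (hΩ : IsPolygonalDomain Ω) {ψ : E → ℝ} (hψ : MemH1 Ω ψ) (p : E) :
    MemH1 (Step.ambient Ω p) (fun x => ψ x * M.hat p x) := by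
  by_cases hp : p ∈ Ω
  · rw [Step.ambient, if_pos hp]
    refine ⟨?_, _, (hasSideTraces (M := M) hΩ hψ).hasL2WeakGrad_mul_hat hψ.1 hψ.hasL2WeakGrad.1 hΩ hp⟩
    rw [Measure.restrict_univ]
    refine ((memLp_indicator_iff_restrict hΩ.isOpen.measurableSet).mpr
      (memH1_mul_hat (M := M) hΩ hψ p).1).ae_eq ?_
    filter_upwards [ae_mem_patch_of_hat_ne_zero M p] with x hx
    by_cases hxΩ : x ∈ Ω
    · rw [Set.indicator_of_mem hxΩ]
    · rw [Set.indicator_of_notMem hxΩ]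
      by_cases h0 : M.hat p x = 0
      · rw [h0, mul_zero]
      · exact absurd (patch_subset hΩ _ (hx h0)) hxΩ
  · rw [Step.ambient, if_neg hp]
    exact memH1_mul_hat hΩ hψ p

end Triangulation

namespace Step.IsAdmissible

variable {Ω : Set E} {D : Step Ω} (h : D.IsAdmissible)
include h

open Triangulation

/-- Both functions are affine on each element, so the inequality at the vertices extends by convex
combination. The discrete solution is therefore feasible for the continuous problem. -/
theorem phih_le_obstacle (hsol : D.IsDiscreteSolution) {x : E} (hx : x ∈ Ω) :
    D.phih x ≤ D.obstacle x := by
  obtain ⟨T, hT, hxT⟩ := exists_hull (M := D.mesh) (subset_closure hx)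
  rw [h.isP1_phih.eq_sum hT hxT, obstacle, (isP1_interp D.phiPrev).eq_sum hT hxT]
  refine Finset.sum_le_sum fun q hq => mul_le_mul_of_nonneg_left ?_ (bary_nonneg hT hxT q)
  exact hsol.1.2 q (D.mesh.mem_nodes.mpr ⟨T, hT, hq⟩)

theorem feasible_phih (hsol : D.IsDiscreteSolution) : D.Feasible D.phih :=
  ⟨h.memH1_phih, (ae_restrict_iff' h.domain.isOpen.measurableSet).mpr
    (Eventually.of_forall fun _ hx => h.phih_le_obstacle hsol hx)⟩

/-- On the patch `φ_h` equals the obstacle, so `(φ_h - φ) φ_p` is nonnegative almost everywhere and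
is a local test function. The sign condition of full contact applies to it, and the sign flips for
`φ - φ_h`. -/
theorem fullForce_nonpos {φ : E → ℝ} (hφ : D.Feasible φ) {p : E} (hp : D.IsFullContact p) :
    D.fullForce p (fun x => φ x - D.phih x) ≤ 0 := by
  have hd : MemH1 Ω (fun x => D.phih x - φ x) := h.memH1_phih.sub hφ.1
  -- Test functions in the definition of full contact must be nonnegative everywhere, whereas
  -- feasibility holds only almost everywhere. The absolute value repairs this on a null set.
  have hae : ∀ᵐ x ∂(volume : Measure E), (D.phih x - φ x) * D.mesh.hat p x =
      |(D.phih x - φ x) * D.mesh.hat p x| := by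
    have h1 := (ae_restrict_iff' h.domain.isOpen.measurableSet).mp hφ.2
    filter_upwards [h1, ae_mem_patch_of_hat_ne_zero D.mesh p] with x hx1 hx2
    by_cases h0 : D.mesh.hat p x = 0
    · rw [h0, mul_zero, abs_zero]
    · have hxp := hx2 h0
      have hle := hx1 (patch_subset h.domain _ hxp)
      rw [← hp.2.1 x hxp] at hle
      rw [abs_of_nonneg (mul_nonneg (sub_nonneg.mpr hle) (hat_nonneg p x))]
  have htest : D.IsLocalTest p (fun x => |(D.phih x - φ x) * D.mesh.hat p x|) := by
    refine ⟨(memH1_ambient_mul_hat h.domain hd p).congr (ae_restrict_of_ae hae), ?_⟩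
    have hm : MeasurableSet (ambient Ω p \ D.mesh.patch {p}) := by
      refine MeasurableSet.diff ?_ (isOpen_patch _).measurableSet
      unfold ambient
      split_ifs
      · exact MeasurableSet.univ
      · exact h.domain.isOpen.measurableSet
    rw [ae_restrict_iff' hm]
    filter_upwards [ae_mem_patch_of_hat_ne_zero D.mesh p] with x hx hxm
    by_cases h0 : D.mesh.hat p x = 0
    · rw [h0, mul_zero, abs_zero]
    · exact absurd (hx h0) hxm.2
  have hpos := hp.2.2 _ htest fun x => abs_nonneg _
  have hm := memH1_mul_hat (M := D.mesh) h.domain hd p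
  rw [← h.force_congr D.phih hm (ae_restrict_of_ae hae)] at hpos
  rw [h.fullForce_eq (hφ.1.sub h.memH1_phih)]
  have := h.force_const_mul h.memH1_phih hm (-1)
  have heq : (fun x => (φ x - D.phih x) * D.mesh.hat p x) =
      fun x => -1 * ((D.phih x - φ x) * D.mesh.hat p x) := by ext x; ring
  rw [heq, this]
  linarith

theorem memLp_obstacle : MemLp D.obstacle 2 (volume.restrict Ω) :=
  ((isP1_interp (M := D.mesh) D.phiPrev).memLp h.domain).1

theorem nodeForce_mul (hsol : D.IsDiscreteSolution) {p : E} (hp : p ∈ D.mesh.nodes) :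
    0 ≤ D.nodeForce p ∧
      D.force D.phih (D.mesh.hat p) = D.nodeForce p * ∫ x in D.mesh.patch {p}, D.mesh.hat p x :=
  ⟨div_nonneg (h.force_hat_nonneg hsol p) (integral_hat_patch_pos hp).le,
    (div_mul_cancel₀ _ (integral_hat_patch_pos hp).ne').symm⟩

/-- The nodal residual is nonnegative, so the weighted mean of `φ - φ_h` may be replaced by that of
the obstacle gap. The factor `64 / 3` compares the integral of `φ_p` over the patch, which enters
through `s_p`, with its integral over the refined patch, which normalizes the mean. -/
theorem semiForce_le (hsol : D.IsDiscreteSolution) {φ : E → ℝ} (hφ : D.Feasible φ) {p : E}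
    (hp : p ∈ D.mesh.nodes) :
    D.semiForce p (fun x => φ x - D.phih x) ≤ 64 / 3 * D.eta4Loc p ^ 2 := by
  set ν := (volume : Measure E).restrict (D.mesh.smallPatch p)
  have hsub : D.mesh.smallPatch p ⊆ Ω := (smallPatch_subset p).trans (patch_subset h.domain _)
  have hle : ν ≤ volume.restrict Ω := Measure.restrict_mono hsub le_rfl
  have hhat := memLp_hat_smallPatch (M := D.mesh) p
  set Y := ∫ x in D.mesh.smallPatch p, (D.obstacle x - D.phih x) * D.mesh.hat p x with hY
  set V := (volume : Measure E).real (D.mesh.patch {p})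
  have hV : 0 < V := measureReal_patch_pos hp
  have hI := integral_hat_smallPatch_ge (M := D.mesh) p
  have hI2 := integral_hat_patch_le (M := D.mesh) p
  obtain ⟨hs, hf⟩ := h.nodeForce_mul hsol hp
  have hY0 : 0 ≤ Y := by
    refine setIntegral_nonneg (isOpen_smallPatch p).measurableSet fun x hx => ?_
    exact mul_nonneg (sub_nonneg.mpr (h.phih_le_obstacle hsol (hsub hx))) (hat_nonneg p x)
  have hmono : ∫ x in D.mesh.smallPatch p, (φ x - D.phih x) * D.mesh.hat p x ≤ Y := by
    refine integral_mono_ae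
      (integrable_mul_of_memLp ((memLp_fun_sub hφ.1.1 h.memH1_phih.1).mono_measure hle) hhat)
      (integrable_mul_of_memLp ((memLp_fun_sub h.memLp_obstacle h.memH1_phih.1).mono_measure hle) hhat) ?_
    filter_upwards [ae_mono hle hφ.2] with x hx
    exact mul_le_mul_of_nonneg_right (sub_le_sub_right hx _) (hat_nonneg p x)
  have hIpos : 0 < ∫ x in D.mesh.smallPatch p, D.mesh.hat p x := by linarith
  have hmean : D.mesh.weightedMean p (fun x => φ x - D.phih x) ≤
      Y / ∫ x in D.mesh.smallPatch p, D.mesh.hat p x := div_le_div_of_nonneg_right hmono hIpos.le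
  have h4 : D.eta4Loc p ^ 2 = D.nodeForce p * Y := by
    rw [eta4Loc, Real.sq_sqrt (mul_nonneg hs hY0)]
  rw [h.semiForce_eq, h.force_const_mul h.memH1_phih (h.memH1_hat p), h4]
  refine (mul_le_mul_of_nonneg_right hmean (h.force_hat_nonneg hsol p)).trans ?_
  rw [hf, div_mul_eq_mul_div, div_le_iff₀ hIpos]
  have hA : ∫ x in D.mesh.patch {p}, D.mesh.hat p x ≤
      64 / 3 * ∫ x in D.mesh.smallPatch p, D.mesh.hat p x := by linarith
  calc _ = D.nodeForce p * Y * ∫ x in D.mesh.patch {p}, D.mesh.hat p x := by ring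
    _ ≤ D.nodeForce p * Y * (64 / 3 * ∫ x in D.mesh.smallPatch p, D.mesh.hat p x) :=
        mul_le_mul_of_nonneg_left hA (mul_nonneg hs hY0)
    _ = _ := by ring

open Classical in
theorem quasiForce_le (hsol : D.IsDiscreteSolution) {φ : E → ℝ} (hφ : D.Feasible φ) :
    D.quasiForce (fun x => φ x - D.phih x) ≤ 64 / 3 * D.eta4 ^ 2 := by
  have h1 : ∑ p ∈ D.mesh.nodes.filter (D.IsSemiContact ·), D.semiForce p (fun x => φ x - D.phih x) ≤
      64 / 3 * D.eta4 ^ 2 := by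
    rw [eta4, Real.sq_sqrt (Finset.sum_nonneg fun _ _ => sq_nonneg _), Finset.mul_sum]
    exact Finset.sum_le_sum fun p hp => h.semiForce_le hsol hφ (Finset.mem_filter.mp hp).1
  have h2 : ∑ p ∈ D.mesh.nodes.filter (D.IsFullContact ·), D.fullForce p (fun x => φ x - D.phih x) ≤ 0 :=
    Finset.sum_nonpos fun p hp => h.fullForce_nonpos hφ (Finset.mem_filter.mp hp).2
  rw [quasiForce]
  linarith

/-! ### Reliability -/

theorem bilin_sub_left {ζ ξ ψ : E → ℝ} (hζ : MemH1 Ω ζ) (hξ : MemH1 Ω ξ) (hψ : MemH1 Ω ψ) :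
    D.bilin (fun x => ζ x - ξ x) ψ = D.bilin ζ ψ - D.bilin ξ ψ := by
  have := h.bilin_linear_comb hψ hζ hξ 1 (-1)
  rw [h.bilin_comm (fun x => ζ x - ξ x), h.bilin_comm ζ, h.bilin_comm ξ]
  simpa [sub_eq_add_neg] using this

theorem force_eq_sub_bilin {φ ψ : E → ℝ} (hφ : MemH1 Ω φ) (hψ : MemH1 Ω ψ) :
    D.force φ ψ = D.force D.phih ψ - D.bilin (fun x => φ x - D.phih x) ψ := by
  rw [h.bilin_sub_left hφ h.memH1_phih hψ, force, force]
  ring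

/-- The squared norm is the difference of residual and constraining force tested with the error. The
constraining force has the good sign, because `φ_h` is a competitor in the continuous problem, and
the residual is at most `B N + 64 / 3 * η₄ ^ 2`. Solving this quadratic inequality gives the claim.
-/
theorem energyNorm_error_le {ρ : ℝ} (hρ : D.mesh.ShapeRegular ρ) (hsol : D.IsDiscreteSolution) {φ : E → ℝ}
    (hφ : D.IsAuxSolution φ) : D.energyNorm (fun x => φ x - D.phih x) ≤
      2 * localConst ρ * (D.eta1 + D.eta2 + D.eta3) + 5 * D.eta4 := by
  have he := hφ.1.1.sub h.memH1_phih
  set N := D.energyNorm (fun x => φ x - D.phih x)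
  have hN : N ^ 2 = D.force D.phih (fun x => φ x - D.phih x) - D.force φ (fun x => φ x - D.phih x) := by
    rw [h.force_eq_sub_bilin hφ.1.1 he, ← h.energyNorm_sq he]
    ring
  have hG := (le_abs_self _).trans (h.abs_force_sub_quasiForce_le hρ hsol he)
  have hQ := h.quasiForce_le hsol hφ.1
  have hneg : 0 ≤ D.force φ (fun x => φ x - D.phih x) := by
    have h1 := hφ.2 _ (h.feasible_phih hsol)
    have h2 := h.force_const_mul hφ.1.1 he (-1)
    have heq : (fun x => D.phih x - φ x) = fun x => -1 * (φ x - D.phih x) := by ext x; ring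
    rw [heq] at h1
    rw [force] at h2
    linarith
  have hN0 : 0 ≤ N := Real.sqrt_nonneg _
  have h40 : 0 ≤ D.eta4 := Real.sqrt_nonneg _
  set B := 2 * localConst ρ * (D.eta1 + D.eta2 + D.eta3)
  have hB : 0 ≤ B := by
    have := localConst_nonneg ρ
    have : 0 ≤ D.eta1 := Real.sqrt_nonneg _
    have : 0 ≤ D.eta2 := Real.sqrt_nonneg _
    have : 0 ≤ D.eta3 := Real.sqrt_nonneg _
    positivity
  -- If `N > B + 5 η₄`, then `N ^ 2 > B N + 25 η₄ ^ 2`, and `25` exceeds `64 / 3`.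
  by_contra! hcon
  nlinarith [mul_pos (show 0 < N - B - 5 * D.eta4 by linarith) (show 0 < N by linarith),
    mul_nonneg h40 hB, mul_nonneg h40 h40]

/-- The force error equals the residual not represented by the quasi-discrete force, minus the form
applied to the error. The first is bounded by `B`, the second by the energy error through
Cauchy–Schwarz. -/
theorem reliability {ρ : ℝ} (hρ : D.mesh.ShapeRegular ρ) (hsol : D.IsDiscreteSolution) {φ : E → ℝ}
    (hφ : D.IsAuxSolution φ) :
    ENNReal.ofReal (D.energyNorm fun x => φ x - D.phih x)
        + D.dualNorm (fun ψ => D.force φ ψ - D.quasiForce ψ)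
      ≤ ENNReal.ofReal ((6 * localConst ρ + 10) * D.eta) := by
  have he := hφ.1.1.sub h.memH1_phih
  have hN := h.energyNorm_error_le hρ hsol hφ
  set N := D.energyNorm (fun x => φ x - D.phih x)
  have hN0 : 0 ≤ N := Real.sqrt_nonneg _
  have h40 : 0 ≤ D.eta4 := Real.sqrt_nonneg _
  have hL := localConst_nonneg ρ
  have h1 : 0 ≤ D.eta1 := Real.sqrt_nonneg _
  have h2 : 0 ≤ D.eta2 := Real.sqrt_nonneg _
  have h3 : 0 ≤ D.eta3 := Real.sqrt_nonneg _
  set B := 2 * localConst ρ * (D.eta1 + D.eta2 + D.eta3) with hB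
  have hB0 : 0 ≤ B := by positivity
  have hdual : D.dualNorm (fun ψ => D.force φ ψ - D.quasiForce ψ) ≤ ENNReal.ofReal (B + N) := by
    -- The multiplicative form of the bound also settles functions of zero energy norm, for which it
    -- forces the numerator to vanish.
    refine iSup₂_le fun ψ hψ => ENNReal.div_le_of_le_mul ?_
    rw [← ENNReal.ofReal_mul (by positivity)]
    refine ENNReal.ofReal_le_ofReal ?_
    have e1 := h.abs_force_sub_quasiForce_le hρ hsol hψ
    have e2 := h.abs_bilin_le he hψ
    beta_reduce
    rw [h.force_eq_sub_bilin hφ.1.1 hψ, sub_right_comm, add_mul]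
    exact (abs_sub _ _).trans (add_le_add e1 e2)
  calc _ ≤ ENNReal.ofReal N + ENNReal.ofReal (B + N) := by gcongr
    _ = ENNReal.ofReal (N + (B + N)) := (ENNReal.ofReal_add hN0 (by positivity)).symm
    _ ≤ _ := by
      refine ENNReal.ofReal_le_ofReal ?_
      rw [eta]
      -- The total is `2 N + B ≤ 3 B + 10 η₄` with `B = 2 * localConst ρ * (η₁ + η₂ + η₃)`, which
      -- explains the 6 and the 10.
      nlinarith [mul_nonneg hL h40]

end Step.IsAdmissible

end PhaseField

end

theorem theorem1 (ρ : ℝ) :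
    ∃ C : ℝ, 0 < C ∧
      ∀ (Ω : Set PhaseField.E), PhaseField.IsPolygonalDomain Ω →
      ∀ D : PhaseField.Step Ω, D.mesh.ShapeRegular ρ →
        0 < D.Gc → 0 < D.eps → 0 < D.kappa → D.kappa < 1 → 0 < D.mu → 0 < D.lam →
        D.mesh.IsP1 D.uh → D.IsDiscreteSolution →
      ∀ φhat : PhaseField.E → ℝ, D.IsAuxSolution φhat →
        ENNReal.ofReal (D.energyNorm fun x => φhat x - D.phih x)
            + D.dualNorm (fun ψ => D.force φhat ψ - D.quasiForce ψ)
          ≤ ENNReal.ofReal (C * D.eta) := by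
  refine ⟨6 * PhaseField.localConst ρ + 10, by
    have := PhaseField.localConst_nonneg ρ
    positivity, ?_⟩
  intro Ω hΩ D hρ hGc heps _ hkappa hmu hlam huh hsol φhat hφ
  exact PhaseField.Step.IsAdmissible.reliability ⟨hΩ, hGc, heps, hkappa, hmu, hlam, huh, hsol.1.1⟩ hρ hsol hφ
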